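/- **Theorem.** Let $\mathbb T^2=[0,2\pi)^2$ carry the normalized Lebesgue measure $d\mu=(2\pi)^{-2}d\mathbf x$, and let all functions be $2\pi$-periodic in each of the two variables and $\mathbb K$-valued, where $\mathbb K=\mathbb R$ or $\mathbb K=\mathbb C$; $\|\cdot\|_p$ is the norm of $L_p(\mathbb T^2,\mu)$. For $r>0$ put $l=[r]+1$. For $t\in\mathbb R$ let $\Delta^l_{t,j}$ be the $l$-th difference with step $t$ in the variable $x_j$ (the $l$-th iterate of $f\mapsto f(\cdot+t\mathbf e_j)-f$), and for $e\subseteq\{1,2\}$ and $\mathbf t=(t_1,t_2)\in\mathbb R^2$ let $\Delta^l_{\mathbf t}(e)=\prod_{j\in e}\Delta^l_{t_j,j}$, with $\Delta^l_{\mathbf t}(\varnothing)=I$. For $1\le p\le\infty$ let $\mathbf H^r_p$ be the class of continuous functions $f$ such that $$\bigl\|\Delta^l_{\mathbf t}(e)f\bigr\|_p\le\prod_{j\in e}|t_j|^r\qquad\text{for all } e\subseteq\{1,2\}\text{ and all }\mathbf t\in\mathbb R^2 .$$ For $m\ge 1$ and points $\xi^1,\dots,\xi^m\in\mathbb T^2$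 put $$E_m(\xi^1,\dots,\xi^m)=\sup_{f\in\mathbf H^r_p}\Bigl|\|f\|_2^2-\frac1m\sum_{j=1}^m|f(\xi^j)|^2\Bigr|,\qquad er_m(\mathbf H^r_p,L_2)=\inf_{\xi^1,\dots,\xi^m\in\mathbb T^2}E_m(\xi^1,\dots,\xi^m).$$ Let $b_0=b_1=1$, $b_n=b_{n-1}+b_{n-2}$ $(n\ge2)$ be the Fibonacci numbers. Let $1\le p\le\infty$ and $r>1/p$ (that is, $r>0$ if $p=\infty$). Then there are constants $0<c\le C<\infty$, independent of $n$, such that for all $n\ge 2$ $$c\,b_n^{-r}\log b_n\;\le\; er_{b_n}(\mathbf H^r_p,L_2)\;\le\; C\,b_n^{-r}\log b_n .$$ Moreover the upper bound is attained by the Fibonacci point sets $\xi^\mu=\bigl(2\pi\mu/b_n,\,2\pi\{\mu b_{n-1}/b_n\}\bigr)$, $\mu=1,\dots,b_n$ (here $\{x\}$ is the fractional part of $x$): for all $n\ge2$, $E_{b_n}(\xi^1,\dots,\xi^{b_n})\le C\,b_n^{-r}\log b_n$. -/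

import Mathlib

open MeasureTheory
open scoped ENNReal Real

noncomputable section

instance factTwoPiPos : Fact ((0 : ℝ) < 2 * π) := ⟨Real.two_pi_pos⟩

/-- The torus `𝕋^d = [0, 2π)^d`, i.e. `(ℝ / 2πℤ)^d`. Functions on it are the functions on `ℝ^d`
that are `2π`-periodic in each variable. -/
abbrev Torus (d : ℕ) : Type := Fin d → AddCircle (2 * π)

/-- The normalized Lebesgue measure `(2π)^{-d} dx` on the torus. -/
def torusMeasure (d : ℕ) : Measure (Torus d) :=
  Measure.pi fun _ => AddCircle.haarAddCircle

instance isProbabilityMeasure_torusMeasure (d : ℕ) : IsProbabilityMeasure (torusMeasure d) := by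
  unfold torusMeasure; infer_instance

/-- The `l`-th difference `Δ^l_{t,j}` with step `t` in the variable `x_j`: the `l`-th iterate of
`g ↦ (x ↦ g (x + t e_j) - g x)`. -/
def coordDiff {𝕜 : Type*} [RCLike 𝕜] {d : ℕ} (l : ℕ) (t : ℝ) (j : Fin d)
    (g : Torus d → 𝕜) : Torus d → 𝕜 :=
  (fwdDiff (Pi.single j (t : AddCircle (2 * π)) : Torus d))^[l] g

/-- The mixed `l`-th difference `Δ^l_t(e) = ∏_{j ∈ e} Δ^l_{t_j,j}`; it is the identity for
`e = ∅`. (The operators commute; they are applied here in the order of increasing `j`.) -/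
def mixedDiff {𝕜 : Type*} [RCLike 𝕜] {d : ℕ} (l : ℕ) (t : Fin d → ℝ) (e : Finset (Fin d))
    (f : Torus d → 𝕜) : Torus d → 𝕜 :=
  (List.finRange d).foldl (fun g j => if j ∈ e then coordDiff l (t j) j g else g) f

/-- The class `H^r_p` of `𝕜`-valued functions on the `d`-dimensional torus, of continuous `f` with
`‖Δ^l_t(e) f‖_p ≤ ∏_{j ∈ e} |t_j|^r` for all `e ⊆ {1, …, d}` and all steps `t`,
where `l = [r] + 1`. -/
def classH (𝕜 : Type*) [RCLike 𝕜] (d : ℕ) (r : ℝ) (p : ℝ≥0∞) : Set C(Torus d, 𝕜) :=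
  {f | ∀ (e : Finset (Fin d)) (t : Fin d → ℝ),
    eLpNorm (mixedDiff (⌊r⌋₊ + 1) t e (⇑f)) p (torusMeasure d)
      ≤ ENNReal.ofReal (∏ j ∈ e, |t j| ^ r)}

section Discretization

variable {𝕜 : Type*} [RCLike 𝕜] {Ω : Type*} [TopologicalSpace Ω] [MeasurableSpace Ω]

/-- The error of discretization of the `L_q(μ)` norm on the class `W` by the points
`ξ^1, …, ξ^m` with equal weights:
`sup_{f ∈ W} | ‖f‖_q^q - (1/m) ∑_j |f(ξ^j)|^q |`, a value in `[0, ∞]`. -/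
def samplingError (μ : Measure Ω) (q : ℝ) (W : Set C(Ω, 𝕜)) {m : ℕ} (ξ : Fin m → Ω) : ℝ≥0∞ :=
  ⨆ f ∈ W, ENNReal.ofReal |(∫ x, ‖f x‖ ^ q ∂μ) - (1 / (m : ℝ)) * ∑ j, ‖f (ξ j)‖ ^ q|

/-- The optimal error `er_m(W, L_q)` of discretization: the infimum of `samplingError` over all
choices of `m` points. -/
def er (μ : Measure Ω) (q : ℝ) (W : Set C(Ω, 𝕜)) (m : ℕ) : ℝ≥0∞ :=
  ⨅ ξ : Fin m → Ω, samplingError μ q W ξ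

end Discretization

/-- The Fibonacci numbers normalized by `b_0 = b_1 = 1`, `b_n = b_{n-1} + b_{n-2}`. -/
def fibB : ℕ → ℕ
  | 0 => 1
  | 1 => 1
  | n + 2 => fibB (n + 1) + fibB n

/-- The points `(2π μ / b_n, 2π {μ b_{n-1} / b_n})`, `μ = 1, …, b_n`, of the `n`-th Fibonacci
cubature formula (`n ≥ 1`); the index `j = 0, …, b_n - 1` stands for `μ = j + 1`. -/
def fibPoint (n : ℕ) (j : Fin (fibB n)) : Torus 2 :=
  ![((2 * π * (((j : ℕ) + 1 : ℝ) / (fibB n : ℝ)) : ℝ) : AddCircle (2 * π)),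
    ((2 * π * Int.fract (((j : ℕ) + 1 : ℝ) * (fibB (n - 1) : ℝ) / (fibB n : ℝ)) : ℝ) :
      AddCircle (2 * π))]

end

noncomputable section

/-! Upper bound. Write b for the number of Fibonacci points. Everything arithmetic is one fact
(`fibB_lattice_le`): a nonzero vector (μ, ν) of the lattice b ∣ μ b_{n-1} - ν satisfies b ≤ 6
max(1,|μ|) max(1,|ν|). It follows from Cassini's identity and the anisotropy of the form k² + kμ -
μ². It is used twice. In frequency, the cubature formula is exact on characters in a small
hyperbolic region (`fibErr_torusChar`). In space, two distinct points differ by at least 1/b in the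
product of coordinate distances (`fibPoint_separated`), so a box grid with sides 1/N₁, 1/N₂ and N₁N₂
≥ b has at most one point per cell, and product kernels at those scales sum over the points as if
the points were spread evenly (`sum_fibPoint_cauchyKer_le`).

A function f of the class is split into dyadic de la Vallée Poussin blocks f_s, s = (s₀, s₁). A
Jackson average of the mixed difference of f agrees up to sign with f on the frequencies of f_s
(`norm_block_avgDiff`), so f_s is a convolution of a concentrated kernel with a function whose L_q
norm is O(2^{-r(s₀+s₁)}). Here q is finite, q ≤ p and q > 1/r. Expanding |f|² gives products f_s ·
conj f_{s'}. The cubature error of such a product vanishes when max(s₀,s'₀) + max(s₁,s'₁) lies below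
a threshold m with 2^m of order b. Otherwise Jensen's inequality and separation bound it by b^{-1/q}
2^{-(r-1/q)(|s|+|s'|)}, with |s| = s₀ + s₁ (`norm_fibErr_block_mul_conj_le`). Since r > 1/q, the sum
over the remaining pairs is dominated by the roughly m pairs of scales with sum m, giving b^{-1/q} ·
m · b^{-(r-1/q)}, of order b^{-r} log b. The bound is uniform in the partial sums, which converge
uniformly to f.

Lower bound, for arbitrary m points. Take 2^N comparable to m with 2^N ≥ 2m. For each a ≤ N cut the
torus into 2^a × 2^{N-a} boxes, put a smooth bump in every box, and discard the bumps that are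
nonzero at some point; at least half survive. The sum G of all layers vanishes at the points and has
integral at least (N+1)/32, yet its mixed differences are only O(2^{rN} ∏|t_j|^r), with no factor N:
for a given step (t₀, t₁) the contributions of the layers decay geometrically away from a critical
one (`exists_sum_min_one_pow_le`). So f = 1/2 + κ 2^{-rN} G lies in the class for every p. The
constant 1/2 makes the error linear in G, so it is at least a multiple of 2^{-rN} N, of order m^{-r}
log m. -/

/-! ### Arithmetic of the Fibonacci lattice -/

theorem fibB_pos (n : ℕ) : 0 < fibB n := by
  induction n using Nat.twoStepInduction with
  | zero => simp [fibB]
  | one => simp [fibB]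
  | more n h1 h2 => rw [fibB]; omega

theorem two_le_fibB {n : ℕ} (hn : 2 ≤ n) : 2 ≤ fibB n := by
  obtain ⟨m, rfl⟩ := Nat.exists_eq_add_of_le' hn
  rw [fibB]
  have := fibB_pos m
  have := fibB_pos (m + 1)
  omega

theorem fibB_cassini (n : ℕ) :
    ((fibB n : ℤ) ^ 2 + fibB n * fibB (n + 1) - (fibB (n + 1) : ℤ) ^ 2) ^ 2 = 1 := by
  induction n with
  | zero => simp [fibB]
  | succ n ih =>
    rw [show fibB (n + 1 + 1) = fibB (n + 1) + fibB n from rfl, ← ih]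
    push_cast
    ring

theorem sq_ne_five_mul_sq {x y : ℤ} (hy : y ≠ 0) : x ^ 2 ≠ 5 * y ^ 2 := by
  intro h
  have hirr := (Nat.Prime.irrational_sqrt (p := 5) (by norm_num))
  apply hirr
  refine ⟨|(x : ℚ) / y|, ?_⟩
  have hy' : (y : ℝ) ≠ 0 := by exact_mod_cast hy
  have h' : ((x : ℝ) / y) ^ 2 = 5 := by
    rw [div_pow, div_eq_iff (by positivity)]
    exact_mod_cast h
  push_cast
  rw [← Real.sqrt_sq_eq_abs, h']

/-- The indefinite form `k² + kμ - μ²` is anisotropic over `ℤ`. -/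
theorem one_le_abs_golden_form {μ k : ℤ} (h : ¬(μ = 0 ∧ k = 0)) :
    1 ≤ |k ^ 2 + k * μ - μ ^ 2| := by
  refine Int.one_le_abs fun h0 => ?_
  by_cases hμ : μ = 0
  · subst hμ
    exact h ⟨rfl, by simpa using h0⟩
  · exact sq_ne_five_mul_sq (x := 2 * k + μ) hμ (by linear_combination 4 * h0)

theorem fibB_lattice_sq_le (n : ℕ) {μ ν : ℤ}
    (hdvd : (fibB (n + 1) : ℤ) ∣ μ * fibB n - ν) (h : ¬(μ = 0 ∧ ν = 0)) :
    (fibB (n + 1) : ℤ) ^ 2 ≤ μ ^ 2 + ν ^ 2 + 3 * fibB (n + 1) * |μ * ν| := by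
  obtain ⟨k, hk⟩ := hdvd
  set a : ℤ := ((fibB n : ℕ) : ℤ) with ha
  set b : ℤ := ((fibB (n + 1) : ℕ) : ℤ) with hb
  have hb0 : 0 < b := by rw [hb]; exact_mod_cast fibB_pos (n + 1)
  have ha0 : 0 < a := by rw [ha]; exact_mod_cast fibB_pos n
  have hab : a ≤ b := by
    rcases n with _ | n
    · simp [ha, hb, fibB]
    · rw [ha, hb, show fibB (n + 1 + 1) = fibB (n + 1) + fibB n from rfl]
      push_cast
      omega
  have hk' : ν = μ * a - b * k := by linarith
  have h1 := one_le_abs_golden_form (μ := μ) (k := k) (by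
    rintro ⟨rfl, rfl⟩
    exact h ⟨rfl, by simpa using hk'⟩)
  -- Substituting ν = μa - bk turns the golden form in (k, μ) into a form in (μ, ν) whose μ²
  -- coefficient is ±1 by Cassini. The left side is at least b² in absolute value, so μν cannot be
  -- small unless μ or ν is of size b.
  have hid : b ^ 2 * (k ^ 2 + k * μ - μ ^ 2)
      = μ ^ 2 * (a ^ 2 + a * b - b ^ 2) - μ * ν * (2 * a + b) + ν ^ 2 := by
    rw [hk']; ring
  have hc : |a ^ 2 + a * b - b ^ 2| = 1 := by
    have := fibB_cassini n
    rw [← ha, ← hb] at this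
    exact (pow_eq_one_iff_of_nonneg (abs_nonneg _) two_ne_zero).1 (by rw [sq_abs]; exact this)
  calc b ^ 2 ≤ b ^ 2 * |k ^ 2 + k * μ - μ ^ 2| := by nlinarith [sq_nonneg b]
    _ = |μ ^ 2 * (a ^ 2 + a * b - b ^ 2) - μ * ν * (2 * a + b) + ν ^ 2| := by
        rw [← hid, abs_mul, abs_of_nonneg (sq_nonneg b)]
    _ ≤ |μ ^ 2 * (a ^ 2 + a * b - b ^ 2)| + |μ * ν * (2 * a + b)| + |ν ^ 2| := by
        exact (abs_add_le _ _).trans (add_le_add_left (abs_sub _ _) _)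
    _ = μ ^ 2 + |μ * ν| * (2 * a + b) + ν ^ 2 := by
        rw [abs_mul, abs_mul (μ * ν), hc, mul_one, abs_of_nonneg (sq_nonneg μ),
          abs_of_nonneg (sq_nonneg ν), abs_of_pos (show 0 < 2 * a + b by linarith)]
    _ ≤ _ := by nlinarith [abs_nonneg (μ * ν)]

theorem fibB_lattice_le (n : ℕ) {μ ν : ℤ}
    (hdvd : (fibB (n + 1) : ℤ) ∣ μ * fibB n - ν) (h : ¬(μ = 0 ∧ ν = 0)) :
    (fibB (n + 1) : ℤ) ≤ 6 * max 1 |μ| * max 1 |ν| := by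
  have h1 := fibB_lattice_sq_le n hdvd h
  set b : ℤ := ((fibB (n + 1) : ℕ) : ℤ) with hb
  have hb0 : 0 < b := by rw [hb]; exact_mod_cast fibB_pos (n + 1)
  set M := max 1 |μ| with hM
  set V := max 1 |ν| with hV
  have hM1 : 1 ≤ M := le_max_left _ _
  have hV1 : 1 ≤ V := le_max_left _ _
  have hμ : |μ| ≤ M := le_max_right _ _
  have hν : |ν| ≤ V := le_max_right _ _
  by_contra! hlt
  have e1 : μ ^ 2 ≤ M ^ 2 := by rw [← sq_abs]; gcongr
  have e2 : ν ^ 2 ≤ V ^ 2 := by rw [← sq_abs]; gcongr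
  have e3 : |μ * ν| ≤ M * V := by rw [abs_mul]; gcongr
  have e4 : 6 * M < b := by nlinarith
  have e5 : 6 * V < b := by nlinarith
  nlinarith [mul_le_mul_of_nonneg_left e3 hb0.le]

/-! ### Separation of the Fibonacci points and kernel sums over them -/

/-- The circle of length `2π`. -/
abbrev Circ : Type := AddCircle (2 * π)

theorem circ_norm_coe_le (x : ℝ) : ‖(x : Circ)‖ ≤ |x| := by
  rw [AddCircle.norm_eq]
  have := round_le ((2 * π)⁻¹ * x) 0
  have hpi := Real.two_pi_pos
  have e : x - round ((2 * π)⁻¹ * x) * (2 * π)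
      = (2 * π) * ((2 * π)⁻¹ * x - round ((2 * π)⁻¹ * x)) := by field_simp
  rw [e, abs_mul, abs_of_pos hpi]
  calc 2 * π * |(2 * π)⁻¹ * x - round ((2 * π)⁻¹ * x)| ≤ 2 * π * |(2 * π)⁻¹ * x - (0 : ℤ)| := by
        gcongr
    _ = |x| := by
        rw [Int.cast_zero, sub_zero, abs_mul, abs_of_pos (inv_pos.2 hpi)]
        field_simp

theorem circ_exists_rep (z : Circ) : ∃ x : ℝ, (x : Circ) = z ∧ |x| = ‖z‖ := by
  induction z using QuotientAddGroup.induction_on with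
  | H y =>
    refine ⟨y - round ((2 * π)⁻¹ * y) * (2 * π), ?_, (AddCircle.norm_eq (2 * π)).symm⟩
    have : ((round ((2 * π)⁻¹ * y) * (2 * π) : ℝ) : Circ) = 0 := by
      rw [AddCircle.coe_eq_zero_iff]
      exact ⟨round ((2 * π)⁻¹ * y), by simp⟩
    rw [AddCircle.coe_sub, this, sub_zero]

/-- The representative of smallest absolute value. -/
def circRep (z : Circ) : ℝ := (circ_exists_rep z).choose

theorem coe_circRep (z : Circ) : (circRep z : Circ) = z := (circ_exists_rep z).choose_spec.1

theorem abs_circRep (z : Circ) : |circRep z| = ‖z‖ := (circ_exists_rep z).choose_spec.2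

theorem circ_norm_sub_le (z w : Circ) : ‖z - w‖ ≤ |circRep z - circRep w| := by
  conv_lhs => rw [← coe_circRep z, ← coe_circRep w, ← AddCircle.coe_sub]
  exact circ_norm_coe_le _

theorem circ_norm_le_pi (z : Circ) : ‖z‖ ≤ π := by
  have := AddCircle.norm_le_half_period (p := 2 * π) (x := z) Real.two_pi_pos.ne'
  rw [abs_of_pos Real.two_pi_pos] at this
  linarith

/-- The integer μ is the residue of m modulo b of least absolute value; this translates distances
between lattice points into lattice vectors. -/
theorem exists_norm_circ_eq (m : ℤ) {b : ℕ} (hb : 0 < b) :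
    ∃ μ : ℤ, (b : ℤ) ∣ m - μ ∧
      ‖((2 * π * ((m : ℝ) / b) : ℝ) : Circ)‖ = 2 * π * (|(μ : ℝ)| / b) := by
  have hb' : (0 : ℝ) < b := by exact_mod_cast hb
  refine ⟨m - b * round ((m : ℝ) / b), ⟨round ((m : ℝ) / b), by ring⟩, ?_⟩
  rw [AddCircle.norm_eq' (2 * π) Real.two_pi_pos]
  have e : (2 * π)⁻¹ * (2 * π * ((m : ℝ) / b)) = (m : ℝ) / b := by
    field_simp
  rw [e]
  congr 1
  rw [eq_div_iff hb'.ne']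
  rw [show ∀ x : ℝ, |x| * (b : ℝ) = |x * b| from fun x => by rw [abs_mul, abs_of_pos hb']]
  congr 1
  push_cast
  field_simp

theorem fibPoint_zero (n : ℕ) (j : Fin (fibB n)) :
    fibPoint n j 0 = ((2 * π * (((j + 1 : ℤ) : ℝ) / fibB n) : ℝ) : Circ) := by
  simp [fibPoint]

theorem fibPoint_one (n : ℕ) (j : Fin (fibB n)) :
    fibPoint n j 1
      = ((2 * π * ((((j + 1) * fibB (n - 1) : ℤ) : ℝ) / fibB n) : ℝ) : Circ) := by
  simp only [fibPoint, Matrix.cons_val_one, Matrix.cons_val_zero]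
  rw [← sub_eq_zero, ← AddCircle.coe_sub, AddCircle.coe_eq_zero_iff]
  refine ⟨-⌊((j : ℕ) + 1 : ℝ) * (fibB (n - 1) : ℝ) / (fibB n : ℝ)⌋, ?_⟩
  rw [Int.fract]
  push_cast
  simp only [zsmul_eq_mul]
  push_cast
  ring

/-- The Cauchy type kernel `N / (1 + N² ‖t‖²)` on the circle. -/
def cauchyKer (N : ℝ) (t : Circ) : ℝ := N / (1 + (N * ‖t‖) ^ 2)

theorem cauchyKer_nonneg {N : ℝ} (hN : 0 ≤ N) (t : Circ) : 0 ≤ cauchyKer N t := by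
  unfold cauchyKer; positivity

theorem cauchyKer_le {N : ℝ} (hN : 0 ≤ N) (t : Circ) : cauchyKer N t ≤ N := by
  unfold cauchyKer
  exact div_le_self hN (by nlinarith [sq_nonneg (N * ‖t‖)])

theorem continuous_cauchyKer (N : ℝ) : Continuous (cauchyKer N) := by
  unfold cauchyKer
  refine continuous_const.div (by fun_prop) fun t => ?_
  positivity

/-- The weight of the integer cell `i`. -/
def cellWeight (i : ℤ) : ℝ := 4 / (1 + (i : ℝ) ^ 2)

theorem cellWeight_pos (i : ℤ) : 0 < cellWeight i := by unfold cellWeight; positivity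

theorem summable_cellWeight : Summable cellWeight := by
  have h : Summable fun i : ℤ => 1 / (i : ℝ) ^ 2 :=
    Real.summable_one_div_int_pow.2 one_lt_two
  refine (Summable.add (h.mul_left 4) (summable_of_hasFiniteSupport
    (f := fun i : ℤ => if i = 0 then (4 : ℝ) else 0) ?_)).of_nonneg_of_le
    (fun i => (cellWeight_pos i).le) fun i => ?_
  · refine (Set.finite_singleton (0 : ℤ)).subset fun i hi => ?_
    by_contra h0
    simp_all
  · unfold cellWeight
    by_cases hi : i = 0
    · simp [hi]
    · have : (0 : ℝ) < (i : ℝ) ^ 2 := by positivity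
      rw [if_neg hi, add_zero, mul_one_div]
      gcongr
      linarith

/-- The factor 4 in the weight absorbs the rounding: if i ≤ u < i + 1 then 1 + i² ≤ 4(1 + u²). -/
theorem cauchyKer_le_cellWeight {N : ℝ} (hN : 0 < N) (t : Circ) :
    cauchyKer N t ≤ N * cellWeight ⌊N * circRep t⌋ := by
  unfold cauchyKer cellWeight
  rw [div_eq_mul_inv]
  refine mul_le_mul_of_nonneg_left ?_ hN.le
  rw [inv_eq_one_div, div_le_div_iff₀ (by positivity) (by positivity)]
  set u := N * circRep t
  have hu : (N * ‖t‖) ^ 2 = u ^ 2 := by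
    rw [← abs_circRep, mul_pow, sq_abs, ← mul_pow]
  rw [hu]
  have h1 := Int.floor_le u
  have h2 := Int.lt_floor_add_one u
  set i : ℝ := ((⌊u⌋ : ℤ) : ℝ)
  nlinarith [sq_nonneg (u + (u - i)), sq_nonneg (u - i), sq_nonneg u]

/-- The total mass of the cell weights. -/
def cellMass : ℝ := ∑' i, cellWeight i

theorem cellMass_pos : 0 < cellMass :=
  summable_cellWeight.tsum_pos (fun i => (cellWeight_pos i).le) 0 (cellWeight_pos 0)

/-- Two distinct Fibonacci points are not both close in the two coordinates. -/
theorem fibPoint_separated (n : ℕ) {j j' : Fin (fibB (n + 1))} (hj : j ≠ j') :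
    1 ≤ fibB (n + 1) * (‖fibPoint (n + 1) j 0 - fibPoint (n + 1) j' 0‖ *
      ‖fibPoint (n + 1) j 1 - fibPoint (n + 1) j' 1‖) := by
  have hb0 : 0 < fibB (n + 1) := fibB_pos _
  have hb0' : (0 : ℝ) < fibB (n + 1) := by exact_mod_cast hb0
  set m : ℤ := (j : ℤ) - j' with hm
  have e0 : fibPoint (n + 1) j 0 - fibPoint (n + 1) j' 0
      = ((2 * π * ((m : ℝ) / fibB (n + 1)) : ℝ) : Circ) := by
    rw [fibPoint_zero, fibPoint_zero, ← AddCircle.coe_sub]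
    congr 1
    rw [hm]
    push_cast
    ring
  have e1 : fibPoint (n + 1) j 1 - fibPoint (n + 1) j' 1
      = ((2 * π * (((m * fibB n : ℤ) : ℝ) / fibB (n + 1)) : ℝ) : Circ) := by
    rw [fibPoint_one, fibPoint_one, ← AddCircle.coe_sub]
    congr 1
    rw [hm, Nat.add_sub_cancel]
    push_cast
    ring
  obtain ⟨μ, hμ, hμn⟩ := exists_norm_circ_eq m hb0
  obtain ⟨ν, hν, hνn⟩ := exists_norm_circ_eq (m * fibB n) hb0
  have hpi := Real.pi_gt_three
  have hμ0 : μ ≠ 0 := by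
    rintro rfl
    rw [sub_zero] at hμ
    have h1 := j.2
    have h2 := j'.2
    have := Int.eq_zero_of_abs_lt_dvd hμ (by rw [abs_lt]; omega)
    apply hj
    ext
    omega
  have hμb : 2 * |(μ : ℝ)| ≤ fibB (n + 1) := by
    have := circ_norm_le_pi (((2 * π * ((m : ℝ) / fibB (n + 1)) : ℝ) : Circ))
    rw [hμn] at this
    have h3 : 2 * π * (|(μ : ℝ)| / fibB (n + 1)) = π * (2 * |(μ : ℝ)| / fibB (n + 1)) := by ring
    rw [h3] at this
    have h4 : 2 * |(μ : ℝ)| / fibB (n + 1) ≤ 1 := by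
      by_contra! hc
      nlinarith
    rwa [div_le_one hb0'] at h4
  have hdvd : (fibB (n + 1) : ℤ) ∣ μ * fibB n - ν := by
    have : μ * fibB n - ν = (m * fibB n - ν) - (m - μ) * fibB n := by ring
    rw [this]
    exact dvd_sub hν (hμ.mul_right _)
  -- With ν = 0 the quadratic bound would read b² ≤ μ², contradicting |μ| ≤ b/2.
  have hν0 : ν ≠ 0 := by
    rintro rfl
    have h5 := fibB_lattice_sq_le n hdvd (by simp [hμ0])
    simp only [mul_zero, abs_zero, add_zero, ne_eq, OfNat.ofNat_ne_zero, not_false_eq_true,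
      zero_pow] at h5
    have h6 : ((fibB (n + 1) : ℝ)) ^ 2 ≤ |(μ : ℝ)| ^ 2 := by rw [sq_abs]; exact_mod_cast h5
    nlinarith [abs_nonneg (μ : ℝ)]
  have h7 := fibB_lattice_le n hdvd (by simp [hμ0])
  rw [max_eq_right (Int.one_le_abs hμ0), max_eq_right (Int.one_le_abs hν0)] at h7
  have h8 : (fibB (n + 1) : ℝ) ≤ 6 * |(μ : ℝ)| * |(ν : ℝ)| := by exact_mod_cast h7
  rw [e0, e1, hμn, hνn]
  have : fibB (n + 1) * (2 * π * (|(μ : ℝ)| / fibB (n + 1)) * (2 * π * (|(ν : ℝ)| / fibB (n + 1))))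
      = 4 * π ^ 2 * (|(μ : ℝ)| * |(ν : ℝ)|) / fibB (n + 1) := by
    field_simp
    ring
  rw [this, le_div_iff₀ hb0']
  have h9 : 0 ≤ |(μ : ℝ)| * |(ν : ℝ)| := by positivity
  have h10 : 36 ≤ 4 * π ^ 2 := by nlinarith
  nlinarith [mul_le_mul_of_nonneg_right h10 h9]

/-- Two points in one cell would have N₁N₂ times the product of their coordinate distances below 1,
against separation and N₁N₂ ≥ b. Hence the map from points to cells is injective and the sum is
dominated by the full sum of cell weights, uniformly in the centre (y, z). -/
theorem sum_fibPoint_cauchyKer_le (n : ℕ) {N₁ N₂ : ℝ} (h₁ : 0 < N₁) (h₂ : 0 < N₂)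
    (hN : (fibB (n + 1) : ℝ) ≤ N₁ * N₂) (y z : Circ) :
    ∑ j, cauchyKer N₁ (fibPoint (n + 1) j 0 - y) * cauchyKer N₂ (fibPoint (n + 1) j 1 - z)
      ≤ N₁ * N₂ * cellMass ^ 2 := by
  set F : Fin (fibB (n + 1)) → ℤ × ℤ := fun j =>
    (⌊N₁ * circRep (fibPoint (n + 1) j 0 - y)⌋, ⌊N₂ * circRep (fibPoint (n + 1) j 1 - z)⌋) with hF
  have hcell : ∀ {N : ℝ} (hN : 0 < N) (u v w : Circ),
      ⌊N * circRep (u - w)⌋ = ⌊N * circRep (v - w)⌋ → N * ‖u - v‖ < 1 := by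
    intro N hN u v w h
    have := Int.abs_sub_lt_one_of_floor_eq_floor h
    rw [← mul_sub, abs_mul, abs_of_pos hN] at this
    have h3 := circ_norm_sub_le (u - w) (v - w)
    rw [sub_sub_sub_cancel_right] at h3
    nlinarith
  have hinj : Function.Injective F := by
    intro j j' hjj
    by_contra hne
    have h3 := fibPoint_separated n hne
    have h4 := hcell h₁ _ _ _ (congrArg Prod.fst hjj)
    have h5 := hcell h₂ _ _ _ (congrArg Prod.snd hjj)
    set d := ‖fibPoint (n + 1) j 0 - fibPoint (n + 1) j' 0‖
    set e := ‖fibPoint (n + 1) j 1 - fibPoint (n + 1) j' 1‖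
    have hd : 0 ≤ d := norm_nonneg _
    have he : 0 ≤ e := norm_nonneg _
    have h6 : (fibB (n + 1) : ℝ) * (d * e) ≤ (N₁ * N₂) * (d * e) := by gcongr
    have h7 : (N₁ * d) * (N₂ * e) < 1 := by
      calc (N₁ * d) * (N₂ * e) ≤ (N₁ * d) * 1 := by gcongr
        _ < 1 := by linarith
    nlinarith
  have hs : Summable fun i : ℤ × ℤ => cellWeight i.1 * cellWeight i.2 :=
    summable_cellWeight.mul_of_nonneg summable_cellWeight (fun i => (cellWeight_pos i).le)
      (fun i => (cellWeight_pos i).le)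
  calc _ ≤ ∑ j, N₁ * N₂ * (cellWeight (F j).1 * cellWeight (F j).2) := by
        refine Finset.sum_le_sum fun j _ => ?_
        calc _ ≤ (N₁ * cellWeight (F j).1) * (N₂ * cellWeight (F j).2) :=
              mul_le_mul (cauchyKer_le_cellWeight h₁ _) (cauchyKer_le_cellWeight h₂ _)
                (cauchyKer_nonneg h₂.le _) (mul_nonneg h₁.le (cellWeight_pos _).le)
          _ = _ := by ring
    _ = N₁ * N₂ * ∑ i ∈ Finset.univ.image F, cellWeight i.1 * cellWeight i.2 := by
        rw [← Finset.mul_sum, Finset.sum_image fun _ _ _ _ h => hinj h]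
    _ ≤ N₁ * N₂ * ∑' i : ℤ × ℤ, cellWeight i.1 * cellWeight i.2 := by
        gcongr
        exact hs.sum_le_tsum _ fun i _ => mul_nonneg (cellWeight_pos _).le (cellWeight_pos _).le
    _ = N₁ * N₂ * cellMass ^ 2 := by
        rw [sq, cellMass, summable_cellWeight.tsum_mul_tsum summable_cellWeight hs]

/-! ### Characters on the Fibonacci points -/

/-- The characters of the two-dimensional torus. -/
def torusChar (k₁ k₂ : ℤ) (x : Torus 2) : ℂ := fourier k₁ (x 0) * fourier k₂ (x 1)

/-- Along the points the character runs through a geometric progression whose ratio is a b-th root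
of unity different from 1. -/
theorem sum_torusChar_fibPoint (n : ℕ) {k₁ k₂ : ℤ}
    (h : ¬ (fibB (n + 1) : ℤ) ∣ k₁ + k₂ * fibB n) :
    ∑ j, torusChar k₁ k₂ (fibPoint (n + 1) j) = 0 := by
  set b := fibB (n + 1) with hb
  have hb0 : 0 < b := fibB_pos _
  have hbC : (b : ℂ) ≠ 0 := by exact_mod_cast hb0.ne'
  set ζ : ℂ := Complex.exp (2 * π * Complex.I * ((k₁ + k₂ * fibB n : ℤ) / b)) with hζ
  have hpiC : (π : ℂ) ≠ 0 := by exact_mod_cast Real.pi_ne_zero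
  have key : ∀ j : Fin b, torusChar k₁ k₂ (fibPoint (n + 1) j) = ζ * ζ ^ (j : ℕ) := by
    intro j
    rw [torusChar, fibPoint_zero (n + 1) j, fibPoint_one (n + 1) j, fourier_coe_apply,
      fourier_coe_apply, ← Complex.exp_add, ← pow_succ', hζ, ← Complex.exp_nat_mul,
      Nat.add_sub_cancel, show ((fibB (n + 1) : ℕ) : ℝ) = (b : ℝ) from rfl]
    congr 1
    push_cast
    field_simp
  have hζb : ζ ^ b = 1 := by
    rw [hζ, ← Complex.exp_nat_mul, Complex.exp_eq_one_iff]
    refine ⟨k₁ + k₂ * fibB n, ?_⟩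
    push_cast
    field_simp
  have hζ1 : ζ ≠ 1 := by
    intro h1
    rw [hζ, Complex.exp_eq_one_iff] at h1
    obtain ⟨m, hm⟩ := h1
    apply h
    refine ⟨m, ?_⟩
    have h2 : (((k₁ + k₂ * fibB n : ℤ) : ℂ)) / b = m := by
      have h3 : (2 * π * Complex.I : ℂ) ≠ 0 := by
        simp [hpiC, Complex.I_ne_zero]
      apply mul_left_cancel₀ h3
      rw [hm]; ring
    rw [div_eq_iff hbC] at h2
    have : (((k₁ + k₂ * fibB n : ℤ)) : ℂ) = ((b * m : ℤ) : ℂ) := by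
      rw [h2]; push_cast; ring
    exact_mod_cast this
  rw [Finset.sum_congr rfl fun j _ => key j, ← Finset.mul_sum,
    Fin.sum_univ_eq_sum_range (fun j => ζ ^ j) b]
  have := mul_neg_geom_sum ζ b
  rw [hζb, sub_self] at this
  rcases mul_eq_zero.1 this with h3 | h3
  · exact absurd (sub_eq_zero.1 h3).symm hζ1
  · rw [h3, mul_zero]

/-- The aliased frequencies form the same kind of lattice as the points, with μ = k₂ and ν = -k₁, so
`fibB_lattice_le` applies again. -/
theorem not_dvd_of_lt (n : ℕ) {k₁ k₂ : ℤ} {d₁ d₂ : ℤ} (hd₁ : 1 ≤ d₁) (hd₂ : 1 ≤ d₂)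
    (hk₁ : |k₁| ≤ d₁) (hk₂ : |k₂| ≤ d₂) (hd : 6 * d₁ * d₂ < fibB (n + 1))
    (h : ¬(k₁ = 0 ∧ k₂ = 0)) : ¬ (fibB (n + 1) : ℤ) ∣ k₁ + k₂ * fibB n := by
  intro hdvd
  have h1 := fibB_lattice_le n (μ := k₂) (ν := -k₁) (by
    rwa [sub_neg_eq_add, add_comm (k₂ * _)]) (by simpa [and_comm] using h)
  rw [abs_neg] at h1
  have h2 : 6 * max 1 |k₂| * max 1 |k₁| ≤ 6 * d₂ * d₁ := by
    gcongr
    · exact max_le hd₂ hk₂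
    · exact max_le hd₁ hk₁
  nlinarith

/-! ### Dirichlet and de la Vallée Poussin kernels on the circle -/

/-- The normalized Haar measure on the circle. -/
abbrev circMeasure : Measure Circ := AddCircle.haarAddCircle

theorem integrable_circ_of_continuous {E : Type*} [NormedAddCommGroup E] {f : Circ → E}
    (hf : Continuous f) : Integrable f circMeasure :=
  hf.integrable_of_hasCompactSupport (HasCompactSupport.of_compactSpace f)

theorem integral_fourier_eq_ite (k : ℤ) :
    ∫ t, fourier k t ∂circMeasure = if k = 0 then 1 else 0 := by
  split_ifs with hk
  · subst hk
    simp
  · exact integral_eq_zero_of_add_right_eq_neg (μ := circMeasure)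
      (fourier_add_half_inv_index hk Real.two_pi_pos)

theorem fourier_mul_fourier (k m : ℤ) (t : Circ) :
    fourier k t * fourier m t = (fourier (k + m) t : ℂ) := fourier_add.symm

theorem fourier_zero_apply (t : Circ) : (fourier 0 t : ℂ) = 1 := fourier_zero

theorem norm_fourier_apply (k : ℤ) (t : Circ) : ‖(fourier k t : ℂ)‖ = 1 := by
  rw [fourier_apply]; exact Circle.norm_coe _

theorem fourier_eq_exp (k : ℤ) (t : Circ) :
    (fourier k t : ℂ) = Complex.exp (Complex.I * ((k * circRep t : ℝ) : ℂ)) := by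
  conv_lhs => rw [← coe_circRep t]
  rw [fourier_coe_apply]
  congr 1
  have : (π : ℂ) ≠ 0 := by exact_mod_cast Real.pi_ne_zero
  push_cast
  field_simp

theorem norm_fourier_sub_one_le (k : ℤ) (t : Circ) :
    ‖(fourier k t : ℂ) - 1‖ ≤ |(k : ℝ)| * ‖t‖ := by
  rw [fourier_eq_exp, ← abs_circRep, ← abs_mul]
  exact Real.norm_exp_I_mul_ofReal_sub_one_le

theorem le_norm_fourier_one_sub_one (t : Circ) :
    2 / π * ‖t‖ ≤ ‖(fourier 1 t : ℂ) - 1‖ := by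
  rw [fourier_eq_exp, Complex.norm_exp_I_mul_ofReal_sub_one, Int.cast_one, one_mul, norm_mul,
    Real.norm_eq_abs, Real.norm_eq_abs, ← abs_circRep]
  have h := Real.mul_abs_le_abs_sin (x := circRep t / 2) (by
    rw [abs_div, abs_two, abs_circRep]
    have := circ_norm_le_pi t
    linarith)
  rw [abs_div, abs_two] at h
  rw [abs_two]
  linarith

/-- The Dirichlet kernel. -/
def dirichletKer (M : ℕ) : C(Circ, ℂ) := ∑ k ∈ Finset.Icc (-(M : ℤ)) M, fourier k

theorem dirichletKer_apply (M : ℕ) (t : Circ) :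
    dirichletKer M t = ∑ k ∈ Finset.Icc (-(M : ℤ)) M, fourier k t := by
  simp [dirichletKer]

theorem card_Icc_neg (M : ℕ) : (Finset.Icc (-(M : ℤ)) M).card = 2 * M + 1 := by
  rw [Int.card_Icc]; omega

theorem norm_dirichletKer_le (M : ℕ) (t : Circ) : ‖dirichletKer M t‖ ≤ 2 * M + 1 := by
  rw [dirichletKer_apply]
  refine (norm_sum_le _ _).trans ?_
  simp_rw [norm_fourier_apply]
  rw [Finset.sum_const, card_Icc_neg]
  simp

theorem dirichletKer_mul_sub_one (M : ℕ) (t : Circ) :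
    dirichletKer M t * (fourier 1 t - 1) = fourier (M + 1 : ℤ) t - fourier (-M : ℤ) t := by
  induction M with
  | zero => simp [dirichletKer_apply]
  | succ M ih =>
    have hs : Finset.Icc (-((M + 1 : ℕ) : ℤ)) ((M + 1 : ℕ) : ℤ)
        = insert (-(M + 1 : ℤ)) (insert (M + 1 : ℤ) (Finset.Icc (-(M : ℤ)) M)) := by
      ext k; simp; omega
    rw [dirichletKer_apply, hs, Finset.sum_insert (by simp; omega),
      Finset.sum_insert (by simp), ← dirichletKer_apply, ← add_assoc, add_mul, ih, sub_eq_add_neg,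
      mul_add, add_mul, add_mul, fourier_mul_fourier, fourier_mul_fourier]
    push_cast
    rw [show (-(M + 1 : ℤ)) + 1 = -M by ring]
    ring_nf

/-- Multiplication by e^{it} - 1 telescopes the kernel to two characters, while |e^{it} - 1| ≥
(2/π)‖t‖. -/
theorem norm_dirichletKer_mul_le (M : ℕ) (t : Circ) : ‖dirichletKer M t‖ * ‖t‖ ≤ π := by
  have h1 : ‖dirichletKer M t * (fourier 1 t - 1)‖ ≤ 2 := by
    rw [dirichletKer_mul_sub_one]
    refine (norm_sub_le _ _).trans ?_
    rw [norm_fourier_apply, norm_fourier_apply]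
    norm_num
  rw [norm_mul] at h1
  have h2 := le_norm_fourier_one_sub_one t
  have h3 : ‖dirichletKer M t‖ * (2 / π * ‖t‖) ≤ 2 :=
    (mul_le_mul_of_nonneg_left h2 (norm_nonneg _)).trans h1
  have hpi := Real.pi_pos
  have h4 : ‖dirichletKer M t‖ * (2 / π * ‖t‖) = 2 * (‖dirichletKer M t‖ * ‖t‖) / π := by ring
  rw [h4, div_le_iff₀ hpi] at h3
  linarith

/-- So close to 0 each character differs from 1 by at most 1/2, so the kernel keeps half of its peak
value. -/
theorem le_norm_dirichletKer (M : ℕ) {t : Circ} (ht : ‖t‖ ≤ 1 / (2 * (2 * M + 1))) :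
    (2 * M + 1 : ℝ) / 2 ≤ ‖dirichletKer M t‖ := by
  have hM : (0 : ℝ) < 2 * M + 1 := by positivity
  have h1 : ‖(2 * M + 1 : ℂ) - dirichletKer M t‖ ≤ (2 * M + 1) / 2 := by
    have e : (2 * M + 1 : ℂ) - dirichletKer M t
        = ∑ k ∈ Finset.Icc (-(M : ℤ)) M, (1 - fourier k t) := by
      rw [Finset.sum_sub_distrib, ← dirichletKer_apply, Finset.sum_const, card_Icc_neg]
      simp
    rw [e]
    refine (norm_sum_le _ _).trans ?_
    calc _ ≤ ∑ k ∈ Finset.Icc (-(M : ℤ)) M, (1 / 2 : ℝ) := by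
          refine Finset.sum_le_sum fun k hk => ?_
          rw [norm_sub_rev]
          refine (norm_fourier_sub_one_le k t).trans ?_
          have hk' : |(k : ℝ)| ≤ 2 * M + 1 := by
            have : |k| ≤ 2 * M + 1 := by
              rw [Finset.mem_Icc] at hk
              rw [abs_le]; omega
            exact_mod_cast this
          calc |(k : ℝ)| * ‖t‖ ≤ (2 * M + 1) * (1 / (2 * (2 * M + 1))) := by gcongr
            _ = 1 / 2 := by field_simp
      _ = _ := by
          rw [Finset.sum_const, card_Icc_neg]
          rw [nsmul_eq_mul]
          push_cast
          ring
  have h2 := norm_sub_norm_le (2 * M + 1 : ℂ) (dirichletKer M t)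
  have h3 : ‖(2 * M + 1 : ℂ)‖ = 2 * M + 1 := by
    rw [show (2 * M + 1 : ℂ) = ((2 * M + 1 : ℝ) : ℂ) by push_cast; rfl, Complex.norm_real,
      Real.norm_of_nonneg hM.le]
  rw [h3] at h2
  linarith

theorem conj_dirichletKer (M : ℕ) (t : Circ) :
    (starRingEnd ℂ) (dirichletKer M t) = dirichletKer M t := by
  rw [dirichletKer_apply, map_sum]
  simp_rw [← fourier_neg]
  refine Finset.sum_nbij' (fun k => -k) (fun k => -k) ?_ ?_ ?_ ?_ ?_ <;> simp <;> omega

/-- The Dirichlet kernel is real, so an even power of its modulus is a trigonometric polynomial,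
orthogonal to high frequencies. -/
theorem ofReal_norm_dirichletKer_pow (M L : ℕ) (t : Circ) :
    ((‖dirichletKer M t‖ ^ (2 * L) : ℝ) : ℂ) = (dirichletKer M t) ^ (2 * L) := by
  rw [pow_mul, pow_mul]
  push_cast
  rw [← Complex.conj_mul', conj_dirichletKer, sq]

/-- Trigonometric polynomials of degree at most `N`. -/
def trigPoly (N : ℕ) : Submodule ℂ C(Circ, ℂ) :=
  Submodule.span ℂ ((fun k : ℤ => (fourier k : C(Circ, ℂ))) '' {k | |k| ≤ N})

theorem fourier_mem_trigPoly {N : ℕ} {k : ℤ} (hk : |k| ≤ N) :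
    (fourier k : C(Circ, ℂ)) ∈ trigPoly N := Submodule.subset_span ⟨k, hk, rfl⟩

theorem mul_mem_trigPoly {N M : ℕ} {f g : C(Circ, ℂ)} (hf : f ∈ trigPoly N)
    (hg : g ∈ trigPoly M) : f * g ∈ trigPoly (N + M) := by
  have h := Submodule.mul_mem_mul hf hg
  rw [trigPoly, trigPoly, Submodule.span_mul_span] at h
  refine Submodule.span_mono ?_ h
  rintro _ ⟨_, ⟨k, hk, rfl⟩, _, ⟨m, hm, rfl⟩, rfl⟩
  refine ⟨k + m, ?_, ?_⟩
  · simp only [Set.mem_ofPred_eq] at hk hm ⊢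
    push_cast
    exact (abs_add_le _ _).trans (add_le_add hk hm)
  · ext t
    exact (fourier_mul_fourier k m t).symm

theorem dirichletKer_mem_trigPoly (M : ℕ) : dirichletKer M ∈ trigPoly M := by
  refine Submodule.sum_mem _ fun k hk => fourier_mem_trigPoly ?_
  rw [Finset.mem_Icc] at hk
  rw [abs_le]; exact hk

theorem dirichletKer_pow_mem_trigPoly (M L : ℕ) : dirichletKer M ^ L ∈ trigPoly (L * M) := by
  induction L with
  | zero =>
    have : (1 : C(Circ, ℂ)) = fourier 0 := by ext t; simp
    rw [pow_zero, this]
    exact fourier_mem_trigPoly (by simp)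
  | succ L ih =>
    rw [pow_succ, Nat.succ_mul]
    exact mul_mem_trigPoly ih (dirichletKer_mem_trigPoly M)

theorem integral_trigPoly_mul_fourier {N : ℕ} {f : C(Circ, ℂ)} (hf : f ∈ trigPoly N) {k : ℤ}
    (hk : (N : ℤ) < |k|) : ∫ t, f t * fourier k t ∂circMeasure = 0 := by
  induction hf using Submodule.span_induction with
  | mem f hf =>
    obtain ⟨m, hm, rfl⟩ := hf
    simp only [Set.mem_ofPred_eq] at hm
    simp_rw [fourier_mul_fourier]
    rw [integral_fourier_eq_ite, if_neg]
    intro h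
    rw [show m = -k by omega, abs_neg] at hm
    omega
  | zero => simp
  | add f g _ _ hf hg =>
    simp only [ContinuousMap.add_apply, add_mul]
    rw [integral_add (integrable_circ_of_continuous (by fun_prop))
      (integrable_circ_of_continuous (by fun_prop)), hf, hg, add_zero]
  | smul c f _ hf =>
    simp only [ContinuousMap.smul_apply, smul_eq_mul, mul_assoc]
    rw [integral_const_mul, hf, mul_zero]

theorem integral_cauchyKer_le (N : ℝ) : ∫ t, cauchyKer N t ∂circMeasure ≤ 1 := by
  rw [AddCircle.integral_haarAddCircle, ← AddCircle.intervalIntegral_preimage (2 * π) (-π)]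
  have hpi := Real.pi_pos
  have e : ∫ a in -π..-π + 2 * π, cauchyKer N (a : Circ)
      = ∫ a in -π..π, N * (1 + (N * a) ^ 2)⁻¹ := by
    rw [show -π + 2 * π = π by ring]
    refine intervalIntegral.integral_congr fun a ha => ?_
    rw [Set.uIcc_of_le (by linarith), Set.mem_Icc] at ha
    simp only [cauchyKer]
    rw [(AddCircle.norm_coe_eq_abs_iff (2 * π) (by positivity)).2 (by
      rw [abs_of_pos (by positivity : 0 < 2 * π), abs_le]; constructor <;> linarith [ha.1, ha.2]),
      mul_pow, sq_abs, ← mul_pow, div_eq_mul_inv]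
  rw [e, intervalIntegral.integral_const_mul,
    intervalIntegral.mul_integral_comp_mul_left (f := fun x => (1 + x ^ 2)⁻¹),
    integral_inv_one_add_sq, smul_eq_mul, inv_mul_le_iff₀ (by positivity)]
  have := Real.arctan_lt_pi_div_two (N * π)
  have := Real.neg_pi_div_two_lt_arctan (N * -π)
  linarith

theorem cauchyKer_le_mul_cauchyKer {N c : ℝ} (hN : 0 ≤ N) (hc : 1 ≤ c) (t : Circ) :
    cauchyKer N t ≤ c * cauchyKer (c * N) t := by
  unfold cauchyKer
  rw [← mul_div_assoc, div_le_div_iff₀ (by positivity) (by positivity)]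
  have h : 1 ≤ c ^ 2 := by nlinarith
  have : 0 ≤ N * (c ^ 2 - 1) := mul_nonneg hN (by linarith)
  nlinarith

theorem le_cauchyKer_of_le {N A B X : ℝ} {t : Circ} (h₁ : X ≤ A * N)
    (h₂ : X * (N * ‖t‖) ^ 2 ≤ B * N) : X ≤ (A + B) * cauchyKer N t := by
  unfold cauchyKer
  rw [← mul_div_assoc, le_div_iff₀ (by positivity)]
  nlinarith

/-- The trapezoidal multiplier of the de la Vallée Poussin kernel. -/
def vpCoeff (N : ℕ) (k : ℤ) : ℝ :=
  (((Finset.Icc (-(N : ℤ)) N).filter fun j => |k - j| ≤ 2 * N).card : ℝ) / (2 * N + 1)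

theorem vpCoeff_of_le {N : ℕ} {k : ℤ} (hk : |k| ≤ N) : vpCoeff N k = 1 := by
  rw [vpCoeff, Finset.filter_true_of_mem, card_Icc_neg]
  · push_cast
    exact div_self (by positivity)
  · intro j hj
    rw [Finset.mem_Icc] at hj
    rw [abs_le] at hk ⊢
    omega

/-- The de la Vallée Poussin kernel. -/
def vpKer (N : ℕ) (t : Circ) : ℂ := dirichletKer N t * dirichletKer (2 * N) t / (2 * N + 1)

/-- The coefficient counts representations of k as a sum of a frequency of each factor. The range D
is left free so that kernels of different degrees can be subtracted term by term. -/
theorem vpKer_eq_sum {N D : ℕ} (hD : 3 * N ≤ D) (t : Circ) :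
    vpKer N t = ∑ k ∈ Finset.Icc (-(D : ℤ)) D, (vpCoeff N k : ℂ) * fourier k t := by
  have h1 : dirichletKer N t * dirichletKer (2 * N) t
      = ∑ j ∈ Finset.Icc (-(N : ℤ)) N, ∑ k ∈ Finset.Icc (-(D : ℤ)) D,
        if |k - j| ≤ 2 * N then (fourier k t : ℂ) else 0 := by
    rw [dirichletKer_apply, dirichletKer_apply, Finset.sum_mul_sum]
    refine Finset.sum_congr rfl fun j hj => ?_
    rw [← Finset.sum_filter]
    simp_rw [fourier_mul_fourier]
    rw [Finset.mem_Icc] at hj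
    refine Finset.sum_nbij' (fun k => j + k) (fun k => k - j) ?_ ?_ ?_ ?_ ?_
    · intro k hk
      simp only [Finset.mem_Icc, Finset.mem_filter, abs_le] at hk ⊢
      push_cast at hk
      omega
    · intro k hk
      simp only [Finset.mem_Icc, Finset.mem_filter, abs_le] at hk ⊢
      push_cast
      omega
    · intros; ring
    · intros; ring
    · intros; rfl
  rw [vpKer, h1, Finset.sum_comm, Finset.sum_div]
  refine Finset.sum_congr rfl fun k _ => ?_
  rw [← Finset.sum_filter, Finset.sum_const, vpCoeff, nsmul_eq_mul]
  push_cast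
  ring

theorem norm_vpKer_le {N : ℕ} (hN : 1 ≤ N) (t : Circ) : ‖vpKer N t‖ ≤ 10 * cauchyKer N t := by
  have hN' : (1 : ℝ) ≤ N := by exact_mod_cast hN
  have h0 : ‖vpKer N t‖ * (2 * N + 1) = ‖dirichletKer N t‖ * ‖dirichletKer (2 * N) t‖ := by
    rw [vpKer, norm_div, norm_mul, show (2 * N + 1 : ℂ) = ((2 * N + 1 : ℝ) : ℂ) by push_cast; rfl,
      Complex.norm_real, Real.norm_of_nonneg (by positivity), div_mul_cancel₀ _ (by positivity)]
  have a1 := norm_dirichletKer_le N t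
  have a2 := norm_dirichletKer_le (2 * N) t
  have b1 := norm_dirichletKer_mul_le N t
  have b2 := norm_dirichletKer_mul_le (2 * N) t
  push_cast at a2
  have hpi := Real.pi_pos
  have hpi2 : π ^ 2 ≤ 10 := by nlinarith [Real.pi_lt_d2]
  have c1 : ‖vpKer N t‖ ≤ 5 * N := by
    have : ‖vpKer N t‖ * (2 * N + 1) ≤ (2 * N + 1) * (2 * (2 * N) + 1) := by
      rw [h0]; gcongr
    have : ‖vpKer N t‖ ≤ 2 * (2 * N) + 1 := by
      by_contra! hc
      nlinarith
    linarith
  have c2 : ‖vpKer N t‖ * (N * ‖t‖) ^ 2 ≤ 5 * N := by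
    have : (‖vpKer N t‖ * (2 * N + 1)) * ‖t‖ ^ 2 ≤ π * π := by
      rw [h0]
      calc _ = (‖dirichletKer N t‖ * ‖t‖) * (‖dirichletKer (2 * N) t‖ * ‖t‖) := by ring
        _ ≤ π * π := by gcongr
    have h3 : 0 ≤ ‖vpKer N t‖ * ‖t‖ ^ 2 := by positivity
    have h4 : ‖vpKer N t‖ * ‖t‖ ^ 2 * N ≤ 5 := by nlinarith
    calc _ = N * (‖vpKer N t‖ * ‖t‖ ^ 2 * N) := by ring
      _ ≤ N * 5 := by gcongr
      _ = _ := by ring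
  calc _ ≤ (5 + 5) * cauchyKer N t := le_cauchyKer_of_le c1 c2
    _ = _ := by norm_num

/-- The multiplier of the `s`-th dyadic block. -/
def blockCoeff (Q s : ℕ) (k : ℤ) : ℝ :=
  match s with
  | 0 => vpCoeff Q k
  | s + 1 => vpCoeff (Q * 2 ^ (s + 1)) k - vpCoeff (Q * 2 ^ s) k

/-- The kernel of the `s`-th dyadic block. -/
def blockKer (Q s : ℕ) (t : Circ) : ℂ :=
  ∑ k ∈ Finset.Icc (-((3 * (Q * 2 ^ s) : ℕ) : ℤ)) (3 * (Q * 2 ^ s) : ℕ),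
    (blockCoeff Q s k : ℂ) * fourier k t

/-- Both trapezoidal multipliers equal 1 here and cancel. The resulting spectral gap is what allows
a block to be recovered from differences. -/
theorem blockCoeff_of_le {Q s : ℕ} {k : ℤ} (hk : |k| ≤ (Q * 2 ^ s : ℕ)) :
    blockCoeff Q (s + 1) k = 0 := by
  rw [blockCoeff, vpCoeff_of_le hk, vpCoeff_of_le, sub_self]
  refine hk.trans ?_
  push_cast
  gcongr <;> simp

theorem continuous_blockKer (Q s : ℕ) : Continuous (blockKer Q s) := by
  unfold blockKer; fun_prop

theorem norm_blockKer_le {Q : ℕ} (hQ : 1 ≤ Q) (s : ℕ) (t : Circ) :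
    ‖blockKer Q s t‖ ≤ 450 * cauchyKer (15 * (Q * 2 ^ s)) t := by
  have hN : ∀ s, 1 ≤ Q * 2 ^ s := fun s => Nat.mul_pos hQ (by positivity)
  have hp : (0 : ℝ) ≤ cauchyKer (Q * 2 ^ s) t := cauchyKer_nonneg (by positivity) t
  -- 30 = 10 + 10 · 2: the coarser of the two kernels is compared with the finer scale at the cost
  -- of a factor 2.
  have h1 : ‖blockKer Q s t‖ ≤ 30 * cauchyKer (Q * 2 ^ s) t := by
    cases s with
    | zero =>
      have : blockKer Q 0 t = vpKer Q t := by
        rw [vpKer_eq_sum (D := 3 * (Q * 2 ^ 0)) (by simp)]; rfl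
      rw [this]
      refine (norm_vpKer_le hQ t).trans ?_
      simp only [pow_zero, mul_one] at hp ⊢
      linarith
    | succ s =>
      have : blockKer Q (s + 1) t = vpKer (Q * 2 ^ (s + 1)) t - vpKer (Q * 2 ^ s) t := by
        rw [vpKer_eq_sum (D := 3 * (Q * 2 ^ (s + 1))) le_rfl,
          vpKer_eq_sum (D := 3 * (Q * 2 ^ (s + 1))) (by rw [pow_succ]; nlinarith [hN s]),
          ← Finset.sum_sub_distrib]
        refine Finset.sum_congr rfl fun k _ => ?_
        rw [blockCoeff]
        push_cast
        ring
      rw [this]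
      refine (norm_sub_le _ _).trans ?_
      have e1 := norm_vpKer_le (hN (s + 1)) t
      have e2 := norm_vpKer_le (hN s) t
      have e3 := cauchyKer_le_mul_cauchyKer (N := ((Q * 2 ^ s : ℕ) : ℝ)) (c := 2)
        (by positivity) (by norm_num) t
      have e4 : (2 : ℝ) * ((Q * 2 ^ s : ℕ) : ℝ) = Q * 2 ^ (s + 1) := by push_cast; ring
      rw [e4] at e3
      push_cast at e1 e2 e3
      linarith
  -- The scale is inflated by 15 because 15² ≥ 6³. The threshold (15Q2^i)(15Q2^j) against b then
  -- serves both alternatives: below it the formula is exact on products of blocks, at or above it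
  -- the majorants are at scales with N₁N₂ ≥ b.
  refine h1.trans ?_
  have := cauchyKer_le_mul_cauchyKer (N := (Q * 2 ^ s : ℝ)) (c := 15) (by positivity)
    (by norm_num) t
  linarith

/-! ### Jackson kernels: moments and averaged differences -/

/-- The mass of the unnormalized Jackson kernel. -/
def jacksonMass (L M : ℕ) : ℝ := ∫ t, ‖dirichletKer M t‖ ^ (2 * L) ∂circMeasure

/-- The generalized Jackson kernel. -/
def jacksonKer (L M : ℕ) (t : Circ) : ℝ := ‖dirichletKer M t‖ ^ (2 * L) / jacksonMass L M

theorem continuous_jacksonKer (L M : ℕ) : Continuous (jacksonKer L M) := by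
  unfold jacksonKer; fun_prop

/-- Only the ball where the Dirichlet kernel is at least half its peak is kept; its normalized
measure is 1/(2π(2M+1)). -/
theorem le_jacksonMass (L M : ℕ) :
    ((2 * M + 1 : ℝ) / 2) ^ (2 * L) / (2 * π * (2 * M + 1)) ≤ jacksonMass L M := by
  set ε : ℝ := 1 / (2 * (2 * M + 1)) with hε
  have hM : (0 : ℝ) < 2 * M + 1 := by positivity
  have hpi := Real.pi_gt_three
  have hvol : circMeasure.real (Metric.closedBall 0 ε) = 1 / (2 * π * (2 * M + 1)) := by
    have h := AddCircle.volume_closedBall (2 * π) (x := 0) ε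
    rw [AddCircle.volume_eq_smul_haarAddCircle, Measure.smul_apply, smul_eq_mul, min_eq_right,
      ] at h
    · have h2 := congrArg ENNReal.toReal h
      rw [ENNReal.toReal_mul, ENNReal.toReal_ofReal (by positivity),
        ENNReal.toReal_ofReal (by positivity)] at h2
      rw [Measure.real, eq_div_iff (by positivity)]
      have h3 : 2 * ε * (2 * M + 1) = 1 := by rw [hε]; field_simp
      linear_combination (2 * M + 1 : ℝ) * h2 + h3
    · have : ε ≤ 1 := by
        rw [hε, div_le_one (by positivity)]
        nlinarith
      linarith
  have hint : Integrable (fun t => ‖dirichletKer M t‖ ^ (2 * L)) circMeasure :=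
    integrable_circ_of_continuous (by fun_prop)
  calc _ = ∫ t in Metric.closedBall (0 : Circ) ε, ((2 * M + 1 : ℝ) / 2) ^ (2 * L)
          ∂circMeasure := by
        rw [setIntegral_const, hvol, smul_eq_mul]; ring
    _ ≤ ∫ t in Metric.closedBall (0 : Circ) ε, ‖dirichletKer M t‖ ^ (2 * L) ∂circMeasure := by
        refine setIntegral_mono_on (integrable_const _).integrableOn hint.integrableOn
          Metric.isClosed_closedBall.measurableSet fun t ht => ?_
        rw [mem_closedBall_zero_iff] at ht
        have := le_norm_dirichletKer M ht
        gcongr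
    _ ≤ jacksonMass L M :=
        setIntegral_le_integral hint (Filter.Eventually.of_forall fun t => by positivity)

theorem jacksonMass_pos (L M : ℕ) : 0 < jacksonMass L M :=
  lt_of_lt_of_le (by positivity) (le_jacksonMass L M)

theorem jacksonKer_nonneg (L M : ℕ) (t : Circ) : 0 ≤ jacksonKer L M t :=
  div_nonneg (by positivity) (jacksonMass_pos L M).le

theorem integral_jacksonKer (L M : ℕ) : ∫ t, jacksonKer L M t ∂circMeasure = 1 := by
  unfold jacksonKer
  rw [integral_div]
  exact div_self (jacksonMass_pos L M).ne'

theorem integral_norm_dirichletKer_sq_le (M : ℕ) :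
    ∫ t, ‖dirichletKer M t‖ ^ 2 ∂circMeasure ≤ 11 * (2 * M + 1) := by
  have hM : (0 : ℝ) < 2 * M + 1 := by positivity
  have hpi2 : π ^ 2 ≤ 10 := by nlinarith [Real.pi_lt_d2, Real.pi_pos]
  have h : ∀ t, ‖dirichletKer M t‖ ^ 2 ≤ 11 * (2 * M + 1) * cauchyKer (2 * M + 1) t := by
    intro t
    have h1 := norm_dirichletKer_le M t
    have h2 := norm_dirichletKer_mul_le M t
    refine (le_cauchyKer_of_le (N := 2 * M + 1) (A := 2 * M + 1) (B := 10 * (2 * M + 1)) ?_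
      ?_).trans (le_of_eq (by ring))
    · calc ‖dirichletKer M t‖ ^ 2 ≤ (2 * M + 1) ^ 2 := by gcongr
        _ = _ := by ring
    · calc _ = (2 * M + 1) ^ 2 * (‖dirichletKer M t‖ * ‖t‖) ^ 2 := by ring
        _ ≤ (2 * M + 1) ^ 2 * π ^ 2 := by gcongr
        _ ≤ (2 * M + 1) ^ 2 * 10 := by gcongr
        _ = _ := by ring
  calc _ ≤ ∫ t, 11 * (2 * M + 1) * cauchyKer (2 * M + 1) t ∂circMeasure :=
        integral_mono (integrable_circ_of_continuous (by fun_prop))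
          (integrable_circ_of_continuous ((continuous_cauchyKer _).const_mul _)) h
    _ ≤ 11 * (2 * M + 1) * 1 := by
        rw [integral_const_mul]
        gcongr
        exact integral_cauchyKer_le _
    _ = _ := mul_one _

/-- Moments of the Jackson kernel. -/
theorem integral_jacksonKer_mul_rpow_le {L : ℕ} {q : ℝ} (hq : 0 ≤ q) (hL : q + 2 ≤ 2 * L) :
    ∃ C : ℝ, 0 < C ∧ ∀ M : ℕ,
      ∫ t, jacksonKer L M t * ‖t‖ ^ q ∂circMeasure ≤ C * (2 * M + 1 : ℝ) ^ (-q) := by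
  refine ⟨π ^ q * 11 * (2 * π) * 2 ^ (2 * L), by positivity, fun M => ?_⟩
  set A : ℝ := 2 * M + 1 with hA
  have hA0 : 0 < A := by positivity
  have hpt : ∀ t : Circ, jacksonKer L M t * ‖t‖ ^ q
      ≤ π ^ q * A ^ (2 * L - 2 - q) / jacksonMass L M * ‖dirichletKer M t‖ ^ 2 := by
    intro t
    have h1 := norm_dirichletKer_le M t
    have h2 := norm_dirichletKer_mul_le M t
    unfold jacksonKer
    rw [div_mul_eq_mul_div, div_mul_eq_mul_div]
    refine div_le_div_of_nonneg_right ?_ (jacksonMass_pos L M).le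
    rcases (norm_nonneg (dirichletKer M t)).eq_or_lt with h0 | h0
    · rw [← h0, zero_pow (by
        rintro h
        have : L = 0 := by omega
        rw [this] at hL
        norm_num at hL
        linarith)]
      simp
    -- Of the 2L factors, q are paired with ‖t‖^q, two are kept to be integrated, and the remaining
    -- 2L - 2 - q ≥ 0 are bounded by the peak.
    · calc ‖dirichletKer M t‖ ^ (2 * L) * ‖t‖ ^ q
          = (‖dirichletKer M t‖ * ‖t‖) ^ q * ‖dirichletKer M t‖ ^ (2 * L - 2 - q)
              * ‖dirichletKer M t‖ ^ 2 := by
            rw [Real.mul_rpow (norm_nonneg _) (norm_nonneg _), ← Real.rpow_natCast,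
              ← Real.rpow_natCast, show ‖dirichletKer M t‖ ^ q * ‖t‖ ^ q
                * ‖dirichletKer M t‖ ^ (2 * L - 2 - q) * ‖dirichletKer M t‖ ^ ((2 : ℕ) : ℝ)
                = (‖dirichletKer M t‖ ^ q * ‖dirichletKer M t‖ ^ (2 * L - 2 - q)
                  * ‖dirichletKer M t‖ ^ ((2 : ℕ) : ℝ)) * ‖t‖ ^ q by ring,
              ← Real.rpow_add h0, ← Real.rpow_add h0]
            congr 2
            push_cast
            ring
        _ ≤ π ^ q * A ^ (2 * L - 2 - q) * ‖dirichletKer M t‖ ^ 2 := by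
            gcongr
            linarith
  calc _ ≤ ∫ t, π ^ q * A ^ (2 * L - 2 - q) / jacksonMass L M * ‖dirichletKer M t‖ ^ 2
          ∂circMeasure := by
        refine integral_mono (integrable_circ_of_continuous ?_)
          (integrable_circ_of_continuous (by fun_prop)) hpt
        exact (continuous_jacksonKer L M).mul (continuous_norm.rpow_const fun _ => Or.inr hq)
    _ ≤ π ^ q * A ^ (2 * L - 2 - q) / jacksonMass L M * (11 * A) := by
        rw [integral_const_mul]
        have := jacksonMass_pos L M
        gcongr
        exact integral_norm_dirichletKer_sq_le M
    _ ≤ π ^ q * A ^ (2 * L - 2 - q) / ((A / 2) ^ (2 * L) / (2 * π * A)) * (11 * A) := by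
        gcongr
        exact le_jacksonMass L M
    _ = _ := by
        have e : A ^ (2 * L - 2 - q : ℝ) = A ^ (2 * L) * A ^ (-q) / A ^ 2 := by
          rw [← Real.rpow_natCast, ← Real.rpow_natCast, ← Real.rpow_add hA0, ← Real.rpow_sub hA0]
          congr 1
          push_cast
          ring
        rw [e, div_pow]
        field_simp

/-- High-frequency characters are almost inverted by averaged differences. -/
theorem integral_jacksonKer_mul_fourier_sub_one_pow {L M : ℕ} (l : ℕ) {k : ℤ}
    (hk : ((2 * L * M : ℕ) : ℤ) < |k|) :
    ∫ t, (jacksonKer L M t : ℂ) * (fourier k t - 1) ^ l ∂circMeasure = (-1) ^ l := by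
  -- In the binomial expansion the terms with i ≥ 1 have frequency ik beyond the degree 2LM of the
  -- kernel and integrate to zero; only the constant term (-1)^l survives.
  have hz : ∀ i : ℕ, ∫ t, (jacksonKer L M t : ℂ) * fourier k t ^ i ∂circMeasure
      = if i = 0 then 1 else 0 := by
    intro i
    split_ifs with hi
    · subst hi
      simp only [pow_zero, mul_one]
      rw [integral_complex_ofReal, integral_jacksonKer, Complex.ofReal_one]
    · have h1 : ∀ t : Circ, (jacksonKer L M t : ℂ) * fourier k t ^ i
          = (jacksonMass L M : ℂ)⁻¹ * ((dirichletKer M ^ (2 * L)) t * fourier (i * k : ℤ) t) := by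
        intro t
        have h2 : (fourier k t : ℂ) ^ i = fourier (i * k : ℤ) t := by
          rw [fourier_eq_exp, fourier_eq_exp, ← Complex.exp_nat_mul]
          congr 1
          push_cast
          ring
        rw [h2, jacksonKer, Complex.ofReal_div, ofReal_norm_dirichletKer_pow,
          ContinuousMap.pow_apply]
        ring
      simp_rw [h1]
      rw [integral_const_mul,
        integral_trigPoly_mul_fourier (dirichletKer_pow_mem_trigPoly M (2 * L)),
        mul_zero]
      refine lt_of_lt_of_le hk ?_
      rw [abs_mul]
      have : 1 ≤ |(i : ℤ)| := by
        rw [Nat.abs_cast]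
        exact_mod_cast Nat.one_le_iff_ne_zero.2 hi
      nlinarith [abs_nonneg k]
  have hexp : ∀ t : Circ, (jacksonKer L M t : ℂ) * (fourier k t - 1) ^ l
      = ∑ i ∈ Finset.range (l + 1), ((-1) ^ (l - i) * (l.choose i : ℂ)) *
        ((jacksonKer L M t : ℂ) * fourier k t ^ i) := by
    intro t
    rw [sub_eq_add_neg, add_pow, Finset.mul_sum]
    refine Finset.sum_congr rfl fun i _ => ?_
    ring
  have hcont := continuous_jacksonKer L M
  simp_rw [hexp]
  rw [integral_finsetSum _ fun i _ => integrable_circ_of_continuous (by fun_prop)]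
  simp_rw [integral_const_mul, hz]
  simp

/-! ### Integration on the torus and Jensen's inequality -/

theorem integrable_torus_of_continuous {E : Type*} [NormedAddCommGroup E] {f : Torus 2 → E}
    (hf : Continuous f) : Integrable f (torusMeasure 2) := by
  unfold torusMeasure
  exact hf.integrable_of_hasCompactSupport (HasCompactSupport.of_compactSpace f)

theorem integrable_torus_prod_of_continuous {E : Type*} [NormedAddCommGroup E]
    {f : Torus 2 × Torus 2 → E} (hf : Continuous f) :
    Integrable f ((torusMeasure 2).prod (torusMeasure 2)) := by
  have : IsFiniteMeasure ((torusMeasure 2).prod (torusMeasure 2)) := inferInstance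
  exact hf.integrable_of_hasCompactSupport (HasCompactSupport.of_compactSpace f)

instance isAddLeftInvariant_torusMeasure (d : ℕ) : (torusMeasure d).IsAddLeftInvariant := by
  unfold torusMeasure; infer_instance

instance isNegInvariant_torusMeasure (d : ℕ) : (torusMeasure d).IsNegInvariant := by
  have : circMeasure.IsNegInvariant := Measure.IsAddHaarMeasure.isNegInvariant_of_regular _
  unfold torusMeasure
  infer_instance

theorem integral_tensor {R : Type*} [RCLike R] (a b : Circ → R) :
    ∫ x, a (x 0) * b (x 1) ∂torusMeasure 2
      = (∫ t, a t ∂circMeasure) * ∫ t, b t ∂circMeasure := by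
  have := integral_fintype_prod_eq_prod (𝕜 := R) (ι := Fin 2) (E := fun _ => Circ)
    (f := ![a, b]) (μ := fun _ => circMeasure)
  simpa [Fin.prod_univ_two, torusMeasure] using this

/-- Jensen's inequality for powers, with a weight of mass at most one. -/
theorem rpow_integral_mul_le {Ω : Type*} [MeasurableSpace Ω] {μ : Measure Ω} {g w : Ω → ℝ}
    {q : ℝ} (hq : 1 ≤ q) (hg : ∀ x, 0 ≤ g x) (hw : ∀ x, 0 ≤ w x) (hwi : Integrable w μ)
    (hgw : Integrable (fun x => g x * w x) μ) (hgq : Integrable (fun x => g x ^ q * w x) μ)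
    (hmass : ∫ x, w x ∂μ ≤ 1) :
    (∫ x, g x * w x ∂μ) ^ q ≤ ∫ x, g x ^ q * w x ∂μ := by
  set a := ∫ x, g x * w x ∂μ with ha
  have hq0 : 0 < q := by linarith
  have ha0 : 0 ≤ a := integral_nonneg fun x => mul_nonneg (hg x) (hw x)
  rcases ha0.eq_or_lt with h0 | h0
  · rw [← h0, Real.zero_rpow hq0.ne']
    exact integral_nonneg fun x => mul_nonneg (Real.rpow_nonneg (hg x) _) (hw x)
  -- Tangent line of u ↦ u^q at the weighted mean a, times the weight. Integrated with mass m ≤ 1 it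
  -- gives a^q(m + q(1 - m)), which is at least a^q since q ≥ 1.
  have hpt : ∀ x, a ^ q * w x + q * a ^ (q - 1) * (g x * w x - a * w x) ≤ g x ^ q * w x := by
    intro x
    have h1 := one_add_mul_self_le_rpow_one_add (s := g x / a - 1) (by
      have := div_nonneg (hg x) h0.le
      linarith) hq
    rw [show 1 + (g x / a - 1) = g x / a by ring, Real.div_rpow (hg x) h0.le,
      le_div_iff₀ (by positivity)] at h1
    have h2 : a ^ (q - 1) = a ^ q / a := by rw [Real.rpow_sub h0, Real.rpow_one]
    have h3 : a ^ q + q * a ^ (q - 1) * (g x - a) ≤ g x ^ q := by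
      refine le_trans (le_of_eq ?_) h1
      rw [h2]
      field_simp
    calc _ = (a ^ q + q * a ^ (q - 1) * (g x - a)) * w x := by ring
      _ ≤ _ := mul_le_mul_of_nonneg_right h3 (hw x)
  have hint₁ : Integrable (fun x => q * a ^ (q - 1) * (g x * w x - a * w x)) μ :=
    (hgw.sub (hwi.const_mul _)).const_mul _
  have hint : Integrable (fun x => a ^ q * w x + q * a ^ (q - 1) * (g x * w x - a * w x)) μ :=
    (hwi.const_mul _).add hint₁
  refine le_trans ?_ (integral_mono hint hgq hpt)
  rw [integral_add (hwi.const_mul _) hint₁,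
    integral_const_mul, integral_const_mul, integral_sub hgw (hwi.const_mul _),
    integral_const_mul, ← ha]
  set m := ∫ x, w x ∂μ
  have h2 : a ^ (q - 1) * a = a ^ q := by
    rw [← Real.rpow_add_one h0.ne']; congr 1; ring
  have h3 : 0 < a ^ q := by positivity
  have : a ^ q * m + q * a ^ (q - 1) * (a - a * m)
      = a ^ q * m + q * (a ^ (q - 1) * a) * (1 - m) := by ring
  rw [this, h2]
  nlinarith [mul_nonneg (mul_nonneg h3.le (sub_nonneg.2 hq)) (sub_nonneg.2 hmass)]

/-! ### Mixed differences as Fourier multipliers -/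

/-- The `l`-th difference in the `j`-th variable, with a step on the circle. -/
def circDiff (l : ℕ) (t : Circ) (j : Fin 2) (g : Torus 2 → ℂ) : Torus 2 → ℂ :=
  (fwdDiff (Pi.single j t : Torus 2))^[l] g

/-- The mixed difference over the variables `j` with `s j ≠ 0`. -/
def blockDiff (l : ℕ) (s : Fin 2 → ℕ) (t : Torus 2) (f : Torus 2 → ℂ) : Torus 2 → ℂ :=
  circDiff (if s 1 = 0 then 0 else l) (t 1) 1 (circDiff (if s 0 = 0 then 0 else l) (t 0) 0 f)

theorem mixedDiff_eq_blockDiff (l : ℕ) (s : Fin 2 → ℕ) (t : Fin 2 → ℝ) (f : Torus 2 → ℂ) :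
    mixedDiff l t (Finset.univ.filter fun j => s j ≠ 0) f
      = blockDiff l s (fun j => (t j : Circ)) f := by
  simp only [mixedDiff, blockDiff, List.finRange_succ, List.finRange_zero, List.map_nil,
    List.map_cons, List.foldl_cons, List.foldl_nil, Finset.mem_filter, Finset.mem_univ, true_and,
    Fin.succ_zero_eq_one]
  split_ifs with h0 h1 h1 <;> simp_all [coordDiff, circDiff]

theorem continuous_circDiff {X : Type*} [TopologicalSpace X] (l : ℕ) (j : Fin 2) {τ : X → Circ}
    (hτ : Continuous τ) {G : X → Torus 2 → ℂ}
    (hG : Continuous fun p : X × Torus 2 => G p.1 p.2) :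
    Continuous fun p : X × Torus 2 => circDiff l (τ p.1) j (G p.1) p.2 := by
  simp only [circDiff, fwdDiff_iter_eq_sum_shift]
  refine continuous_finsetSum _ fun k _ => Continuous.const_smul ?_ _
  have h1 : Continuous fun p : X × Torus 2 => p.2 + k • (Pi.single j (τ p.1) : Torus 2) := by
    have := (continuous_single (A := fun _ : Fin 2 => Circ) j).comp (hτ.comp continuous_fst
      (X := X × Torus 2))
    exact continuous_snd.add (this.const_smul k)
  exact hG.comp (continuous_fst.prodMk h1)

theorem continuous_blockDiff (l : ℕ) (s : Fin 2 → ℕ) {f : Torus 2 → ℂ} (hf : Continuous f) :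
    Continuous fun p : Torus 2 × Torus 2 => blockDiff l s p.1 f p.2 := by
  unfold blockDiff
  refine continuous_circDiff (τ := fun t : Torus 2 => t 1)
    (G := fun t => circDiff (if s 0 = 0 then 0 else l) (t 0) 0 f) _ _ (continuous_apply 1) ?_
  exact continuous_circDiff (τ := fun t : Torus 2 => t 0) (G := fun _ => f) _ _ (continuous_apply 0)
    (hf.comp continuous_snd)

theorem continuous_torusChar (k₁ k₂ : ℤ) : Continuous (torusChar k₁ k₂) := by
  unfold torusChar; fun_prop

theorem torusChar_add_apply (k₁ k₂ : ℤ) (x y : Torus 2) :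
    torusChar k₁ k₂ (x + y) = torusChar k₁ k₂ x * torusChar k₁ k₂ y := by
  have h : ∀ (k : ℤ) (s t : Circ), (fourier k (s + t) : ℂ) = fourier k s * fourier k t := by
    intro k s t
    rw [fourier_apply, fourier_apply, fourier_apply, smul_add, AddCircle.toCircle_add,
      Circle.coe_mul]
  simp only [torusChar, Pi.add_apply, h]
  ring

theorem torusChar_mul_torusChar_neg (k₁ k₂ : ℤ) (x : Torus 2) :
    torusChar k₁ k₂ x * torusChar (-k₁) (-k₂) x = 1 := by
  simp only [torusChar]
  calc _ = (fourier k₁ (x 0) * fourier (-k₁) (x 0)) *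
        (fourier k₂ (x 1) * fourier (-k₂) (x 1) : ℂ) := by
        ring
    _ = 1 := by
        rw [fourier_mul_fourier, fourier_mul_fourier, add_neg_cancel, add_neg_cancel,
          fourier_zero_apply, fourier_zero_apply, one_mul]

/-- The Fourier coefficients on the torus. -/
def torusCoeff (f : Torus 2 → ℂ) (k₁ k₂ : ℤ) : ℂ :=
  ∫ y, f y * torusChar (-k₁) (-k₂) y ∂torusMeasure 2

/-- Translation invariance of the measure turns a shift of f into multiplication of the coefficient
by a character value. -/
theorem torusCoeff_fwdDiff {f : Torus 2 → ℂ} (hf : Continuous f) (h : Torus 2) (k₁ k₂ : ℤ) :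
    torusCoeff (fwdDiff h f) k₁ k₂ = (torusChar k₁ k₂ h - 1) * torusCoeff f k₁ k₂ := by
  have hc := continuous_torusChar (-k₁) (-k₂)
  have h1 : ∫ y, f (y + h) * torusChar (-k₁) (-k₂) y ∂torusMeasure 2
      = torusChar k₁ k₂ h * torusCoeff f k₁ k₂ := by
    have e : ∀ y, f (y + h) * torusChar (-k₁) (-k₂) y
        = torusChar k₁ k₂ h * (f (y + h) * torusChar (-k₁) (-k₂) (y + h)) := by
      intro y
      rw [torusChar_add_apply]
      linear_combination (-(f (y + h)) * torusChar (-k₁) (-k₂) y)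
        * torusChar_mul_torusChar_neg k₁ k₂ h
    simp_rw [e]
    rw [integral_const_mul, torusCoeff,
      integral_add_right_eq_self (fun y => f y * torusChar (-k₁) (-k₂) y) h]
  simp only [torusCoeff, fwdDiff, sub_mul]
  rw [integral_sub (integrable_torus_of_continuous (by fun_prop))
    (integrable_torus_of_continuous (by fun_prop)), h1, one_mul]
  rfl

theorem continuous_fwdDiff_iter {f : Torus 2 → ℂ} (hf : Continuous f) (h : Torus 2) (l : ℕ) :
    Continuous ((fwdDiff h)^[l] f) := by
  induction l with
  | zero => exact hf
  | succ l ih =>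
    rw [Function.iterate_succ_apply']
    unfold fwdDiff at ih ⊢
    exact (ih.comp (continuous_add_const h)).sub ih

theorem torusCoeff_circDiff {f : Torus 2 → ℂ} (hf : Continuous f) (l : ℕ) (t : Circ) (j : Fin 2)
    (k₁ k₂ : ℤ) :
    torusCoeff (circDiff l t j f) k₁ k₂
      = (torusChar k₁ k₂ (Pi.single j t) - 1) ^ l * torusCoeff f k₁ k₂ := by
  unfold circDiff
  induction l with
  | zero => simp
  | succ l ih =>
    rw [Function.iterate_succ_apply', torusCoeff_fwdDiff (continuous_fwdDiff_iter hf _ _), ih]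
    ring

theorem torusCoeff_blockDiff {f : Torus 2 → ℂ} (hf : Continuous f) (l : ℕ) (s : Fin 2 → ℕ)
    (t : Torus 2) (k₁ k₂ : ℤ) :
    torusCoeff (blockDiff l s t f) k₁ k₂
      = ((fourier k₁ (t 0) - 1) ^ (if s 0 = 0 then 0 else l) *
        (fourier k₂ (t 1) - 1) ^ (if s 1 = 0 then 0 else l)) * torusCoeff f k₁ k₂ := by
  have h0 : ∀ u : Circ, torusChar k₁ k₂ (Pi.single 0 u) = fourier k₁ u := by
    intro u; simp [torusChar]
  have h1 : ∀ u : Circ, torusChar k₁ k₂ (Pi.single 1 u) = fourier k₂ u := by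
    intro u; simp [torusChar]
  rw [blockDiff, torusCoeff_circDiff
    (f := circDiff (if s 0 = 0 then 0 else l) (t 0) 0 f) (continuous_fwdDiff_iter hf _ _),
    torusCoeff_circDiff hf, h0, h1]
  ring

/-! ### Dyadic blocks and their smoothness estimates -/

/-- The block kernel on the torus. -/
def blockKer₂ (Q : ℕ) (s : Fin 2 → ℕ) (x : Torus 2) : ℂ :=
  blockKer Q (s 0) (x 0) * blockKer Q (s 1) (x 1)

theorem continuous_blockKer₂ (Q : ℕ) (s : Fin 2 → ℕ) : Continuous (blockKer₂ Q s) := by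
  have h0 := continuous_blockKer Q (s 0)
  have h1 := continuous_blockKer Q (s 1)
  unfold blockKer₂
  fun_prop

/-- The dyadic block of a function. -/
def block (Q : ℕ) (s : Fin 2 → ℕ) (f : Torus 2 → ℂ) (x : Torus 2) : ℂ :=
  ∫ y, blockKer₂ Q s (x - y) * f y ∂torusMeasure 2

/-- The averaged mixed difference. -/
def avgDiff (L l : ℕ) (s : Fin 2 → ℕ) (f : Torus 2 → ℂ) (x : Torus 2) : ℂ :=
  ∫ t, ((jacksonKer L (2 ^ s 0) (t 0) * jacksonKer L (2 ^ s 1) (t 1) : ℝ) : ℂ)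
    * blockDiff l s t f x ∂torusMeasure 2

theorem continuous_integral_torus {E : Type*} [NormedAddCommGroup E] [NormedSpace ℝ E]
    {F : Torus 2 → Torus 2 → E} (hF : Continuous fun p : Torus 2 × Torus 2 => F p.1 p.2) :
    Continuous fun x => ∫ y, F x y ∂torusMeasure 2 := by
  have := continuous_parametric_integral_of_continuous (μ := torusMeasure 2) (f := F) hF
    (isCompact_univ)
  simpa using this

theorem continuous_jacksonKer₂ (L : ℕ) (s : Fin 2 → ℕ) : Continuous fun t : Torus 2 =>
    jacksonKer L (2 ^ s 0) (t 0) * jacksonKer L (2 ^ s 1) (t 1) := by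
  have h0 := continuous_jacksonKer L (2 ^ s 0)
  have h1 := continuous_jacksonKer L (2 ^ s 1)
  fun_prop

theorem continuous_avgDiff (L l : ℕ) (s : Fin 2 → ℕ) {f : Torus 2 → ℂ} (hf : Continuous f) :
    Continuous (avgDiff L l s f) := by
  unfold avgDiff
  apply continuous_integral_torus
  have h := continuous_jacksonKer₂ L s
  have h2 := (continuous_blockDiff l s hf).comp (continuous_swap (X := Torus 2) (Y := Torus 2))
  exact (Complex.continuous_ofReal.comp (h.comp continuous_snd)).mul h2

theorem continuous_block (Q : ℕ) (s : Fin 2 → ℕ) {f : Torus 2 → ℂ} (hf : Continuous f) :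
    Continuous (block Q s f) := by
  unfold block
  apply continuous_integral_torus
  have h := continuous_blockKer₂ Q s
  fun_prop

/-- The multiplier factors over the two variables, each factor being a Jackson average of (e^{ikt} -
1)^l. A variable with s j = 0 is not differenced, so its frequency is unrestricted. -/
theorem torusCoeff_avgDiff {f : Torus 2 → ℂ} (hf : Continuous f) (L l : ℕ) (s : Fin 2 → ℕ)
    {k₁ k₂ : ℤ} (h₁ : s 0 ≠ 0 → ((2 * L * 2 ^ s 0 : ℕ) : ℤ) < |k₁|)
    (h₂ : s 1 ≠ 0 → ((2 * L * 2 ^ s 1 : ℕ) : ℤ) < |k₂|) :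
    torusCoeff (avgDiff L l s f) k₁ k₂
      = (-1) ^ ((if s 0 = 0 then 0 else l) + if s 1 = 0 then 0 else l) * torusCoeff f k₁ k₂ := by
  have hb := continuous_blockDiff l s hf
  have hj := continuous_jacksonKer₂ L s
  have hc := continuous_torusChar (-k₁) (-k₂)
  have hm : ∀ (u : ℕ) (k : ℤ), (u ≠ 0 → ((2 * L * 2 ^ u : ℕ) : ℤ) < |k|) →
      ∫ t, (jacksonKer L (2 ^ u) t : ℂ) * (fourier k t - 1) ^ (if u = 0 then 0 else l)
        ∂circMeasure = (-1) ^ (if u = 0 then 0 else l) := by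
    intro u k hk
    split_ifs with hu
    · simp only [pow_zero, mul_one]
      rw [integral_complex_ofReal, integral_jacksonKer, Complex.ofReal_one]
    · exact integral_jacksonKer_mul_fourier_sub_one_pow l (hk hu)
  calc torusCoeff (avgDiff L l s f) k₁ k₂
      = ∫ x, ∫ t, ((jacksonKer L (2 ^ s 0) (t 0) * jacksonKer L (2 ^ s 1) (t 1) : ℝ) : ℂ)
          * blockDiff l s t f x * torusChar (-k₁) (-k₂) x ∂torusMeasure 2 ∂torusMeasure 2 := by
        simp only [torusCoeff, avgDiff, integral_mul_const]
    _ = ∫ t, ∫ x, ((jacksonKer L (2 ^ s 0) (t 0) * jacksonKer L (2 ^ s 1) (t 1) : ℝ) : ℂ)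
          * blockDiff l s t f x * torusChar (-k₁) (-k₂) x ∂torusMeasure 2 ∂torusMeasure 2 := by
        rw [integral_integral_swap]
        refine integrable_torus_prod_of_continuous ?_
        have h2 := hb.comp (continuous_swap (X := Torus 2) (Y := Torus 2))
        exact ((Complex.continuous_ofReal.comp (hj.comp continuous_snd)).mul h2).mul
          (hc.comp continuous_fst)
    _ = ∫ t, (((jacksonKer L (2 ^ s 0) (t 0) : ℂ)
            * (fourier k₁ (t 0) - 1) ^ (if s 0 = 0 then 0 else l)) *
          ((jacksonKer L (2 ^ s 1) (t 1) : ℂ)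
            * (fourier k₂ (t 1) - 1) ^ (if s 1 = 0 then 0 else l))) * torusCoeff f k₁ k₂
          ∂torusMeasure 2 := by
        refine integral_congr_ae (Filter.Eventually.of_forall fun t => ?_)
        have := torusCoeff_blockDiff hf l s t k₁ k₂
        simp only [mul_assoc] at this ⊢
        rw [integral_const_mul, ← torusCoeff, this]
        push_cast
        ring
    _ = _ := by
        rw [integral_mul_const, integral_tensor (fun t => (jacksonKer L (2 ^ s 0) t : ℂ)
            * (fourier k₁ t - 1) ^ (if s 0 = 0 then 0 else l))
            (fun t => (jacksonKer L (2 ^ s 1) t : ℂ)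
            * (fourier k₂ t - 1) ^ (if s 1 = 0 then 0 else l)), hm _ _ h₁, hm _ _ h₂, pow_add]

/-- The frequencies of a block. -/
def blockFreq (Q s : ℕ) : Finset ℤ :=
  Finset.Icc (-((3 * (Q * 2 ^ s) : ℕ) : ℤ)) (3 * (Q * 2 ^ s) : ℕ)

theorem block_eq_sum (Q : ℕ) (s : Fin 2 → ℕ) {f : Torus 2 → ℂ} (hf : Continuous f)
    (x : Torus 2) :
    block Q s f x = ∑ k ∈ blockFreq Q (s 0) ×ˢ blockFreq Q (s 1),
      ((blockCoeff Q (s 0) k.1 : ℂ) * blockCoeff Q (s 1) k.2 * torusCoeff f k.1 k.2)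
        * torusChar k.1 k.2 x := by
  have hk : ∀ y, blockKer₂ Q s (x - y) * f y
      = ∑ k ∈ blockFreq Q (s 0) ×ˢ blockFreq Q (s 1),
        ((blockCoeff Q (s 0) k.1 : ℂ) * blockCoeff Q (s 1) k.2 * torusChar k.1 k.2 x)
          * (f y * torusChar (-k.1) (-k.2) y) := by
    intro y
    rw [blockKer₂, blockKer, blockKer, Finset.sum_mul_sum, ← Finset.sum_product', Finset.sum_mul]
    refine Finset.sum_congr rfl fun k _ => ?_
    have h1 : fourier k.1 ((x - y) 0) * fourier k.2 ((x - y) 1)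
        = torusChar k.1 k.2 x * torusChar (-k.1) (-k.2) y := by
      have h2 := torusChar_add_apply k.1 k.2 (x - y) y
      rw [sub_add_cancel] at h2
      rw [h2, mul_assoc, torusChar_mul_torusChar_neg, mul_one]
      rfl
    linear_combination ((blockCoeff Q (s 0) k.1 : ℂ) * blockCoeff Q (s 1) k.2 * f y) * h1
  unfold block
  simp_rw [hk]
  rw [integral_finsetSum _ fun k _ => integrable_torus_of_continuous (by
    have := continuous_torusChar (-k.1) (-k.2); fun_prop)]
  refine Finset.sum_congr rfl fun k _ => ?_
  rw [integral_const_mul, torusCoeff]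
  ring

/-- This is why Q = 4L: a block of index u ≥ 1 lives on |k| > 4L · 2^{u-1} = 2L · 2^u, beyond the
degree of the Jackson kernel, where averaging differences only changes the sign. -/
theorem norm_block_avgDiff {L : ℕ} (l : ℕ) (s : Fin 2 → ℕ) {f : Torus 2 → ℂ}
    (hf : Continuous f) (x : Torus 2) :
    ‖block (4 * L) s (avgDiff L l s f) x‖ = ‖block (4 * L) s f x‖ := by
  have h : block (4 * L) s (avgDiff L l s f) x
      = (-1) ^ ((if s 0 = 0 then 0 else l) + if s 1 = 0 then 0 else l) * block (4 * L) s f x := by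
    rw [block_eq_sum _ _ (continuous_avgDiff L l s hf), block_eq_sum _ _ hf, Finset.mul_sum]
    refine Finset.sum_congr rfl fun k _ => ?_
    have hz : ∀ (u : ℕ) (m : ℤ), blockCoeff (4 * L) u m ≠ 0 →
        u ≠ 0 → ((2 * L * 2 ^ u : ℕ) : ℤ) < |m| := by
      intro u m hm hu
      obtain ⟨v, rfl⟩ := Nat.exists_eq_succ_of_ne_zero hu
      by_contra! hle
      refine hm (blockCoeff_of_le (hle.trans (le_of_eq ?_)))
      rw [Nat.succ_eq_add_one, pow_succ]
      push_cast
      ring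
    by_cases h1 : blockCoeff (4 * L) (s 0) k.1 = 0
    · simp [h1]
    by_cases h2 : blockCoeff (4 * L) (s 1) k.2 = 0
    · simp [h2]
    rw [torusCoeff_avgDiff hf L l s (hz _ _ h1) (hz _ _ h2)]
    ring
  rw [h, norm_mul]
  simp

/-- The majorant of the block kernel. -/
def majKer (Q : ℕ) (s : Fin 2 → ℕ) (x : Torus 2) : ℝ :=
  cauchyKer (15 * (Q * 2 ^ s 0)) (x 0) * cauchyKer (15 * (Q * 2 ^ s 1)) (x 1)

theorem continuous_majKer (Q : ℕ) (s : Fin 2 → ℕ) : Continuous (majKer Q s) := by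
  have h0 := continuous_cauchyKer (15 * (Q * 2 ^ s 0))
  have h1 := continuous_cauchyKer (15 * (Q * 2 ^ s 1))
  unfold majKer
  fun_prop

theorem majKer_nonneg (Q : ℕ) (s : Fin 2 → ℕ) (x : Torus 2) : 0 ≤ majKer Q s x :=
  mul_nonneg (cauchyKer_nonneg (by positivity) _) (cauchyKer_nonneg (by positivity) _)

theorem integral_majKer_le (Q : ℕ) (s : Fin 2 → ℕ) (x : Torus 2) :
    ∫ y, majKer Q s (x - y) ∂torusMeasure 2 ≤ 1 := by
  rw [integral_sub_left_eq_self (majKer Q s)]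
  unfold majKer
  rw [integral_tensor (cauchyKer (15 * (Q * 2 ^ s 0))) (cauchyKer (15 * (Q * 2 ^ s 1)))]
  exact mul_le_one₀ (integral_cauchyKer_le _)
    (integral_nonneg fun t => cauchyKer_nonneg (by positivity) t) (integral_cauchyKer_le _)

theorem norm_blockKer₂_le {Q : ℕ} (hQ : 1 ≤ Q) (s : Fin 2 → ℕ) (x : Torus 2) :
    ‖blockKer₂ Q s x‖ ≤ 450 ^ 2 * majKer Q s x := by
  rw [blockKer₂, majKer, norm_mul]
  refine (mul_le_mul (norm_blockKer_le hQ _ _) (norm_blockKer_le hQ _ _) (norm_nonneg _)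
    ?_).trans (le_of_eq (by ring))
  exact mul_nonneg (by norm_num) (cauchyKer_nonneg (by positivity) _)

theorem norm_block_rpow_le {L : ℕ} (hL : 1 ≤ L) (l : ℕ) (s : Fin 2 → ℕ) {f : Torus 2 → ℂ}
    (hf : Continuous f) {q : ℝ} (hq : 1 ≤ q) (x : Torus 2) :
    ‖block (4 * L) s f x‖ ^ q ≤ (450 ^ 2) ^ q *
      ∫ y, ‖avgDiff L l s f y‖ ^ q * majKer (4 * L) s (x - y) ∂torusMeasure 2 := by
  have hg := continuous_avgDiff L l s hf
  have hm : Continuous fun y => majKer (4 * L) s (x - y) :=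
    (continuous_majKer (4 * L) s).comp (continuous_sub_left x)
  have hk := continuous_blockKer₂ (4 * L) s
  have hgq : Continuous fun y => ‖avgDiff L l s f y‖ ^ q :=
    hg.norm.rpow_const fun _ => Or.inr (by linarith)
  have h1 : ‖block (4 * L) s f x‖ ≤ 450 ^ 2 *
      ∫ y, ‖avgDiff L l s f y‖ * majKer (4 * L) s (x - y) ∂torusMeasure 2 := by
    rw [← norm_block_avgDiff l s hf, block, ← integral_const_mul]
    refine (norm_integral_le_integral_norm _).trans
      (integral_mono (integrable_torus_of_continuous (by fun_prop))
        (integrable_torus_of_continuous (by fun_prop)) fun y => ?_)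
    simp only [norm_mul]
    calc _ ≤ (450 ^ 2 * majKer (4 * L) s (x - y)) * ‖avgDiff L l s f y‖ := by
          gcongr
          exact norm_blockKer₂_le (by omega) s _
      _ = _ := by ring
  have h2 : 0 ≤ ∫ y, ‖avgDiff L l s f y‖ * majKer (4 * L) s (x - y) ∂torusMeasure 2 :=
    integral_nonneg fun y => mul_nonneg (norm_nonneg _) (majKer_nonneg _ _ _)
  calc _ ≤ (450 ^ 2 * ∫ y, ‖avgDiff L l s f y‖ * majKer (4 * L) s (x - y) ∂torusMeasure 2) ^ q := by
        gcongr
    _ = (450 ^ 2) ^ q *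
        (∫ y, ‖avgDiff L l s f y‖ * majKer (4 * L) s (x - y) ∂torusMeasure 2) ^ q :=
        Real.mul_rpow (by positivity) h2
    _ ≤ _ := by
        gcongr
        exact rpow_integral_mul_le hq (fun _ => norm_nonneg _) (fun _ => majKer_nonneg _ _ _)
          (integrable_torus_of_continuous hm) (integrable_torus_of_continuous (hg.norm.mul hm))
          (integrable_torus_of_continuous (hgq.mul hm)) (integral_majKer_le _ _ _)

/-- Bounds on the `q`-th powers of the mixed differences. -/
def HasMixedBound (l : ℕ) (r q : ℝ) (f : Torus 2 → ℂ) : Prop :=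
  ∀ (s : Fin 2 → ℕ) (t : Torus 2), ∫ x, ‖blockDiff l s t f x‖ ^ q ∂torusMeasure 2
    ≤ (if s 0 = 0 then 1 else ‖t 0‖ ^ (r * q)) * (if s 1 = 0 then 1 else ‖t 1‖ ^ (r * q))

/-- Jensen's inequality in the step t, then Fubini, reduce this to the moment of order rq of the
Jackson kernel in each differenced variable. -/
theorem integral_norm_avgDiff_rpow_le {L : ℕ} {r q : ℝ} (hr : 0 < r) (hq : 1 ≤ q)
    (hL : r * q + 2 ≤ 2 * L) (l : ℕ) :
    ∃ C : ℝ, 0 < C ∧ ∀ (f : Torus 2 → ℂ) (_ : Continuous f) (_ : HasMixedBound l r q f)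
      (s : Fin 2 → ℕ), ∫ x, ‖avgDiff L l s f x‖ ^ q ∂torusMeasure 2
        ≤ C * ((2 : ℝ) ^ s 0 * 2 ^ s 1) ^ (-(r * q)) := by
  have hq0 : 0 ≤ q := by linarith
  have hrq : 0 ≤ r * q := by positivity
  obtain ⟨C, hC, hmom⟩ := integral_jacksonKer_mul_rpow_le hrq hL
  -- The constant C + 1 also covers u = 0, where the integral is the total mass 1.
  have hmom' : ∀ u : ℕ, ∫ t, jacksonKer L (2 ^ u) t * (if u = 0 then 1 else ‖t‖ ^ (r * q))
      ∂circMeasure ≤ (C + 1) * ((2 : ℝ) ^ u) ^ (-(r * q)) := by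
    intro u
    by_cases hu : u = 0
    · subst hu
      simp only [if_true, mul_one, pow_zero, Real.one_rpow]
      rw [integral_jacksonKer]
      linarith
    · simp only [if_neg hu]
      refine (hmom (2 ^ u)).trans ?_
      have h1 : (2 * ((2 ^ u : ℕ) : ℝ) + 1) ^ (-(r * q)) ≤ ((2 : ℝ) ^ u) ^ (-(r * q)) := by
        refine Real.rpow_le_rpow_of_nonpos (by positivity) ?_ (by linarith)
        push_cast
        have : (0 : ℝ) < 2 ^ u := by positivity
        linarith
      calc C * (2 * ((2 ^ u : ℕ) : ℝ) + 1) ^ (-(r * q)) ≤ C * ((2 : ℝ) ^ u) ^ (-(r * q)) := by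
            gcongr
        _ ≤ _ := by gcongr; linarith
  refine ⟨(C + 1) * (C + 1), by positivity, fun f hf hb s => ?_⟩
  have hbd := continuous_blockDiff l s hf
  have hj := continuous_jacksonKer₂ L s
  have hbq : Continuous fun p : Torus 2 × Torus 2 => ‖blockDiff l s p.1 f p.2‖ ^ q :=
    hbd.norm.rpow_const fun _ => Or.inr hq0
  have hpos : ∀ t : Torus 2, 0 ≤ jacksonKer L (2 ^ s 0) (t 0) * jacksonKer L (2 ^ s 1) (t 1) :=
    fun t => mul_nonneg (jacksonKer_nonneg _ _ _) (jacksonKer_nonneg _ _ _)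
  have hfx : ∀ x, Continuous fun t => ‖blockDiff l s t f x‖ := fun x =>
    (hbd.comp (continuous_id.prodMk continuous_const)).norm
  have hfxq : ∀ x, Continuous fun t => ‖blockDiff l s t f x‖ ^ q := fun x =>
    (hfx x).rpow_const fun _ => Or.inr hq0
  have hweight : ∀ u : ℕ, Continuous fun t : Circ => (if u = 0 then 1 else ‖t‖ ^ (r * q)) := by
    intro u
    split_ifs
    · exact continuous_const
    · exact continuous_norm.rpow_const fun _ => Or.inr hrq
  have h1 : ∀ x, ‖avgDiff L l s f x‖ ^ q ≤ ∫ t, ‖blockDiff l s t f x‖ ^ q *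
      (jacksonKer L (2 ^ s 0) (t 0) * jacksonKer L (2 ^ s 1) (t 1)) ∂torusMeasure 2 := by
    intro x
    have h2 : ‖avgDiff L l s f x‖ ≤ ∫ t, ‖blockDiff l s t f x‖ *
        (jacksonKer L (2 ^ s 0) (t 0) * jacksonKer L (2 ^ s 1) (t 1)) ∂torusMeasure 2 := by
      refine (norm_integral_le_integral_norm _).trans (le_of_eq ?_)
      refine integral_congr_ae (Filter.Eventually.of_forall fun t => ?_)
      simp only [norm_mul, Complex.norm_real, Real.norm_eq_abs]
      rw [← abs_mul, abs_of_nonneg (hpos t), mul_comm]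
    calc _ ≤ (∫ t, ‖blockDiff l s t f x‖ *
        (jacksonKer L (2 ^ s 0) (t 0) * jacksonKer L (2 ^ s 1) (t 1)) ∂torusMeasure 2) ^ q := by
          gcongr
      _ ≤ _ := by
          refine rpow_integral_mul_le hq (fun _ => norm_nonneg _) hpos
            (integrable_torus_of_continuous hj)
            (integrable_torus_of_continuous ((hfx x).mul hj))
            (integrable_torus_of_continuous ((hfxq x).mul hj)) ?_
          rw [integral_tensor (jacksonKer L (2 ^ s 0)) (jacksonKer L (2 ^ s 1)),
            integral_jacksonKer, integral_jacksonKer, one_mul]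
  have hcont : Continuous fun p : Torus 2 × Torus 2 => ‖blockDiff l s p.2 f p.1‖ ^ q *
      (jacksonKer L (2 ^ s 0) (p.2 0) * jacksonKer L (2 ^ s 1) (p.2 1)) :=
    (hbq.comp (continuous_swap (X := Torus 2) (Y := Torus 2))).mul (hj.comp continuous_snd)
  have hcont' : Continuous fun p : Torus 2 × Torus 2 => ‖blockDiff l s p.1 f p.2‖ ^ q *
      (jacksonKer L (2 ^ s 0) (p.1 0) * jacksonKer L (2 ^ s 1) (p.1 1)) :=
    hbq.mul (hj.comp continuous_fst)
  have hw2 : Continuous fun t : Torus 2 =>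
      (jacksonKer L (2 ^ s 0) (t 0) * (if s 0 = 0 then 1 else ‖t 0‖ ^ (r * q))) *
        (jacksonKer L (2 ^ s 1) (t 1) * (if s 1 = 0 then 1 else ‖t 1‖ ^ (r * q))) :=
    (((continuous_jacksonKer L (2 ^ s 0)).mul (hweight (s 0))).comp (continuous_apply 0)).mul
      (((continuous_jacksonKer L (2 ^ s 1)).mul (hweight (s 1))).comp (continuous_apply 1))
  calc _ ≤ ∫ x, ∫ t, ‖blockDiff l s t f x‖ ^ q *
      (jacksonKer L (2 ^ s 0) (t 0) * jacksonKer L (2 ^ s 1) (t 1)) ∂torusMeasure 2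
        ∂torusMeasure 2 := by
        refine integral_mono (integrable_torus_of_continuous ?_)
          (integrable_torus_of_continuous (continuous_integral_torus hcont)) h1
        exact (continuous_avgDiff L l s hf).norm.rpow_const fun _ => Or.inr hq0
    _ = ∫ t, ∫ x, ‖blockDiff l s t f x‖ ^ q *
      (jacksonKer L (2 ^ s 0) (t 0) * jacksonKer L (2 ^ s 1) (t 1)) ∂torusMeasure 2
        ∂torusMeasure 2 :=
        integral_integral_swap (integrable_torus_prod_of_continuous hcont)
    _ ≤ ∫ t, (jacksonKer L (2 ^ s 0) (t 0) * (if s 0 = 0 then 1 else ‖t 0‖ ^ (r * q))) *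
        (jacksonKer L (2 ^ s 1) (t 1) * (if s 1 = 0 then 1 else ‖t 1‖ ^ (r * q)))
        ∂torusMeasure 2 := by
        refine integral_mono (integrable_torus_of_continuous
          (continuous_integral_torus (F := fun t x => ‖blockDiff l s t f x‖ ^ q *
            (jacksonKer L (2 ^ s 0) (t 0) * jacksonKer L (2 ^ s 1) (t 1))) hcont'))
          (integrable_torus_of_continuous hw2) fun t => ?_
        · simp only
          rw [integral_mul_const]
          calc _ ≤ ((if s 0 = 0 then 1 else ‖t 0‖ ^ (r * q))
                * (if s 1 = 0 then 1 else ‖t 1‖ ^ (r * q))) * _ :=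
                mul_le_mul_of_nonneg_right (hb s t) (hpos t)
            _ = _ := by ring
    _ ≤ ((C + 1) * ((2 : ℝ) ^ s 0) ^ (-(r * q))) * ((C + 1) * ((2 : ℝ) ^ s 1) ^ (-(r * q))) := by
        rw [integral_tensor
          (fun t => jacksonKer L (2 ^ s 0) t * (if s 0 = 0 then 1 else ‖t‖ ^ (r * q)))
          (fun t => jacksonKer L (2 ^ s 1) t * (if s 1 = 0 then 1 else ‖t‖ ^ (r * q)))]
        refine mul_le_mul (hmom' _) (hmom' _) (integral_nonneg fun t => ?_) (by positivity)
        refine mul_nonneg (jacksonKer_nonneg _ _ _) ?_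
        split_ifs <;> positivity
    _ = _ := by
        rw [Real.mul_rpow (by positivity) (by positivity)]
        ring

/-! ### Uniform convergence of the block decomposition -/

theorem blockKer_zero (Q : ℕ) (t : Circ) : blockKer Q 0 t = vpKer Q t := by
  rw [vpKer_eq_sum (D := 3 * (Q * 2 ^ 0)) (by simp)]; rfl

theorem blockKer_succ (Q s : ℕ) (t : Circ) :
    blockKer Q (s + 1) t = vpKer (Q * 2 ^ (s + 1)) t - vpKer (Q * 2 ^ s) t := by
  rw [vpKer_eq_sum (D := 3 * (Q * 2 ^ (s + 1))) le_rfl,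
    vpKer_eq_sum (D := 3 * (Q * 2 ^ (s + 1))) (Nat.mul_le_mul_left _
      (Nat.mul_le_mul_left _ (Nat.pow_le_pow_right two_pos (Nat.le_succ s)))),
    ← Finset.sum_sub_distrib]
  refine Finset.sum_congr rfl fun k _ => ?_
  rw [blockCoeff]
  push_cast
  ring

theorem sum_blockKer (Q S : ℕ) (t : Circ) :
    ∑ s ∈ Finset.range (S + 1), blockKer Q s t = vpKer (Q * 2 ^ S) t := by
  induction S with
  | zero => simp [blockKer_zero]
  | succ S ih => rw [Finset.sum_range_succ, ih, blockKer_succ]; ring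

theorem continuous_vpKer (N : ℕ) : Continuous (vpKer N) := by
  unfold vpKer; fun_prop

theorem integral_vpKer (N : ℕ) : ∫ t, vpKer N t ∂circMeasure = 1 := by
  simp_rw [vpKer_eq_sum (le_refl (3 * N))]
  rw [integral_finsetSum _ fun k _ => integrable_circ_of_continuous (by fun_prop)]
  simp_rw [integral_const_mul, integral_fourier_eq_ite]
  rw [Finset.sum_eq_single_of_mem 0 (by simp) fun k _ hk => by simp [hk],
    vpCoeff_of_le (by simp)]
  simp

theorem norm_sq_mul_cauchyKer_le {N : ℝ} (hN : 0 < N) (t : Circ) :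
    ‖t‖ ^ 2 * cauchyKer N t ≤ 1 / N := by
  unfold cauchyKer
  rw [← mul_div_assoc, div_le_div_iff₀ (by positivity) hN]
  nlinarith

/-- The partial sums of the block decomposition. -/
def partialSum (Q S : ℕ) (f : Torus 2 → ℂ) (x : Torus 2) : ℂ :=
  ∑ i ∈ Finset.range (S + 1) ×ˢ Finset.range (S + 1), block Q ![i.1, i.2] f x

theorem partialSum_eq_integral (Q S : ℕ) {f : Torus 2 → ℂ} (hf : Continuous f) (x : Torus 2) :
    partialSum Q S f x
      = ∫ t, vpKer (Q * 2 ^ S) (t 0) * vpKer (Q * 2 ^ S) (t 1) * f (x - t) ∂torusMeasure 2 := by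
  have h1 : ∀ y, vpKer (Q * 2 ^ S) ((x - y) 0) * vpKer (Q * 2 ^ S) ((x - y) 1) * f y
      = ∑ i ∈ Finset.range (S + 1) ×ˢ Finset.range (S + 1),
        blockKer₂ Q ![i.1, i.2] (x - y) * f y := by
    intro y
    rw [← sum_blockKer, ← sum_blockKer, Finset.sum_mul_sum, ← Finset.sum_product',
      Finset.sum_mul]
    rfl
  have h2 := integral_sub_left_eq_self
    (fun t => vpKer (Q * 2 ^ S) (t 0) * vpKer (Q * 2 ^ S) (t 1) * f (x - t)) (torusMeasure 2) x
  rw [← h2]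
  simp_rw [sub_sub_cancel, h1]
  rw [integral_finsetSum _ fun i _ => integrable_torus_of_continuous (by
    have := continuous_blockKer₂ Q ![i.1, i.2]; fun_prop)]
  rfl

/-- Uniform continuity handles short shifts and boundedness long ones. The penalty is quadratic
because ‖t‖² times the Cauchy kernel is at most 1/N. -/
theorem exists_modulus {f : Torus 2 → ℂ} (hf : Continuous f) {ε : ℝ} (hε : 0 < ε) :
    ∃ B : ℝ, 0 ≤ B ∧ ∀ x t : Torus 2, ‖f (x - t) - f x‖ ≤ ε + B * (‖t 0‖ ^ 2 + ‖t 1‖ ^ 2) := by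
  have hu := CompactSpace.uniformContinuous_of_continuous hf
  obtain ⟨η, hη, h⟩ := Metric.uniformContinuous_iff.1 hu ε hε
  obtain ⟨K, hK⟩ := (isCompact_range hf).isBounded.exists_norm_le
  have hK' : ∀ x, ‖f x‖ ≤ K := fun x => hK _ ⟨x, rfl⟩
  have hK0 : 0 ≤ K := (norm_nonneg _).trans (hK' 0)
  refine ⟨2 * K / η ^ 2, by positivity, fun x t => ?_⟩
  have hp : 0 ≤ 2 * K / η ^ 2 * (‖t 0‖ ^ 2 + ‖t 1‖ ^ 2) := by positivity
  by_cases ht : ‖t 0‖ < η ∧ ‖t 1‖ < η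
  · have hd : dist (x - t) x < η := by
      rw [dist_eq_norm, sub_sub_cancel_left, norm_neg, pi_norm_lt_iff hη]
      intro i
      fin_cases i
      exacts [ht.1, ht.2]
    have := h hd
    rw [dist_eq_norm] at this
    linarith
  · have h1 : η ^ 2 ≤ ‖t 0‖ ^ 2 + ‖t 1‖ ^ 2 := by
      rcases not_and_or.1 ht with h | h
      · have : η ^ 2 ≤ ‖t 0‖ ^ 2 := by gcongr; exact not_lt.1 h
        nlinarith [sq_nonneg ‖t 1‖]
      · have : η ^ 2 ≤ ‖t 1‖ ^ 2 := by gcongr; exact not_lt.1 h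
        nlinarith [sq_nonneg ‖t 0‖]
    calc ‖f (x - t) - f x‖ ≤ K + K := (norm_sub_le _ _).trans (add_le_add (hK' _) (hK' _))
      _ = 2 * K / η ^ 2 * η ^ 2 := by field_simp; ring
      _ ≤ 2 * K / η ^ 2 * (‖t 0‖ ^ 2 + ‖t 1‖ ^ 2) := by gcongr
      _ ≤ _ := by linarith

theorem exists_partialSum_close {Q : ℕ} (hQ : 1 ≤ Q) {f : Torus 2 → ℂ} (hf : Continuous f)
    {ε : ℝ} (hε : 0 < ε) : ∃ S, ∀ x, ‖partialSum Q S f x - f x‖ ≤ ε := by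
  obtain ⟨B, hB, hmod⟩ := exists_modulus hf (ε := ε / 200) (by positivity)
  obtain ⟨S, hS⟩ := pow_unbounded_of_one_lt (400 * B / ε) (one_lt_two (α := ℝ))
  refine ⟨S, fun x => ?_⟩
  set N := Q * 2 ^ S with hN
  have hN1 : 1 ≤ N := Nat.mul_pos hQ (by positivity)
  have hN0 : (0 : ℝ) < N := by exact_mod_cast hN1
  have hNS : (2 : ℝ) ^ S ≤ N := by
    rw [hN]
    push_cast
    have : (1 : ℝ) ≤ Q := by exact_mod_cast hQ
    nlinarith [pow_pos (two_pos (α := ℝ)) S]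
  have hv := continuous_vpKer N
  have hc := continuous_cauchyKer N
  have hVf : Integrable (fun t : Torus 2 => vpKer N (t 0) * vpKer N (t 1) * f (x - t))
      (torusMeasure 2) := integrable_torus_of_continuous (by fun_prop)
  have hV : Integrable (fun t : Torus 2 => vpKer N (t 0) * vpKer N (t 1) * f x)
      (torusMeasure 2) := integrable_torus_of_continuous (by fun_prop)
  have hdiff : partialSum Q S f x - f x
      = ∫ t, vpKer N (t 0) * vpKer N (t 1) * (f (x - t) - f x) ∂torusMeasure 2 := by
    simp only [mul_sub]
    rw [integral_sub hVf hV, ← partialSum_eq_integral Q S hf, integral_mul_const,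
      integral_tensor (vpKer N) (vpKer N), integral_vpKer, one_mul, one_mul]
  have hck : ∀ t, 0 ≤ cauchyKer N t := cauchyKer_nonneg hN0.le
  have hckN := norm_sq_mul_cauchyKer_le hN0
  rw [hdiff]
  calc _ ≤ ∫ t : Torus 2, (100 * (ε / 200) * (cauchyKer N (t 0) * cauchyKer N (t 1))
        + 100 * B * ((1 / N) * cauchyKer N (t 1) + cauchyKer N (t 0) * (1 / N)))
          ∂torusMeasure 2 := by
        refine (norm_integral_le_integral_norm _).trans
          (integral_mono (integrable_torus_of_continuous (by fun_prop))
            (integrable_torus_of_continuous (by fun_prop)) fun t => ?_)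
        simp only [norm_mul]
        calc _ ≤ (10 * cauchyKer N (t 0)) * (10 * cauchyKer N (t 1))
              * (ε / 200 + B * (‖t 0‖ ^ 2 + ‖t 1‖ ^ 2)) := by
              have := hck (t 0)
              have := hck (t 1)
              exact mul_le_mul (mul_le_mul (norm_vpKer_le hN1 _) (norm_vpKer_le hN1 _)
                (norm_nonneg _) (by positivity)) (hmod x t) (norm_nonneg _) (by positivity)
          _ = 100 * (ε / 200) * (cauchyKer N (t 0) * cauchyKer N (t 1)) + 100 * B *
              ((‖t 0‖ ^ 2 * cauchyKer N (t 0)) * cauchyKer N (t 1)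
                + cauchyKer N (t 0) * (‖t 1‖ ^ 2 * cauchyKer N (t 1))) := by ring
          _ ≤ _ := by
              have := hck (t 0)
              have := hck (t 1)
              gcongr
              · exact hckN _
              · exact hckN _
    _ ≤ 100 * (ε / 200) * 1 + 100 * B * ((1 / N) * 1 + (1 / N) * 1) := by
        have e0 := integral_tensor (cauchyKer N) (cauchyKer N)
        have e1 := integral_tensor (fun _ => (1 / N : ℝ)) (cauchyKer N)
        have e2 := integral_tensor (cauchyKer N) (fun _ => (1 / N : ℝ))
        rw [integral_add (integrable_torus_of_continuous (by fun_prop))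
          (integrable_torus_of_continuous (by fun_prop)), integral_const_mul, integral_const_mul,
          integral_add (integrable_torus_of_continuous (by fun_prop))
          (integrable_torus_of_continuous (by fun_prop)), e0, e1, e2]
        have h1 := integral_cauchyKer_le N
        have h0 : 0 ≤ ∫ t, cauchyKer N t ∂circMeasure := integral_nonneg hck
        have hN2 : 0 ≤ 1 / (N : ℝ) := by positivity
        simp only [integral_const, probReal_univ, smul_eq_mul, one_mul]
        rw [mul_comm _ (1 / (N : ℝ))]
        gcongr
        exact mul_le_one₀ h1 h0 h1
    _ = ε / 2 + 200 * B / N := by ring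
    _ ≤ ε / 2 + ε / 2 := by
        have : 200 * B / N ≤ ε / 2 := by
          rw [div_le_iff₀ hN0]
          rw [div_lt_iff₀ hε] at hS
          nlinarith
        linarith
    _ = ε := by ring

/-! ### Quadrature error of a product of two blocks -/

/-- The quadrature error of the Fibonacci points. -/
def fibErr (n : ℕ) (F : Torus 2 → ℂ) : ℂ :=
  ∫ x, F x ∂torusMeasure 2 - (1 / (fibB n : ℂ)) * ∑ j, F (fibPoint n j)

theorem fibErr_sum {ι : Type*} (n : ℕ) (I : Finset ι) {F : ι → Torus 2 → ℂ}
    (hF : ∀ i ∈ I, Continuous (F i)) :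
    fibErr n (fun x => ∑ i ∈ I, F i x) = ∑ i ∈ I, fibErr n (F i) := by
  simp only [fibErr]
  rw [integral_finsetSum _ fun i hi => integrable_torus_of_continuous (hF i hi),
    Finset.sum_sub_distrib, Finset.sum_comm, ← Finset.mul_sum]

theorem fibErr_const_mul (n : ℕ) (c : ℂ) (F : Torus 2 → ℂ) :
    fibErr n (fun x => c * F x) = c * fibErr n F := by
  simp only [fibErr]
  rw [integral_const_mul, ← Finset.mul_sum]
  ring

theorem norm_fibErr_sub_le (n : ℕ) {F G : Torus 2 → ℂ} (hF : Continuous F) (hG : Continuous G)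
    {K : ℝ} (h : ∀ x, ‖F x - G x‖ ≤ K) : ‖fibErr n F - fibErr n G‖ ≤ 2 * K := by
  have hb : (0 : ℝ) < fibB n := by exact_mod_cast fibB_pos n
  have e : fibErr n F - fibErr n G
      = ∫ x, (F x - G x) ∂torusMeasure 2
        - (1 / (fibB n : ℂ)) * ∑ j, (F (fibPoint n j) - G (fibPoint n j)) := by
    simp only [fibErr]
    rw [integral_sub (integrable_torus_of_continuous hF) (integrable_torus_of_continuous hG),
      Finset.sum_sub_distrib]
    ring
  rw [e]
  have h1 : ‖∫ x, (F x - G x) ∂torusMeasure 2‖ ≤ K := by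
    have := norm_integral_le_of_norm_le_const (μ := torusMeasure 2)
      (Filter.Eventually.of_forall h)
    simpa using this
  have h2 : ‖(1 / (fibB n : ℂ)) * ∑ j, (F (fibPoint n j) - G (fibPoint n j))‖ ≤ K := by
    rw [norm_mul, norm_div, norm_one, Complex.norm_natCast, div_mul_eq_mul_div, one_mul,
      div_le_iff₀ hb]
    refine (norm_sum_le _ _).trans ((Finset.sum_le_sum fun j _ => h _).trans ?_)
    simp [mul_comm]
  exact (norm_sub_le _ _).trans (by linarith)

theorem integral_torusChar (k₁ k₂ : ℤ) (h : ¬(k₁ = 0 ∧ k₂ = 0)) :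
    ∫ x, torusChar k₁ k₂ x ∂torusMeasure 2 = 0 := by
  simp only [torusChar]
  rw [integral_tensor (fun t => (fourier k₁ t : ℂ)) (fun t => (fourier k₂ t : ℂ)),
    integral_fourier_eq_ite, integral_fourier_eq_ite]
  rcases not_and_or.1 h with h | h <;> simp [h]

theorem fibErr_torusChar (n : ℕ) {k₁ k₂ : ℤ} {d₁ d₂ : ℤ} (hd₁ : 1 ≤ d₁) (hd₂ : 1 ≤ d₂)
    (hk₁ : |k₁| ≤ d₁) (hk₂ : |k₂| ≤ d₂) (hd : 6 * d₁ * d₂ < fibB (n + 1)) :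
    fibErr (n + 1) (torusChar k₁ k₂) = 0 := by
  have hb : ((fibB (n + 1) : ℕ) : ℂ) ≠ 0 := by exact_mod_cast (fibB_pos _).ne'
  unfold fibErr
  by_cases h : k₁ = 0 ∧ k₂ = 0
  · obtain ⟨rfl, rfl⟩ := h
    simp [torusChar, hb]
  · rw [integral_torusChar _ _ h,
      sum_torusChar_fibPoint n (not_dvd_of_lt n hd₁ hd₂ hk₁ hk₂ hd h)]
    simp

theorem torusChar_mul_conj (k₁ k₂ m₁ m₂ : ℤ) (x : Torus 2) :
    torusChar k₁ k₂ x * (starRingEnd ℂ) (torusChar m₁ m₂ x)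
      = torusChar (k₁ - m₁) (k₂ - m₂) x := by
  simp only [torusChar, map_mul, ← fourier_neg]
  rw [sub_eq_add_neg, sub_eq_add_neg, ← fourier_mul_fourier, ← fourier_mul_fourier]
  ring

/-- The spectrum of the product consists of differences of block frequencies, of size at most
6Q2^{max} in each variable. Exactness requires 6 · 6 · 6 = 216 times the remaining factors to stay
below b, and 216 ≤ 15². -/
theorem fibErr_block_mul_conj_eq_zero (n : ℕ) {Q : ℕ} (hQ : 1 ≤ Q) (s s' : Fin 2 → ℕ)
    {f : Torus 2 → ℂ} (hf : Continuous f)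
    (h : (15 * Q * 2 ^ (max (s 0) (s' 0))) * (15 * Q * 2 ^ (max (s 1) (s' 1))) < fibB (n + 1)) :
    fibErr (n + 1) (fun x => block Q s f x * (starRingEnd ℂ) (block Q s' f x)) = 0 := by
  have hexp : (fun x => block Q s f x * (starRingEnd ℂ) (block Q s' f x))
      = fun x => ∑ k ∈ (blockFreq Q (s 0) ×ˢ blockFreq Q (s 1)) ×ˢ
          (blockFreq Q (s' 0) ×ˢ blockFreq Q (s' 1)),
        (((blockCoeff Q (s 0) k.1.1 : ℂ) * blockCoeff Q (s 1) k.1.2 * torusCoeff f k.1.1 k.1.2)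
          * (starRingEnd ℂ) ((blockCoeff Q (s' 0) k.2.1 : ℂ) * blockCoeff Q (s' 1) k.2.2
            * torusCoeff f k.2.1 k.2.2))
        * torusChar (k.1.1 - k.2.1) (k.1.2 - k.2.2) x := by
    funext x
    rw [block_eq_sum Q s hf, block_eq_sum Q s' hf, map_sum, Finset.sum_mul_sum,
      ← Finset.sum_product']
    refine Finset.sum_congr rfl fun k _ => ?_
    rw [← torusChar_mul_conj, map_mul]
    ring
  rw [hexp]
  refine (fibErr_sum _ _ fun k _ => ?_).trans (Finset.sum_eq_zero fun k hk => ?_)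
  · exact continuous_const.mul (continuous_torusChar _ _)
  rw [fibErr_const_mul]
  have hfreq : ∀ {a b : ℕ} {i j : ℤ}, i ∈ blockFreq Q a → j ∈ blockFreq Q b →
      |i - j| ≤ ((6 * Q * 2 ^ (max a b) : ℕ) : ℤ) := by
    intro a b i j hi hj
    have ha : Q * 2 ^ a ≤ Q * 2 ^ max a b := by gcongr <;> simp
    have hb : Q * 2 ^ b ≤ Q * 2 ^ max a b := by gcongr <;> simp
    rw [blockFreq, Finset.mem_Icc] at hi hj
    rw [abs_le, mul_assoc]
    omega
  simp only [Finset.mem_product] at hk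
  have hpos : ∀ a : ℕ, 1 ≤ 6 * Q * 2 ^ a := fun a => Nat.mul_pos (by omega) (by positivity)
  rw [fibErr_torusChar n (d₁ := ((6 * Q * 2 ^ (max (s 0) (s' 0)) : ℕ) : ℤ))
    (d₂ := ((6 * Q * 2 ^ (max (s 1) (s' 1)) : ℕ) : ℤ)) (by exact_mod_cast hpos _)
    (by exact_mod_cast hpos _) (hfreq hk.1.1 hk.2.1) (hfreq hk.1.2 hk.2.2), mul_zero]
  have : 6 * (6 * Q * 2 ^ (max (s 0) (s' 0))) * (6 * Q * 2 ^ (max (s 1) (s' 1)))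
      < fibB (n + 1) := by
    refine lt_of_le_of_lt ?_ h
    have := Nat.zero_le (Q * 2 ^ (max (s 0) (s' 0)) * (Q * 2 ^ (max (s 1) (s' 1))))
    nlinarith
  exact_mod_cast this

/-- The wider kernel is replaced by its maximum and the sharper one is kept, with its own centre. -/
theorem exists_cauchyKer_mul_le {N N' : ℝ} (hN : 0 ≤ N) (hN' : 0 ≤ N') (y z : Circ) :
    ∃ c, ∀ x, cauchyKer N (x - y) * cauchyKer N' (x - z)
      ≤ min N N' * cauchyKer (max N N') (x - c) := by
  rcases le_total N N' with h | h
  · refine ⟨z, fun x => ?_⟩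
    rw [min_eq_left h, max_eq_right h]
    exact mul_le_mul_of_nonneg_right (cauchyKer_le hN _) (cauchyKer_nonneg hN' _)
  · refine ⟨y, fun x => ?_⟩
    rw [min_eq_right h, max_eq_left h, mul_comm]
    exact mul_le_mul_of_nonneg_right (cauchyKer_le hN' _) (cauchyKer_nonneg hN _)

/-- In each variable the sharper kernel survives, possibly with centres from different factors; the
point sum is then taken at the maximal scales, and min · max = N N' restores a product in s and s'.
-/
theorem sum_majKer_mul_majKer_le (n : ℕ) {Q : ℕ} (hQ : 1 ≤ Q) (s s' : Fin 2 → ℕ)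
    (h : fibB (n + 1) ≤ (15 * Q * 2 ^ (max (s 0) (s' 0))) * (15 * Q * 2 ^ (max (s 1) (s' 1))))
    (y z : Torus 2) :
    ∑ j, majKer Q s (fibPoint (n + 1) j - y) * majKer Q s' (fibPoint (n + 1) j - z)
      ≤ (15 * Q) ^ 4 * cellMass ^ 2 * ((2 ^ s 0 * 2 ^ s 1) * (2 ^ s' 0 * 2 ^ s' 1)) := by
  have hQ' : (0 : ℝ) < Q := by exact_mod_cast hQ
  set N : ℕ → ℝ := fun a => 15 * (Q * 2 ^ a) with hN
  have hNpos : ∀ a, 0 < N a := fun a => by simp only [hN]; positivity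
  have hmono : Monotone N := by
    intro a b hab
    simp only [hN]
    gcongr
    exact one_le_two
  obtain ⟨c₀, hc₀⟩ := exists_cauchyKer_mul_le (hNpos (s 0)).le (hNpos (s' 0)).le (y 0) (z 0)
  obtain ⟨c₁, hc₁⟩ := exists_cauchyKer_mul_le (hNpos (s 1)).le (hNpos (s' 1)).le (y 1) (z 1)
  have hm0 := lt_min (hNpos (s 0)) (hNpos (s' 0))
  have hm1 := lt_min (hNpos (s 1)) (hNpos (s' 1))
  have hM0 : 0 < max (N (s 0)) (N (s' 0)) := lt_max_of_lt_left (hNpos _)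
  have hM1 : 0 < max (N (s 1)) (N (s' 1)) := lt_max_of_lt_left (hNpos _)
  have hle : (fibB (n + 1) : ℝ) ≤ max (N (s 0)) (N (s' 0)) * max (N (s 1)) (N (s' 1)) := by
    rw [← hmono.map_max, ← hmono.map_max]
    have h' : (fibB (n + 1) : ℝ) ≤ (15 * Q * 2 ^ (max (s 0) (s' 0)))
        * (15 * Q * 2 ^ (max (s 1) (s' 1))) := by exact_mod_cast h
    exact h'.trans (le_of_eq (by simp only [hN]; ring))
  calc _ ≤ ∑ j, (min (N (s 0)) (N (s' 0)) * min (N (s 1)) (N (s' 1))) *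
        (cauchyKer (max (N (s 0)) (N (s' 0))) (fibPoint (n + 1) j 0 - c₀) *
          cauchyKer (max (N (s 1)) (N (s' 1))) (fibPoint (n + 1) j 1 - c₁)) := by
        refine Finset.sum_le_sum fun j _ => ?_
        calc _ = (cauchyKer (N (s 0)) (fibPoint (n + 1) j 0 - y 0)
                * cauchyKer (N (s' 0)) (fibPoint (n + 1) j 0 - z 0))
              * (cauchyKer (N (s 1)) (fibPoint (n + 1) j 1 - y 1)
                * cauchyKer (N (s' 1)) (fibPoint (n + 1) j 1 - z 1)) := by
              simp only [majKer, Pi.sub_apply, hN]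
              ring
          _ ≤ (min (N (s 0)) (N (s' 0))
                * cauchyKer (max (N (s 0)) (N (s' 0))) (fibPoint (n + 1) j 0 - c₀))
              * (min (N (s 1)) (N (s' 1))
                * cauchyKer (max (N (s 1)) (N (s' 1))) (fibPoint (n + 1) j 1 - c₁)) :=
              mul_le_mul (hc₀ _) (hc₁ _)
                (mul_nonneg (cauchyKer_nonneg (hNpos _).le _) (cauchyKer_nonneg (hNpos _).le _))
                (mul_nonneg hm0.le (cauchyKer_nonneg hM0.le _))
          _ = _ := by ring
    _ ≤ (min (N (s 0)) (N (s' 0)) * min (N (s 1)) (N (s' 1))) *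
        (max (N (s 0)) (N (s' 0)) * max (N (s 1)) (N (s' 1)) * cellMass ^ 2) := by
        rw [← Finset.mul_sum]
        gcongr
        exact sum_fibPoint_cauchyKer_le n hM0 hM1 hle c₀ c₁
    _ = ((min (N (s 0)) (N (s' 0)) * max (N (s 0)) (N (s' 0)))
          * (min (N (s 1)) (N (s' 1)) * max (N (s 1)) (N (s' 1)))) * cellMass ^ 2 := by ring
    _ = _ := by
        rw [min_mul_max, min_mul_max]
        simp only [hN]
        ring

theorem sum_integral_mul_integral_le {ι : Type*} (I : Finset ι) {h h' : Torus 2 → ℝ}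
    (hh : Continuous h) (hh' : Continuous h') (h0 : ∀ x, 0 ≤ h x) (h0' : ∀ x, 0 ≤ h' x)
    {A B : ι → Torus 2 → ℝ} (hA : ∀ i, Continuous (A i)) (hB : ∀ i, Continuous (B i)) {K : ℝ}
    (hK : ∀ y z, ∑ i ∈ I, A i y * B i z ≤ K) :
    ∑ i ∈ I, (∫ y, h y * A i y ∂torusMeasure 2) * ∫ z, h' z * B i z ∂torusMeasure 2
      ≤ K * ((∫ y, h y ∂torusMeasure 2) * ∫ z, h' z ∂torusMeasure 2) := by
  have h1 : ∀ y, ∑ i ∈ I, A i y * ∫ z, h' z * B i z ∂torusMeasure 2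
      ≤ K * ∫ z, h' z ∂torusMeasure 2 := by
    intro y
    have e : ∑ i ∈ I, A i y * ∫ z, h' z * B i z ∂torusMeasure 2
        = ∫ z, h' z * ∑ i ∈ I, A i y * B i z ∂torusMeasure 2 := by
      simp_rw [← integral_const_mul]
      rw [← integral_finsetSum _ fun i _ => integrable_torus_of_continuous (by
        have := hB i; fun_prop)]
      refine integral_congr_ae (Filter.Eventually.of_forall fun z => ?_)
      simp only [Finset.mul_sum]
      exact Finset.sum_congr rfl fun i _ => by ring
    rw [e, ← integral_const_mul]
    refine integral_mono (integrable_torus_of_continuous (by fun_prop))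
      (integrable_torus_of_continuous (by fun_prop)) fun z => ?_
    simp only
    rw [mul_comm K]
    exact mul_le_mul_of_nonneg_left (hK y z) (h0' z)
  have e : ∑ i ∈ I, (∫ y, h y * A i y ∂torusMeasure 2) * ∫ z, h' z * B i z ∂torusMeasure 2
      = ∫ y, h y * ∑ i ∈ I, A i y * ∫ z, h' z * B i z ∂torusMeasure 2 ∂torusMeasure 2 := by
    simp_rw [← integral_mul_const]
    rw [← integral_finsetSum _ fun i _ => integrable_torus_of_continuous (by
      have := hA i; fun_prop)]
    refine integral_congr_ae (Filter.Eventually.of_forall fun z => ?_)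
    simp only [Finset.mul_sum]
    exact Finset.sum_congr rfl fun i _ => mul_assoc _ _ _
  rw [e]
  have hc : Continuous fun y => ∑ i ∈ I, A i y * ∫ z, h' z * B i z ∂torusMeasure 2 :=
    continuous_finsetSum _ fun i _ => (hA i).mul continuous_const
  calc _ ≤ ∫ y, h y * (K * ∫ z, h' z ∂torusMeasure 2) ∂torusMeasure 2 :=
        integral_mono (integrable_torus_of_continuous (hh.mul hc))
          (integrable_torus_of_continuous (by fun_prop)) fun y =>
            mul_le_mul_of_nonneg_left (h1 y) (h0 y)
    _ = _ := by rw [integral_mul_const]; ring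

/-- Through this identity an estimate of the point means that is uniform in the shift g controls the
integral as well as the cubature sum. -/
theorem integral_eq_integral_mean_shift {n : ℕ} {F : Torus 2 → ℝ} (hF : Continuous F) :
    ∫ x, F x ∂torusMeasure 2
      = ∫ g, (1 / (fibB n : ℝ)) * ∑ j, F (fibPoint n j + g) ∂torusMeasure 2 := by
  have hb : (fibB n : ℝ) ≠ 0 := by exact_mod_cast (fibB_pos n).ne'
  rw [integral_const_mul, integral_finsetSum _ fun j _ =>
    integrable_torus_of_continuous (by fun_prop)]
  simp_rw [integral_add_left_eq_self F]
  rw [Finset.sum_const, Finset.card_univ, Fintype.card_fin, nsmul_eq_mul]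
  field_simp

theorem mean_le_rpow_mean (n : ℕ) {q : ℝ} (hq : 1 ≤ q) {z : Fin (fibB n) → ℝ}
    (hz : ∀ j, 0 ≤ z j) {X : ℝ} (hX : (1 / (fibB n : ℝ)) * ∑ j, z j ^ q ≤ X) :
    (1 / (fibB n : ℝ)) * ∑ j, z j ≤ X ^ (1 / q) := by
  have hb : (0 : ℝ) < fibB n := by exact_mod_cast fibB_pos n
  have h := Real.arith_mean_le_rpow_mean Finset.univ (fun _ => 1 / (fibB n : ℝ)) z
    (fun _ _ => by positivity) (by simp [hb.ne']) (fun j _ => hz j) hq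
  rw [← Finset.mul_sum, ← Finset.mul_sum] at h
  refine h.trans (Real.rpow_le_rpow ?_ hX (by positivity))
  exact mul_nonneg (by positivity) (Finset.sum_nonneg fun j _ => Real.rpow_nonneg (hz j) _)

theorem norm_fibErr_le_of_mean_le {n : ℕ} {F : Torus 2 → ℂ} (hF : Continuous F) {q X : ℝ}
    (hq : 1 ≤ q)
    (hX : ∀ g, (1 / (fibB n : ℝ)) * ∑ j, ‖F (fibPoint n j + g)‖ ^ q ≤ X) :
    ‖fibErr n F‖ ≤ 2 * X ^ (1 / q) := by
  have h1 : ∀ g, (1 / (fibB n : ℝ)) * ∑ j, ‖F (fibPoint n j + g)‖ ≤ X ^ (1 / q) := fun g =>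
    mean_le_rpow_mean n hq (fun _ => norm_nonneg _) (hX g)
  have h2 : ‖∫ x, F x ∂torusMeasure 2‖ ≤ X ^ (1 / q) := by
    refine (norm_integral_le_integral_norm _).trans ?_
    rw [integral_eq_integral_mean_shift (n := n) hF.norm]
    refine (integral_mono (integrable_torus_of_continuous (by fun_prop))
      (integrable_const _) h1).trans ?_
    simp
  have h3 : ‖(1 / (fibB n : ℂ)) * ∑ j, F (fibPoint n j)‖ ≤ X ^ (1 / q) := by
    have := h1 0
    simp only [add_zero] at this
    refine le_trans ?_ this
    rw [norm_mul, norm_div, norm_one, Complex.norm_natCast]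
    gcongr
    exact norm_sum_le _ _
  exact (norm_sub_le _ _).trans (by linarith)

/-- Each factor is a convolution against the majorant, so the sum over points is a double integral
of products of majorants. The shift g moves into the centres, in which the kernel bound is uniform.
-/
theorem sum_block_rpow_mul_le {L : ℕ} (hL : 1 ≤ L) (l n : ℕ) (s s' : Fin 2 → ℕ)
    (hcond : fibB (n + 1) ≤ (15 * (4 * L) * 2 ^ (max (s 0) (s' 0))) *
      (15 * (4 * L) * 2 ^ (max (s 1) (s' 1))))
    {f : Torus 2 → ℂ} (hf : Continuous f) {q : ℝ} (hq : 1 ≤ q) (g : Torus 2) :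
    ∑ j, ‖block (4 * L) s f (fibPoint (n + 1) j + g)‖ ^ q *
        ‖block (4 * L) s' f (fibPoint (n + 1) j + g)‖ ^ q
      ≤ ((450 ^ 2) ^ q) ^ 2 * (((15 * ((4 * L : ℕ) : ℝ)) ^ 4 * cellMass ^ 2 *
          ((2 ^ s 0 * 2 ^ s 1) * (2 ^ s' 0 * 2 ^ s' 1))) *
        ((∫ y, ‖avgDiff L l s f y‖ ^ q ∂torusMeasure 2) *
          ∫ y, ‖avgDiff L l s' f y‖ ^ q ∂torusMeasure 2)) := by
  have hq0 : 0 < q := by linarith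
  have hA := continuous_majKer (4 * L) s
  have hA' := continuous_majKer (4 * L) s'
  have hcd : Continuous fun y => ‖avgDiff L l s f y‖ ^ q :=
    (continuous_avgDiff L l s hf).norm.rpow_const fun _ => Or.inr hq0.le
  have hcd' : Continuous fun y => ‖avgDiff L l s' f y‖ ^ q :=
    (continuous_avgDiff L l s' hf).norm.rpow_const fun _ => Or.inr hq0.le
  have hb := fun x => norm_block_rpow_le hL l s hf hq x
  have hb' := fun x => norm_block_rpow_le hL l s' hf hq x
  generalize ((450 : ℝ) ^ 2) ^ q = A at hb hb' ⊢
  have hnn : ∀ j, 0 ≤ A * ∫ y, ‖avgDiff L l s f y‖ ^ q *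
      majKer (4 * L) s (fibPoint (n + 1) j + g - y) ∂torusMeasure 2 := fun j =>
    (Real.rpow_nonneg (norm_nonneg _) _).trans (hb _)
  calc _ ≤ ∑ j, A ^ 2 * ((∫ y, ‖avgDiff L l s f y‖ ^ q *
          majKer (4 * L) s (fibPoint (n + 1) j + g - y) ∂torusMeasure 2) *
        ∫ y, ‖avgDiff L l s' f y‖ ^ q *
          majKer (4 * L) s' (fibPoint (n + 1) j + g - y) ∂torusMeasure 2) := by
        refine Finset.sum_le_sum fun j _ => ?_
        refine (mul_le_mul (hb _) (hb' _) (Real.rpow_nonneg (norm_nonneg _) _) (hnn j)).trans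
          (le_of_eq (by ring))
    _ ≤ _ := by
        rw [← Finset.mul_sum]
        refine mul_le_mul_of_nonneg_left ?_ (sq_nonneg A)
        refine sum_integral_mul_integral_le Finset.univ hcd hcd'
          (fun _ => Real.rpow_nonneg (norm_nonneg _) _)
          (fun _ => Real.rpow_nonneg (norm_nonneg _) _) (fun j => by fun_prop)
          (fun j => by fun_prop) fun y z => ?_
        have := sum_majKer_mul_majKer_le n (Q := 4 * L) (by omega) s s' hcond (y - g) (z - g)
        simpa only [sub_sub_eq_add_sub, add_sub_right_comm] using this

/-- The mean of the q-th powers is O((UV)^{1-rq} / b) with U = 2^{s₀+s₁} and V likewise for s'; the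
exponents in the conclusion come from taking the q-th root. -/
theorem norm_fibErr_block_mul_conj_le {L : ℕ} {r q : ℝ} (hr : 0 < r) (hq : 1 ≤ q)
    (hL : r * q + 2 ≤ 2 * L) (l : ℕ) :
    ∃ C : ℝ, 0 < C ∧ ∀ (f : Torus 2 → ℂ) (_ : Continuous f) (_ : HasMixedBound l r q f) (n : ℕ)
      (s s' : Fin 2 → ℕ), fibB (n + 1) ≤ (15 * (4 * L) * 2 ^ (max (s 0) (s' 0))) *
          (15 * (4 * L) * 2 ^ (max (s 1) (s' 1))) →
      ‖fibErr (n + 1) (fun x => block (4 * L) s f x * (starRingEnd ℂ) (block (4 * L) s' f x))‖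
        ≤ C * (fibB (n + 1) : ℝ) ^ (-(1 / q)) *
          ((2 ^ s 0 * 2 ^ s 1) * (2 ^ s' 0 * 2 ^ s' 1) : ℝ) ^ (-(r - 1 / q)) := by
  have hq0 : 0 < q := by linarith
  have hL1 : 1 ≤ L := by
    by_contra! h
    have : L = 0 := by omega
    rw [this] at hL
    have : 0 < r * q := by positivity
    norm_num at hL
    linarith
  obtain ⟨C, hC, hD⟩ := integral_norm_avgDiff_rpow_le hr hq hL l
  have hcm := cellMass_pos
  have hL0 : (0 : ℝ) < L := by exact_mod_cast hL1
  have hsum := fun f hf n s s' hcond g => sum_block_rpow_mul_le hL1 l n s s' hcond (f := f) hf hq g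
  have hA0 : (0 : ℝ) < ((450 ^ 2) ^ q) ^ 2 := by positivity
  generalize ((450 ^ 2 : ℝ) ^ q) ^ 2 = A at hsum hA0
  obtain ⟨D, hD0, hDe⟩ : ∃ D : ℝ, 0 < D ∧ (15 * ((4 * L : ℕ) : ℝ)) ^ 4 * cellMass ^ 2 = D :=
    ⟨_, by push_cast; positivity, rfl⟩
  simp only [hDe] at hsum
  refine ⟨2 * (A * D * C ^ 2) ^ (1 / q), by positivity, fun f hf hb n s s' hcond => ?_⟩
  have hsum' := hsum f hf n s s' hcond
  have hs := hD f hf hb s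
  have hs' := hD f hf hb s'
  have hbn : (0 : ℝ) < fibB (n + 1) := by exact_mod_cast fibB_pos _
  have hcb := continuous_block (4 * L) s hf
  have hcb' := continuous_block (4 * L) s' hf
  obtain ⟨U, hU⟩ : ∃ U : ℝ, (2 : ℝ) ^ s 0 * 2 ^ s 1 = U := ⟨_, rfl⟩
  obtain ⟨V, hV⟩ : ∃ V : ℝ, (2 : ℝ) ^ s' 0 * 2 ^ s' 1 = V := ⟨_, rfl⟩
  have hU0 : 0 < U := by rw [← hU]; positivity
  have hV0 : 0 < V := by rw [← hV]; positivity
  rw [hU] at hs hsum' ⊢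
  rw [hV] at hs' hsum' ⊢
  have hmain : ∀ g, (1 / (fibB (n + 1) : ℝ)) * ∑ j, ‖block (4 * L) s f (fibPoint (n + 1) j + g) *
      (starRingEnd ℂ) (block (4 * L) s' f (fibPoint (n + 1) j + g))‖ ^ q
      ≤ 1 / (fibB (n + 1) : ℝ) * ((A * D * C ^ 2) * (U * V) ^ (1 - r * q)) := by
    intro g
    refine mul_le_mul_of_nonneg_left ?_ (by positivity)
    simp only [norm_mul, RCLike.norm_conj, Real.mul_rpow (norm_nonneg _) (norm_nonneg _)]
    refine (hsum' g).trans ?_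
    have hnn : 0 ≤ ∫ y, ‖avgDiff L l s' f y‖ ^ q ∂torusMeasure 2 :=
      integral_nonneg fun y => Real.rpow_nonneg (norm_nonneg _) _
    calc _ ≤ A * (D * (U * V) * ((C * U ^ (-(r * q))) * (C * V ^ (-(r * q))))) := by
          refine mul_le_mul_of_nonneg_left ?_ hA0.le
          refine mul_le_mul_of_nonneg_left ?_ (by positivity)
          exact mul_le_mul hs hs' hnn (by positivity)
      _ = _ := by
          have e : (U * V) ^ (1 - r * q) = (U * V) * (U ^ (-(r * q)) * V ^ (-(r * q))) := by
            rw [← Real.mul_rpow hU0.le hV0.le, sub_eq_add_neg, Real.rpow_add (by positivity),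
              Real.rpow_one]
          rw [e]
          ring
  refine (norm_fibErr_le_of_mean_le (hcb.mul (Complex.continuous_conj.comp hcb')) hq hmain).trans
    (le_of_eq ?_)
  have hP0 : 0 < U * V := by positivity
  rw [Real.mul_rpow (by positivity) (by positivity), Real.mul_rpow (by positivity) (by positivity),
    ← Real.rpow_mul hP0.le, one_div (fibB (n + 1) : ℝ), Real.inv_rpow hbn.le,
    ← Real.rpow_neg hbn.le]
  have : (1 - r * q) * (1 / q) = -(r - 1 / q) := by field_simp; ring
  rw [this]
  ring

/-! ### Summation over pairs of blocks -/

/-- Since F(max(i,i')) ≤ F(i) + F(i'), the double sum splits into two products with a geometric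
series. Applied in each coordinate it reduces pairs of blocks to single blocks. -/
theorem sum_max_mul_pow_le {β : ℝ} (h0 : 0 ≤ β) (h1 : β < 1) (n : ℕ) {F : ℕ → ℝ}
    (hF : ∀ i, 0 ≤ F i) :
    ∑ i ∈ Finset.range n, ∑ i' ∈ Finset.range n, F (max i i') * (β ^ i * β ^ i')
      ≤ 2 / (1 - β) * ∑ i ∈ Finset.range n, F i * β ^ i := by
  have hg : ∑ i ∈ Finset.range n, β ^ i ≤ 1 / (1 - β) := by
    have := geom_sum_Ico_le_of_lt_one (m := 0) (n := n) h0 h1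
    rwa [pow_zero, Nat.Ico_zero_eq_range] at this
  have hS : 0 ≤ ∑ i ∈ Finset.range n, F i * β ^ i :=
    Finset.sum_nonneg fun i _ => mul_nonneg (hF i) (by positivity)
  calc _ ≤ ∑ i ∈ Finset.range n, ∑ i' ∈ Finset.range n,
        ((F i * β ^ i) * β ^ i' + β ^ i * (F i' * β ^ i')) := by
        refine Finset.sum_le_sum fun i _ => Finset.sum_le_sum fun i' _ => ?_
        have hb : 0 ≤ β ^ i * β ^ i' := by positivity
        rcases max_choice i i' with h | h <;> rw [h] <;>
          nlinarith [mul_nonneg (hF i) hb, mul_nonneg (hF i') hb]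
    _ = 2 * ((∑ i ∈ Finset.range n, β ^ i) * ∑ i ∈ Finset.range n, F i * β ^ i) := by
        simp only [Finset.sum_add_distrib]
        rw [← Finset.sum_mul_sum, ← Finset.sum_mul_sum]
        ring
    _ ≤ 2 * (1 / (1 - β) * ∑ i ∈ Finset.range n, F i * β ^ i) := by gcongr
    _ = _ := by ring

theorem sum_sum_max_mul_pow_le {β : ℝ} (h0 : 0 ≤ β) (h1 : β < 1) (n : ℕ) {G : ℕ → ℕ → ℝ}
    (hG : ∀ i j, 0 ≤ G i j) :
    ∑ a ∈ Finset.range n ×ˢ Finset.range n, ∑ a' ∈ Finset.range n ×ˢ Finset.range n,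
        G (max a.1 a'.1) (max a.2 a'.2) * β ^ (a.1 + a.2 + (a'.1 + a'.2))
      ≤ (2 / (1 - β)) ^ 2 * ∑ i ∈ Finset.range n, ∑ j ∈ Finset.range n, G i j * β ^ (i + j) := by
  have hβ : 0 ≤ 2 / (1 - β) := div_nonneg (by norm_num) (by linarith)
  calc _ = ∑ i ∈ Finset.range n, ∑ i' ∈ Finset.range n,
        (∑ j ∈ Finset.range n, ∑ j' ∈ Finset.range n,
          G (max i i') (max j j') * (β ^ j * β ^ j')) * (β ^ i * β ^ i') := by
        simp only [Finset.sum_product, Finset.sum_mul]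
        refine Finset.sum_congr rfl fun i _ => ?_
        rw [Finset.sum_comm]
        refine Finset.sum_congr rfl fun i' _ => Finset.sum_congr rfl fun j _ =>
          Finset.sum_congr rfl fun j' _ => ?_
        ring
    _ ≤ ∑ i ∈ Finset.range n, ∑ i' ∈ Finset.range n,
        (2 / (1 - β) * ∑ j ∈ Finset.range n, G (max i i') j * β ^ j) * (β ^ i * β ^ i') := by
        refine Finset.sum_le_sum fun i _ => Finset.sum_le_sum fun i' _ => ?_
        exact mul_le_mul_of_nonneg_right (sum_max_mul_pow_le h0 h1 n fun j => hG _ j)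
          (by positivity)
    _ ≤ 2 / (1 - β) * ∑ i ∈ Finset.range n,
        (2 / (1 - β) * ∑ j ∈ Finset.range n, G i j * β ^ j) * β ^ i :=
        sum_max_mul_pow_le h0 h1 n (F := fun u => 2 / (1 - β) * ∑ j ∈ Finset.range n, G u j * β ^ j)
          fun i => mul_nonneg hβ (Finset.sum_nonneg fun j _ => mul_nonneg (hG i j) (by positivity))
    _ = _ := by
        rw [sq, mul_assoc, Finset.mul_sum (s := Finset.range n) (a := 2 / (1 - β))
          (f := fun i => ∑ j ∈ Finset.range n, G i j * β ^ (i + j))]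
        congr 1
        refine Finset.sum_congr rfl fun i _ => ?_
        rw [mul_assoc, Finset.sum_mul]
        congr 1
        refine Finset.sum_congr rfl fun j _ => ?_
        ring

/-- Row i contributes at most β^{max(i,m)}/(1-β). The m rows below m all contribute the same amount,
which is the source of the logarithm. -/
theorem sum_hyperbolic_tail_le {β : ℝ} (h0 : 0 < β) (h1 : β < 1) (n m : ℕ) :
    ∑ i ∈ Finset.range n, ∑ j ∈ Finset.range n, (if m ≤ i + j then 1 else 0) * β ^ (i + j)
      ≤ (m + 1) * β ^ m / (1 - β) ^ 2 := by
  have hb : 0 < 1 - β := by linarith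
  have inner : ∀ i, ∑ j ∈ Finset.range n, (if m ≤ i + j then 1 else 0) * β ^ (i + j)
      ≤ β ^ (i + (m - i)) / (1 - β) := by
    intro i
    calc _ = β ^ i * ∑ j ∈ (Finset.range n).filter (fun j => m ≤ i + j), β ^ j := by
          rw [Finset.mul_sum, Finset.sum_filter]
          refine Finset.sum_congr rfl fun j _ => ?_
          split_ifs
          · rw [one_mul, pow_add]
          · rw [zero_mul]
      _ ≤ β ^ i * ∑ j ∈ Finset.Ico (m - i) n, β ^ j := by
          gcongr
          intro j hj
          simp only [Finset.mem_filter, Finset.mem_range, Finset.mem_Ico] at hj ⊢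
          omega
      _ ≤ β ^ i * (β ^ (m - i) / (1 - β)) := by
          gcongr
          exact geom_sum_Ico_le_of_lt_one h0.le h1
      _ = _ := by rw [pow_add]; ring
  have outer : ∑ i ∈ Finset.range n, β ^ (i + (m - i)) ≤ m * β ^ m + β ^ m / (1 - β) := by
    calc _ ≤ ∑ i ∈ Finset.range n, ((if i < m then β ^ m else 0)
          + (if m ≤ i then β ^ i else 0)) := by
          refine Finset.sum_le_sum fun i _ => ?_
          rcases lt_or_ge i m with h | h
          · rw [if_pos h, if_neg (by omega), show i + (m - i) = m by omega, add_zero]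
          · rw [if_neg (by omega), if_pos h, show i + (m - i) = i by omega, zero_add]
      _ ≤ m * β ^ m + β ^ m / (1 - β) := by
          rw [Finset.sum_add_distrib, ← Finset.sum_filter, ← Finset.sum_filter]
          refine add_le_add ?_ ?_
          · rw [Finset.sum_const, nsmul_eq_mul]
            gcongr
            calc _ ≤ (Finset.range m).card := Finset.card_le_card fun i hi => by
                  simp only [Finset.mem_filter, Finset.mem_range] at hi ⊢; exact hi.2
              _ = m := Finset.card_range m
          · refine le_trans ?_ (geom_sum_Ico_le_of_lt_one (m := m) (n := n) h0.le h1)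
            refine Finset.sum_le_sum_of_subset_of_nonneg (fun i hi => ?_) fun i _ _ => by positivity
            simp only [Finset.mem_filter, Finset.mem_range, Finset.mem_Ico] at hi ⊢
            omega
  calc _ ≤ ∑ i ∈ Finset.range n, β ^ (i + (m - i)) / (1 - β) :=
        Finset.sum_le_sum fun i _ => inner i
    _ ≤ (m * β ^ m + β ^ m / (1 - β)) / (1 - β) := by
        rw [← Finset.sum_div]
        gcongr
    _ ≤ _ := by
        rw [div_le_div_iff₀ hb (by positivity)]
        have e : (m * β ^ m + β ^ m / (1 - β)) * (1 - β) ^ 2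
            = (m * β ^ m * (1 - β) + β ^ m) * (1 - β) := by
          field_simp
        rw [e]
        gcongr
        have : 0 ≤ m * β ^ m := by positivity
        nlinarith

/-! ### The upper bound for complex functions -/

/-- The upper bound for the Fibonacci quadrature error of `|f|²`. -/
theorem norm_fibErr_mul_conj_le {r q : ℝ} (hq : 1 ≤ q) (hr : 1 / q < r) (l : ℕ) :
    ∃ C : ℝ, 0 < C ∧ ∀ (f : Torus 2 → ℂ) (_ : Continuous f) (_ : HasMixedBound l r q f) (n : ℕ),
      1 ≤ n → ‖fibErr (n + 1) (fun x => f x * (starRingEnd ℂ) (f x))‖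
        ≤ C * ((fibB (n + 1) : ℝ) ^ (-r) * Real.log (fibB (n + 1))) := by
  have hq0 : 0 < q := by linarith
  have hr0 : 0 < r := lt_trans (by positivity) hr
  obtain ⟨L, hL⟩ : ∃ L : ℕ, r * q + 2 ≤ 2 * L := by
    obtain ⟨L, hL⟩ := exists_nat_ge (r * q + 2)
    exact ⟨L, by linarith [(Nat.cast_nonneg L : (0 : ℝ) ≤ L)]⟩
  have hL1 : 1 ≤ L := by
    by_contra! h
    have : L = 0 := by omega
    rw [this] at hL
    have : 0 < r * q := by positivity
    norm_num at hL
    linarith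
  obtain ⟨C, hC, hpair⟩ := norm_fibErr_block_mul_conj_le hr0 hq hL l
  set α := r - 1 / q with hα
  have hα0 : 0 < α := by linarith
  set β : ℝ := 2 ^ (-α) with hβ
  have hβ0 : 0 < β := by positivity
  have hβ1 : β < 1 := Real.rpow_lt_one_of_one_lt_of_neg one_lt_two (by linarith)
  set κ : ℕ := (15 * (4 * L)) ^ 2 with hκ
  have hκ1 : 1 ≤ κ := Nat.one_le_pow _ _ (by omega)
  have hκ0 : (0 : ℝ) < κ := by exact_mod_cast hκ1
  have hlog2 : 0 < Real.log 2 := Real.log_pos one_lt_two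
  have hb1 : 0 < 1 - β := by linarith
  refine ⟨C * ((2 / (1 - β)) ^ 2 * ((3 / Real.log 2) * (κ : ℝ) ^ α / (1 - β) ^ 2)),
    by positivity, fun f hf hb n hn => ?_⟩
  set b := fibB (n + 1) with hbdef
  have hb2 : 2 ≤ b := two_le_fibB (by omega)
  have hb2' : (2 : ℝ) ≤ b := by exact_mod_cast hb2
  have hb0 : (0 : ℝ) < b := by linarith
  -- The least such m is the level at which exactness may first fail; minimality gives m = O(log b),
  -- and b ≤ κ2^m gives β^m = O(b^{-α}).
  have hex : ∃ m, b ≤ κ * 2 ^ m := ⟨b, by nlinarith [Nat.lt_two_pow_self (n := b)]⟩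
  classical
  set m := Nat.find hex with hm
  have hm1 : b ≤ κ * 2 ^ m := Nat.find_spec hex
  have hmlog : (m : ℝ) + 1 ≤ 3 / Real.log 2 * Real.log b := by
    have hlogb : Real.log 2 ≤ Real.log b := Real.log_le_log (by norm_num) hb2'
    rw [div_mul_eq_mul_div, le_div_iff₀ hlog2]
    rcases Nat.eq_zero_or_pos m with h | h
    · rw [h]
      push_cast
      linarith
    · have h2 : κ * 2 ^ (m - 1) < b := by
        have := Nat.find_min hex (m := m - 1) (by omega)
        omega
      have h3 : (2 : ℝ) ^ (m - 1) ≤ b := by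
        have : 2 ^ (m - 1) ≤ b := by nlinarith
        exact_mod_cast this
      have h4 := Real.log_le_log (by positivity) h3
      rw [Real.log_pow, Nat.cast_sub h] at h4
      push_cast at h4
      linarith
  have hβm : β ^ m ≤ (κ : ℝ) ^ α * (b : ℝ) ^ (-α) := by
    have h2 : (b : ℝ) / κ ≤ 2 ^ m := by
      rw [div_le_iff₀ hκ0]
      have : (b : ℝ) ≤ κ * 2 ^ m := by exact_mod_cast hm1
      linarith
    calc β ^ m = ((2 : ℝ) ^ m) ^ (-α) := by
          rw [hβ, ← Real.rpow_natCast, ← Real.rpow_mul two_pos.le, mul_comm,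
            Real.rpow_mul two_pos.le, Real.rpow_natCast]
      _ ≤ ((b : ℝ) / κ) ^ (-α) :=
          Real.rpow_le_rpow_of_nonpos (by positivity) h2 (by linarith)
      _ = _ := by
          rw [Real.div_rpow hb0.le hκ0.le, Real.rpow_neg hκ0.le, div_inv_eq_mul, mul_comm]
  set G : ℕ → ℕ → ℝ := fun i j => if m ≤ i + j then 1 else 0 with hG
  have hG0 : ∀ i j, 0 ≤ G i j := fun i j => by simp only [hG]; split_ifs <;> norm_num
  have hblock : ∀ a a' : ℕ × ℕ, ‖fibErr (n + 1) (fun x => block (4 * L) ![a.1, a.2] f x *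
      (starRingEnd ℂ) (block (4 * L) ![a'.1, a'.2] f x))‖
      ≤ C * (b : ℝ) ^ (-(1 / q)) *
        (G (max a.1 a'.1) (max a.2 a'.2) * β ^ (a.1 + a.2 + (a'.1 + a'.2))) := by
    intro a a'
    have hk : (15 * (4 * L) * 2 ^ (max a.1 a'.1)) * (15 * (4 * L) * 2 ^ (max a.2 a'.2))
        = κ * 2 ^ (max a.1 a'.1 + max a.2 a'.2) := by
      rw [hκ, pow_add]; ring
    by_cases hcond : b ≤ κ * 2 ^ (max a.1 a'.1 + max a.2 a'.2)
    · refine (hpair f hf hb n ![a.1, a.2] ![a'.1, a'.2] ?_).trans (le_of_eq ?_)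
      · simpa [hk] using hcond
      · have h3 : m ≤ max a.1 a'.1 + max a.2 a'.2 := Nat.find_min' hex hcond
        simp only [hG, if_pos h3, one_mul, Matrix.cons_val_zero, Matrix.cons_val_one]
        rw [← pow_add, ← pow_add, ← pow_add, hβ, ← Real.rpow_natCast, ← Real.rpow_natCast,
          ← Real.rpow_mul two_pos.le, ← Real.rpow_mul two_pos.le, mul_comm (_ : ℝ) (-α)]
    · have h3 : fibErr (n + 1) (fun x => block (4 * L) ![a.1, a.2] f x *
          (starRingEnd ℂ) (block (4 * L) ![a'.1, a'.2] f x)) = 0 := by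
        refine fibErr_block_mul_conj_eq_zero n (by omega) _ _ hf ?_
        rw [not_le] at hcond
        simpa [hk] using hcond
      rw [h3, norm_zero]
      have := hG0 (max a.1 a'.1) (max a.2 a'.2)
      positivity
  have hpart : ∀ S, ‖fibErr (n + 1) (fun x => partialSum (4 * L) S f x *
      (starRingEnd ℂ) (partialSum (4 * L) S f x))‖
      ≤ C * ((2 / (1 - β)) ^ 2 * ((3 / Real.log 2) * (κ : ℝ) ^ α / (1 - β) ^ 2)) *
        ((b : ℝ) ^ (-r) * Real.log b) := by
    intro S
    set I := Finset.range (S + 1) ×ˢ Finset.range (S + 1) with hI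
    have hcont : ∀ a : ℕ × ℕ, Continuous (block (4 * L) ![a.1, a.2] f) := fun a =>
      continuous_block _ _ hf
    have e : (fun x => partialSum (4 * L) S f x * (starRingEnd ℂ) (partialSum (4 * L) S f x))
        = fun x => ∑ a ∈ I, ∑ a' ∈ I, block (4 * L) ![a.1, a.2] f x *
          (starRingEnd ℂ) (block (4 * L) ![a'.1, a'.2] f x) := by
      funext x
      rw [partialSum, map_sum, Finset.sum_mul_sum]
    have hterm : ∀ a a' : ℕ × ℕ, Continuous fun x => block (4 * L) ![a.1, a.2] f x *
          (starRingEnd ℂ) (block (4 * L) ![a'.1, a'.2] f x) := fun a a' =>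
      (hcont a).mul (Complex.continuous_conj.comp (hcont a'))
    rw [e, fibErr_sum _ _ fun a _ => continuous_finsetSum _ fun a' _ => hterm a a']
    simp only [fibErr_sum (n + 1) I fun a' _ => hterm _ a']
    calc _ ≤ ∑ a ∈ I, ∑ a' ∈ I, C * (b : ℝ) ^ (-(1 / q)) *
          (G (max a.1 a'.1) (max a.2 a'.2) * β ^ (a.1 + a.2 + (a'.1 + a'.2))) :=
          (norm_sum_le _ _).trans (Finset.sum_le_sum fun a _ =>
            (norm_sum_le _ _).trans (Finset.sum_le_sum fun a' _ => hblock a a'))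
      _ = C * (b : ℝ) ^ (-(1 / q)) * ∑ a ∈ I, ∑ a' ∈ I,
          (G (max a.1 a'.1) (max a.2 a'.2) * β ^ (a.1 + a.2 + (a'.1 + a'.2))) := by
          simp only [Finset.mul_sum]
      _ ≤ C * (b : ℝ) ^ (-(1 / q)) * ((2 / (1 - β)) ^ 2 *
          ((m + 1) * β ^ m / (1 - β) ^ 2)) := by
          gcongr
          refine (sum_sum_max_mul_pow_le hβ0.le hβ1 (S + 1) hG0).trans ?_
          gcongr
          exact sum_hyperbolic_tail_le hβ0 hβ1 (S + 1) m
      _ ≤ C * (b : ℝ) ^ (-(1 / q)) * ((2 / (1 - β)) ^ 2 *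
          ((3 / Real.log 2 * Real.log b) * ((κ : ℝ) ^ α * (b : ℝ) ^ (-α)) / (1 - β) ^ 2)) := by
          have : 0 ≤ 3 / Real.log 2 * Real.log b := le_trans (by positivity) hmlog
          gcongr
      _ = _ := by
          have e : (b : ℝ) ^ (-r) = (b : ℝ) ^ (-(1 / q)) * (b : ℝ) ^ (-α) := by
            rw [← Real.rpow_add hb0, hα]
            congr 1
            ring
          rw [e]
          ring
  -- The bound for the partial sums does not depend on S, so it passes to f by uniform
  -- approximation.
  refine le_of_forall_pos_le_add fun ε hε => ?_
  obtain ⟨K, hK⟩ := (isCompact_range hf).isBounded.exists_norm_le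
  have hK' : ∀ x, ‖f x‖ ≤ K := fun x => hK _ ⟨x, rfl⟩
  have hK0 : 0 ≤ K := (norm_nonneg _).trans (hK' 0)
  obtain ⟨η, hη0, hη⟩ : ∃ η : ℝ, 0 < η ∧ 2 * (η * (2 * K + 1)) ≤ ε ∧ η ≤ 1 := by
    refine ⟨min 1 (ε / (2 * (2 * K + 1))), by positivity, ?_, min_le_left _ _⟩
    calc 2 * (min 1 (ε / (2 * (2 * K + 1))) * (2 * K + 1))
        ≤ 2 * (ε / (2 * (2 * K + 1)) * (2 * K + 1)) := by gcongr; exact min_le_right _ _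
      _ = ε := by field_simp
  obtain ⟨S, hS⟩ := exists_partialSum_close (Q := 4 * L) (by omega) hf hη0
  have hpc : Continuous (partialSum (4 * L) S f) :=
    continuous_finsetSum _ fun a _ => continuous_block _ _ hf
  have hdiff := norm_fibErr_sub_le (n + 1) (F := fun x => f x * (starRingEnd ℂ) (f x))
    (G := fun x => partialSum (4 * L) S f x * (starRingEnd ℂ) (partialSum (4 * L) S f x))
    (hf.mul (Complex.continuous_conj.comp hf)) (hpc.mul (Complex.continuous_conj.comp hpc))
    (K := η * (2 * K + 1)) (by
      intro x
      have h1 := hS x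
      have h2 := hK' x
      have h3 : ‖partialSum (4 * L) S f x‖ ≤ K + 1 := by
        have := norm_sub_norm_le (partialSum (4 * L) S f x) (f x)
        linarith [hη.2]
      have e : f x * (starRingEnd ℂ) (f x)
          - partialSum (4 * L) S f x * (starRingEnd ℂ) (partialSum (4 * L) S f x)
          = -((partialSum (4 * L) S f x - f x) * (starRingEnd ℂ) (partialSum (4 * L) S f x)
            + f x * (starRingEnd ℂ) (partialSum (4 * L) S f x - f x)) := by
        rw [map_sub]; ring
      rw [e, norm_neg]
      refine (norm_add_le _ _).trans ?_
      rw [norm_mul, norm_mul, RCLike.norm_conj, RCLike.norm_conj]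
      calc _ ≤ η * (K + 1) + K * η := by gcongr
        _ = _ := by ring)
  have := norm_sub_norm_le (fibErr (n + 1) (fun x => f x * (starRingEnd ℂ) (f x)))
    (fibErr (n + 1) (fun x => partialSum (4 * L) S f x *
      (starRingEnd ℂ) (partialSum (4 * L) S f x)))
  linarith [hpart S, hη.1]

/-! ### From the class to complex functions and a finite exponent -/

/-- The isometric additive embedding of a real or complex scalar into `ℂ`. -/
def toC {𝕜 : Type*} [RCLike 𝕜] (z : 𝕜) : ℂ := ⟨RCLike.re z, RCLike.im z⟩

theorem toC_sub {𝕜 : Type*} [RCLike 𝕜] (z w : 𝕜) : toC (z - w) = toC z - toC w := by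
  apply Complex.ext <;> simp [toC]

theorem norm_toC {𝕜 : Type*} [RCLike 𝕜] (z : 𝕜) : ‖toC z‖ = ‖z‖ := by
  rw [← sq_eq_sq₀ (norm_nonneg _) (norm_nonneg _), ← Complex.normSq_eq_norm_sq,
    ← RCLike.normSq_eq_def']
  simp [toC, Complex.normSq_apply, RCLike.normSq_apply]

theorem continuous_toC {𝕜 : Type*} [RCLike 𝕜] : Continuous (toC : 𝕜 → ℂ) := by
  rw [continuous_iff_continuousAt]
  intro z
  rw [ContinuousAt, tendsto_iff_norm_sub_tendsto_zero]
  simp_rw [← toC_sub, norm_toC]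
  exact tendsto_iff_norm_sub_tendsto_zero.1 Filter.tendsto_id

theorem comp_coordDiff {𝕜 𝕜' : Type*} [RCLike 𝕜] [RCLike 𝕜'] {φ : 𝕜 → 𝕜'}
    (hφ : ∀ z w, φ (z - w) = φ z - φ w) {d : ℕ} (l : ℕ) (t : ℝ) (j : Fin d) (g : Torus d → 𝕜) :
    (fun x => φ (coordDiff l t j g x)) = coordDiff l t j (fun x => φ (g x)) := by
  unfold coordDiff
  induction l with
  | zero => rfl
  | succ l ih =>
    rw [Function.iterate_succ_apply', Function.iterate_succ_apply', ← ih]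
    funext x
    simp only [fwdDiff, hφ]

theorem comp_mixedDiff {𝕜 𝕜' : Type*} [RCLike 𝕜] [RCLike 𝕜'] {φ : 𝕜 → 𝕜'}
    (hφ : ∀ z w, φ (z - w) = φ z - φ w) {d : ℕ} (l : ℕ) (t : Fin d → ℝ)
    (e : Finset (Fin d)) (f : Torus d → 𝕜) :
    (fun x => φ (mixedDiff l t e f x)) = mixedDiff l t e (fun x => φ (f x)) := by
  unfold mixedDiff
  induction (List.finRange d) generalizing f with
  | nil => rfl
  | cons j J ih =>
    rw [List.foldl_cons, List.foldl_cons, ih]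
    split_ifs
    · rw [comp_coordDiff hφ]
    · rfl

/-- A step on the circle is lifted to its representative of least absolute value, for which |t_j| is
the circle norm; e is the set of differenced variables. -/
theorem hasMixedBound_of_mem_classH {𝕜 : Type*} [RCLike 𝕜] {r q : ℝ} (hq : 1 ≤ q)
    {f : C(Torus 2, 𝕜)} (hf : f ∈ classH 𝕜 2 r (ENNReal.ofReal q)) :
    HasMixedBound (⌊r⌋₊ + 1) r q (fun x => toC (f x)) := by
  intro s t
  have hq0 : 0 < q := by linarith
  have hfc : Continuous fun x => toC (f x) := continuous_toC.comp f.continuous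
  set t' : Fin 2 → ℝ := fun j => circRep (t j) with ht'
  have h := hf (Finset.univ.filter fun j => s j ≠ 0) t'
  have e : (fun x => toC (mixedDiff (⌊r⌋₊ + 1) t' (Finset.univ.filter fun j => s j ≠ 0) (⇑f) x))
      = blockDiff (⌊r⌋₊ + 1) s t (fun x => toC (f x)) := by
    rw [comp_mixedDiff toC_sub, mixedDiff_eq_blockDiff]
    congr 1
    funext j
    exact coe_circRep _
  have hcont : Continuous (blockDiff (⌊r⌋₊ + 1) s t (fun x => toC (f x))) :=
    (continuous_blockDiff _ s hfc).comp (continuous_const.prodMk continuous_id)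
  have hnorm : eLpNorm (mixedDiff (⌊r⌋₊ + 1) t' (Finset.univ.filter fun j => s j ≠ 0) (⇑f))
      (ENNReal.ofReal q) (torusMeasure 2)
      = eLpNorm (blockDiff (⌊r⌋₊ + 1) s t (fun x => toC (f x))) (ENNReal.ofReal q)
        (torusMeasure 2) := by
    rw [← e]
    exact eLpNorm_congr_norm_ae (Filter.Eventually.of_forall fun x => (norm_toC _).symm)
  have hprod : ∏ j ∈ Finset.univ.filter (fun j => s j ≠ 0), |t' j| ^ r
      = (if s 0 = 0 then 1 else ‖t 0‖ ^ r) * (if s 1 = 0 then 1 else ‖t 1‖ ^ r) := by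
    rw [Finset.prod_filter, Fin.prod_univ_two]
    simp only [ht', abs_circRep]
    split_ifs <;> simp_all
  rw [hnorm, hprod, eLpNorm_eq_lintegral_rpow_enorm_toReal (by positivity) ENNReal.ofReal_ne_top,
    ENNReal.toReal_ofReal hq0.le, one_div, ENNReal.rpow_inv_le_iff hq0] at h
  have hcq : Continuous fun x => ‖blockDiff (⌊r⌋₊ + 1) s t (fun x => toC (f x)) x‖ ^ q :=
    hcont.norm.rpow_const fun _ => Or.inr hq0.le
  have h2 : ENNReal.ofReal (∫ x, ‖blockDiff (⌊r⌋₊ + 1) s t (fun x => toC (f x)) x‖ ^ q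
      ∂torusMeasure 2)
      = ∫⁻ x, ‖blockDiff (⌊r⌋₊ + 1) s t (fun x => toC (f x)) x‖ₑ ^ q ∂torusMeasure 2 := by
    rw [ofReal_integral_eq_lintegral_ofReal (integrable_torus_of_continuous hcq)
      (Filter.Eventually.of_forall fun x => by positivity)]
    refine lintegral_congr fun x => ?_
    rw [← ENNReal.ofReal_rpow_of_nonneg (norm_nonneg _) hq0.le, ofReal_norm]
  rw [← h2, ENNReal.ofReal_rpow_of_nonneg (by positivity) hq0.le,
    ENNReal.ofReal_le_ofReal_iff (by positivity)] at h
  refine h.trans (le_of_eq ?_)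
  rw [Real.mul_rpow (by positivity) (by positivity)]
  have hpow : ∀ (u : ℕ) (z : Circ), (if u = 0 then (1 : ℝ) else ‖z‖ ^ r) ^ q
      = if u = 0 then 1 else ‖z‖ ^ (r * q) := by
    intro u z
    split_ifs
    · exact Real.one_rpow q
    · rw [← Real.rpow_mul (norm_nonneg _)]
  rw [hpow, hpow]

theorem classH_mono {𝕜 : Type*} [RCLike 𝕜] {r : ℝ} {p p' : ℝ≥0∞} (h : p' ≤ p) :
    classH 𝕜 2 r p ⊆ classH 𝕜 2 r p' := by
  intro f hf e t
  refine (eLpNorm_le_eLpNorm_of_exponent_le h ?_).trans (hf e t)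
  refine Continuous.aestronglyMeasurable ?_
  have hc : ∀ (J : List (Fin 2)) (g : Torus 2 → 𝕜), Continuous g →
      Continuous (J.foldl (fun g j => if j ∈ e then coordDiff (⌊r⌋₊ + 1) (t j) j g else g) g) := by
    intro J
    induction J with
    | nil => intro g hg; exact hg
    | cons j J ih =>
      intro g hg
      rw [List.foldl_cons]
      refine ih _ ?_
      split_ifs
      · have hfd : ∀ (k : ℕ) (h : Torus 2), Continuous ((fwdDiff h)^[k] g) := by
          intro k h
          induction k with
          | zero => exact hg
          | succ k ih =>
            rw [Function.iterate_succ_apply']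
            unfold fwdDiff at ih ⊢
            exact (ih.comp (continuous_add_const h)).sub ih
        exact hfd _ _
      · exact hg
  exact hc _ _ f.continuous

/-- For p = ∞ a finite q with 1/q ≤ r/2 is enough, since the classes grow as the exponent decreases.
-/
theorem exists_real_exponent {p : ℝ≥0∞} (hp : 1 ≤ p) {r : ℝ} (hr : 1 / p < ENNReal.ofReal r) :
    ∃ q : ℝ, 1 ≤ q ∧ 1 / q < r ∧ ENNReal.ofReal q ≤ p := by
  have hr0 : 0 < r := by
    rw [← ENNReal.ofReal_pos]
    exact lt_of_le_of_lt zero_le hr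
  rcases eq_or_ne p ⊤ with rfl | hpt
  · refine ⟨max 1 (2 / r), le_max_left _ _, ?_, le_top⟩
    calc 1 / max 1 (2 / r) ≤ 1 / (2 / r) := by
          gcongr
          exact le_max_right _ _
      _ = r / 2 := by field_simp
      _ < r := by linarith
  · refine ⟨p.toReal, ?_, ?_, (ENNReal.ofReal_toReal hpt).le⟩
    · rw [← ENNReal.toReal_one]
      exact ENNReal.toReal_mono hpt hp
    · have h2 := (ENNReal.toReal_lt_toReal (ne_top_of_lt hr) ENNReal.ofReal_ne_top).2 hr
      rwa [ENNReal.toReal_ofReal hr0.le, ENNReal.toReal_div, ENNReal.toReal_one] at h2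

/-- The upper bound for the discretization error of the Fibonacci points. -/
theorem samplingError_fibPoint_le {𝕜 : Type*} [RCLike 𝕜] {p : ℝ≥0∞} (hp : 1 ≤ p) {r : ℝ}
    (hr : 1 / p < ENNReal.ofReal r) :
    ∃ C : ℝ, 0 < C ∧ ∀ n : ℕ, 2 ≤ n →
      samplingError (torusMeasure 2) 2 (classH 𝕜 2 r p) (fibPoint n)
        ≤ ENNReal.ofReal (C * ((fibB n : ℝ) ^ (-r) * Real.log (fibB n))) := by
  obtain ⟨q, hq, hqr, hqp⟩ := exists_real_exponent hp hr
  have hr0 : 0 < r := lt_trans (by positivity) hqr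
  obtain ⟨C, hC, h⟩ := norm_fibErr_mul_conj_le hq hqr (⌊r⌋₊ + 1)
  refine ⟨C, hC, fun n hn => ?_⟩
  obtain ⟨m, rfl⟩ := Nat.exists_eq_add_of_le' (show 1 ≤ n by omega)
  refine iSup₂_le fun f hf => ENNReal.ofReal_le_ofReal ?_
  have hfc : Continuous fun x => toC (f x) := continuous_toC.comp f.continuous
  refine le_trans (le_of_eq ?_) (h (fun x => toC (f x)) hfc
    (hasMixedBound_of_mem_classH hq (classH_mono hqp hf)) m (by omega))
  have e : ∀ x, toC (f x) * (starRingEnd ℂ) (toC (f x)) = ((‖f x‖ ^ (2 : ℝ) : ℝ) : ℂ) := by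
    intro x
    rw [Complex.mul_conj', norm_toC, Real.rpow_two]
    push_cast
    rfl
  simp only [fibErr, e]
  rw [integral_complex_ofReal, ← Complex.ofReal_sum, ← Real.norm_eq_abs, ← Complex.norm_real]
  push_cast
  rfl

/-! ### Periodic bumps and their differences -/

open scoped ContDiff in
-- Differences commute with the derivative, so the mean value theorem gains one factor |t| per
-- order.
theorem exists_fwdDiff_iter_le_of_contDiff {h : ℝ → ℝ} (l : ℕ) (hh : ContDiff ℝ ∞ h)
    (hs : HasCompactSupport h) : ∃ M : ℝ, ∀ t x : ℝ, |(fwdDiff t)^[l] h x| ≤ M * |t| ^ l := by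
  have hderiv : ∀ (k : ℕ) (t x : ℝ),
      HasDerivAt ((fwdDiff t)^[k] h) ((fwdDiff t)^[k] (deriv h) x) x := by
    intro k t
    induction k with
    | zero => exact fun x => (hh.differentiable (by simp) x).hasDerivAt
    | succ k ih =>
      intro x
      rw [Function.iterate_succ_apply', Function.iterate_succ_apply']
      exact ((ih (x + t)).comp_add_const x t).sub (ih x)
  induction l generalizing h with
  | zero =>
    obtain ⟨M, hM⟩ := hs.exists_bound_of_continuous hh.continuous
    exact ⟨M, fun t x => by simpa using hM x⟩
  | succ l ih =>
    have hd : ContDiff ℝ ∞ (deriv h) := (contDiff_infty_iff_deriv.1 hh).2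
    obtain ⟨M, hM⟩ := ih hd hs.deriv (by
      intro k t
      induction k with
      | zero => exact fun x => (hd.differentiable (by simp) x).hasDerivAt
      | succ k ih =>
        intro x
        rw [Function.iterate_succ_apply', Function.iterate_succ_apply']
        exact ((ih (x + t)).comp_add_const x t).sub (ih x))
    refine ⟨M, fun t x => ?_⟩
    rw [Function.iterate_succ_apply', fwdDiff]
    have := Convex.norm_image_sub_le_of_norm_hasDerivWithin_le (s := Set.univ)
      (f := (fwdDiff t)^[l] h) (C := M * |t| ^ l) (x := x) (y := x + t)
      (fun y _ => (hderiv l t y).hasDerivWithinAt) (fun y _ => hM t y) convex_univ trivial trivial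
    rw [Real.norm_eq_abs, Real.norm_eq_abs, add_sub_cancel_left] at this
    rw [pow_succ, ← mul_assoc]
    exact this

/-- A smooth bump on the unit interval. -/
def unitBump : ContDiffBump (1 / 2 : ℝ) := ⟨1 / 8, 1 / 4, by norm_num, by norm_num⟩

theorem unitBump_eq_zero {y : ℝ} (h : y ≤ 1 / 4 ∨ 3 / 4 ≤ y) : unitBump y = 0 := by
  apply unitBump.zero_of_le_dist
  rw [Real.dist_eq, show unitBump.rOut = 1 / 4 from rfl, le_abs]
  rcases h with h | h
  · right; linarith
  · left; linarith

theorem unitBump_eq_one {y : ℝ} (h₁ : 3 / 8 ≤ y) (h₂ : y ≤ 5 / 8) : unitBump y = 1 := by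
  apply unitBump.one_of_mem_closedBall
  rw [Metric.mem_closedBall, Real.dist_eq, show unitBump.rIn = 1 / 8 from rfl, abs_le]
  constructor <;> linarith

/-- The `1`-periodic bump supported on `[0, 1/c]` modulo one. -/
def perBump (c : ℕ) (y : ℝ) : ℝ := unitBump (c * Int.fract y)

/-- The bump vanishes on the first and last quarter of its arc. If y leaves the unit interval of x,
it does so by at most 1/(4c), where both sides are zero. -/
theorem perBump_eq {c : ℕ} (hc : 1 ≤ c) {x y : ℝ} (h : |y - x| ≤ 1 / (4 * c)) :
    perBump c y = unitBump (c * (y - ⌊x⌋)) := by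
  have hc' : (1 : ℝ) ≤ c := by exact_mod_cast hc
  have hc0 : (0 : ℝ) < c := by linarith
  have h4 : c * (1 / (4 * c)) = (1 / 4 : ℝ) := by field_simp
  have hle : 1 / (4 * c) ≤ (1 / 4 : ℝ) := by
    rw [div_le_div_iff₀ (by positivity) (by norm_num)]; linarith
  have f1 := Int.floor_le x
  have f2 := Int.lt_floor_add_one x
  rw [abs_le] at h
  set k := ⌊x⌋
  unfold perBump
  rcases lt_or_ge y k with hy | hy
  · have hfl : ⌊y⌋ = k - 1 := by
      rw [Int.floor_eq_iff]; push_cast; constructor <;> linarith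
    rw [Int.fract, hfl, unitBump_eq_zero, unitBump_eq_zero]
    · left; nlinarith
    · right
      push_cast
      nlinarith
  · rcases lt_or_ge y (k + 1) with hy2 | hy2
    · have hfl : ⌊y⌋ = k := by rw [Int.floor_eq_iff]; constructor <;> linarith
      rw [Int.fract, hfl]
    · have hfl : ⌊y⌋ = k + 1 := by
        rw [Int.floor_eq_iff]; push_cast; constructor <;> linarith
      rw [Int.fract, hfl, unitBump_eq_zero, unitBump_eq_zero]
      · right; nlinarith
      · left
        push_cast
        nlinarith

theorem continuous_perBump {c : ℕ} (hc : 1 ≤ c) : Continuous (perBump c) := by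
  have hc' : (1 : ℝ) ≤ c := by exact_mod_cast hc
  rw [continuous_iff_continuousAt]
  intro x
  have h1 : ContinuousAt (fun y : ℝ => unitBump (c * (y - ⌊x⌋))) x := by
    have := unitBump.continuous
    exact Continuous.continuousAt (by fun_prop)
  refine h1.congr ?_
  filter_upwards [Metric.closedBall_mem_nhds x (show (0 : ℝ) < 1 / (4 * c) by positivity)] with y hy
  rw [Metric.mem_closedBall, Real.dist_eq] at hy
  exact (perBump_eq hc hy).symm

theorem perBump_nonneg (c : ℕ) (y : ℝ) : 0 ≤ perBump c y := unitBump.nonneg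

theorem perBump_le_one (c : ℕ) (y : ℝ) : perBump c y ≤ 1 := unitBump.le_one

theorem perBump_add_one (c : ℕ) (y : ℝ) : perBump c (y + 1) = perBump c y := by
  unfold perBump; rw [Int.fract_add_one]

theorem perBump_shift_injective {c : ℕ} (hc : 1 ≤ c) {y : ℝ} {i i' : ℕ} (hi : i < c)
    (hi' : i' < c) (h : perBump c (y - i / c) ≠ 0) (h' : perBump c (y - i' / c) ≠ 0) :
    i = i' := by
  have hc0 : (0 : ℝ) < c := by exact_mod_cast hc
  have key : ∀ z, perBump c z ≠ 0 → 1 / 4 < c * Int.fract z ∧ c * Int.fract z < 3 / 4 := by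
    intro z hz
    by_contra hcon
    rw [not_and_or, not_lt, not_lt] at hcon
    exact hz (unitBump_eq_zero hcon)
  obtain ⟨a1, a2⟩ := key _ h
  obtain ⟨b1, b2⟩ := key _ h'
  set k := ⌊y - i / c⌋
  set k' := ⌊y - i' / c⌋
  have e1 : (c : ℝ) * Int.fract (y - i / c) = c * y - i - c * k := by
    change (c : ℝ) * (y - i / c - k) = _
    rw [mul_sub, mul_sub, mul_div_cancel₀ _ hc0.ne']
  have e2 : (c : ℝ) * Int.fract (y - i' / c) = c * y - i' - c * k' := by
    change (c : ℝ) * (y - i' / c - k') = _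
    rw [mul_sub, mul_sub, mul_div_cancel₀ _ hc0.ne']
  rw [e1] at a1 a2
  rw [e2] at b1 b2
  have h1 : |((i' : ℤ) - i + c * (k' - k) : ℤ)| < 1 := by
    have : |(((i' : ℤ) - i + c * (k' - k) : ℤ) : ℝ)| < 1 := by
      push_cast
      rw [abs_lt]
      constructor <;> linarith
    exact_mod_cast this
  rw [Int.abs_lt_one_iff] at h1
  have h2 : (c : ℤ) ∣ (i : ℤ) - i' := ⟨k' - k, by linarith⟩
  have h3 := Int.eq_zero_of_abs_lt_dvd h2 (by rw [abs_lt]; omega)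
  omega

theorem abs_fwdDiff_iter_le {M : Type*} [AddCommMonoid M] {f : M → ℝ} (h : M) (l : ℕ) {K : ℝ}
    (hf : ∀ x, |f x| ≤ K) (x : M) : |(fwdDiff h)^[l] f x| ≤ 2 ^ l * K := by
  induction l generalizing x with
  | zero => simpa using hf x
  | succ l ih =>
    rw [Function.iterate_succ_apply', fwdDiff]
    calc _ ≤ |(fwdDiff h)^[l] f (x + h)| + |(fwdDiff h)^[l] f x| := abs_sub _ _
      _ ≤ 2 ^ l * K + 2 ^ l * K := add_le_add (ih _) (ih _)
      _ = _ := by ring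

/-- If c|t| ≤ 1/(4(l+1)), all shifts stay within 1/(4c) of x and the difference is that of one
rescaled smooth bump. For longer steps the trivial bound 2^l suffices, at the cost of (4(l+1))^l. -/
theorem exists_fwdDiff_perBump_le (l : ℕ) : ∃ A : ℝ, 1 ≤ A ∧ ∀ (c : ℕ), 1 ≤ c → ∀ t x : ℝ,
    |(fwdDiff t)^[l] (perBump c) x| ≤ A * min 1 (c * |t|) ^ l := by
  obtain ⟨M, hM⟩ := exists_fwdDiff_iter_le_of_contDiff l unitBump.contDiff
    unitBump.hasCompactSupport
  refine ⟨max (max 1 M) (2 ^ l * (4 * (l + 1)) ^ l), (le_max_left _ _).trans (le_max_left _ _),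
    fun c hc t x => ?_⟩
  have hc0 : (0 : ℝ) < c := by exact_mod_cast hc
  have hle : |(fwdDiff t)^[l] (perBump c) x| ≤ 2 ^ l * 1 :=
    abs_fwdDiff_iter_le t l (fun y => by
      rw [abs_of_nonneg (perBump_nonneg c y)]; exact perBump_le_one c y) x
  have hct : 0 ≤ c * |t| := by positivity
  by_cases ht : c * |t| ≤ 1 / (4 * (l + 1))
  · have h1 : c * |t| ≤ 1 := by
      refine ht.trans ?_
      rw [div_le_one (by positivity)]
      have : (0 : ℝ) ≤ l := by positivity
      linarith
    have h2 : (fwdDiff t)^[l] (perBump c) x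
        = (fwdDiff (c * t))^[l] unitBump (c * (x - ⌊x⌋)) := by
      rw [fwdDiff_iter_eq_sum_shift, fwdDiff_iter_eq_sum_shift]
      refine Finset.sum_congr rfl fun k hk => ?_
      congr 1
      rw [perBump_eq (x := x) hc]
      · congr 1
        simp only [nsmul_eq_mul]
        ring
      · have hk' : (k : ℝ) ≤ l := by
          have : k ≤ l := by rw [Finset.mem_range] at hk; omega
          exact_mod_cast this
        rw [add_sub_cancel_left, nsmul_eq_mul, abs_mul, Nat.abs_cast, le_div_iff₀ (by positivity)]
        rw [le_div_iff₀ (by positivity)] at ht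
        have := abs_nonneg t
        calc (k : ℝ) * |t| * (4 * c) ≤ (l + 1) * |t| * (4 * c) := by gcongr; linarith
          _ = c * |t| * (4 * (l + 1)) := by ring
          _ ≤ 1 := ht
    rw [h2, min_eq_right h1]
    refine (hM _ _).trans ?_
    rw [abs_mul, Nat.abs_cast]
    gcongr
    exact (le_max_right _ _).trans (le_max_left _ _)
  · rw [not_le] at ht
    have h3 : 1 / (4 * (l + 1)) ≤ min 1 (c * |t|) := by
      refine le_min ?_ ht.le
      rw [div_le_one (by positivity)]
      have : (0 : ℝ) ≤ l := by positivity
      linarith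
    calc _ ≤ 2 ^ l * 1 := hle
      _ = 2 ^ l * (4 * (l + 1)) ^ l * (1 / (4 * (l + 1))) ^ l := by
          rw [mul_assoc, ← mul_pow, mul_one_div_cancel (by positivity), one_pow]
      _ ≤ _ := by
          gcongr
          exact le_max_right _ _

/-- The bump on the circle, translated to the `i`-th of `c` equal arcs. -/
def arcBump (c i : ℕ) : Circ → ℝ :=
  Function.Periodic.lift (f := fun y : ℝ => perBump c (y / (2 * π) - i / c)) (c := 2 * π) (by
    intro y
    have : (y + 2 * π) / (2 * π) - i / c = (y / (2 * π) - i / c) + 1 := by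
      field_simp
      ring
    simp only
    rw [this, perBump_add_one])

theorem arcBump_coe (c i : ℕ) (y : ℝ) :
    arcBump c i (y : Circ) = perBump c (y / (2 * π) - i / c) := rfl

theorem continuous_arcBump {c : ℕ} (hc : 1 ≤ c) (i : ℕ) : Continuous (arcBump c i) := by
  have h : Continuous fun y : ℝ => perBump c (y / (2 * π) - i / c) :=
    (continuous_perBump hc).comp (by fun_prop)
  exact continuous_coinduced_dom.2 h

theorem arcBump_nonneg (c i : ℕ) (x : Circ) : 0 ≤ arcBump c i x := by
  rw [← coe_circRep x, arcBump_coe]; exact perBump_nonneg _ _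

theorem arcBump_index_eq {c : ℕ} (hc : 1 ≤ c) {x : Circ} {i i' : ℕ} (hi : i < c)
    (hi' : i' < c) (h : arcBump c i x ≠ 0) (h' : arcBump c i' x ≠ 0) : i = i' := by
  rw [← coe_circRep x, arcBump_coe] at h h'
  exact perBump_shift_injective hc hi hi' h h'

theorem fwdDiff_iter_arcBump_coe (c i l : ℕ) (t y : ℝ) :
    (fwdDiff (t : Circ))^[l] (arcBump c i) (y : Circ)
      = (fwdDiff (t / (2 * π)))^[l] (perBump c) (y / (2 * π) - i / c) := by
  rw [fwdDiff_iter_eq_sum_shift, fwdDiff_iter_eq_sum_shift]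
  refine Finset.sum_congr rfl fun k _ => ?_
  congr 1
  have : (y : Circ) + k • (t : Circ) = ((y + k • t : ℝ) : Circ) := by
    rw [AddCircle.coe_add, AddCircle.coe_nsmul]
  rw [this, arcBump_coe]
  congr 1
  simp only [nsmul_eq_mul]
  ring

theorem abs_fwdDiff_arcBump_le {l : ℕ} {A : ℝ} (hA : 1 ≤ A)
    (h : ∀ (c : ℕ), 1 ≤ c → ∀ t x : ℝ, |(fwdDiff t)^[l] (perBump c) x| ≤ A * min 1 (c * |t|) ^ l)
    {c : ℕ} (hc : 1 ≤ c) (i : ℕ) (t : ℝ) (x : Circ) :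
    |(fwdDiff (t : Circ))^[l] (arcBump c i) x| ≤ A * min 1 (c * |t|) ^ l := by
  rw [← coe_circRep x, fwdDiff_iter_arcBump_coe]
  refine (h c hc _ _).trans ?_
  have hpi := Real.pi_gt_three
  have : |t / (2 * π)| ≤ |t| := by
    rw [abs_div, abs_of_pos Real.two_pi_pos]
    exact div_le_self (abs_nonneg t) (by linarith)
  gcongr

/-- The differences of all the bumps of one scale add up to no more than a multiple of one. -/
theorem sum_abs_fwdDiff_arcBump_le {l : ℕ} {A : ℝ} (hA : 1 ≤ A)
    (h : ∀ (c : ℕ), 1 ≤ c → ∀ t x : ℝ, |(fwdDiff t)^[l] (perBump c) x| ≤ A * min 1 (c * |t|) ^ l)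
    {c : ℕ} (hc : 1 ≤ c) (t : ℝ) (x : Circ) :
    ∑ i ∈ Finset.range c, |(fwdDiff (t : Circ))^[l] (arcBump c i) x|
      ≤ (l + 1) * A * min 1 (c * |t|) ^ l := by
  classical
  -- At each of the l + 1 nodes x + kt at most one bump is nonzero, so at most l + 1 indices
  -- contribute, however large c is.
  set T : ℕ → Finset ℕ := fun k =>
    (Finset.range c).filter fun i => arcBump c i (x + k • (t : Circ)) ≠ 0 with hT
  set S := (Finset.range (l + 1)).biUnion T with hS
  have hcard : S.card ≤ l + 1 := by
    refine (Finset.card_biUnion_le_card_mul _ _ 1 fun k _ => ?_).trans (by simp)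
    rw [Finset.card_le_one]
    intro i hi i' hi'
    simp only [hT, Finset.mem_filter, Finset.mem_range] at hi hi'
    exact arcBump_index_eq hc hi.1 hi'.1 hi.2 hi'.2
  have hsub : S ⊆ Finset.range c := by
    intro i hi
    simp only [hS, hT, Finset.mem_biUnion, Finset.mem_filter] at hi
    obtain ⟨_, _, h, _⟩ := hi
    exact h
  have hzero : ∀ i ∈ Finset.range c, i ∉ S → |(fwdDiff (t : Circ))^[l] (arcBump c i) x| = 0 := by
    intro i hi hiS
    rw [fwdDiff_iter_eq_sum_shift, abs_eq_zero]
    refine Finset.sum_eq_zero fun k hk => ?_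
    have : arcBump c i (x + k • (t : Circ)) = 0 := by
      by_contra hne
      apply hiS
      simp only [hS, hT, Finset.mem_biUnion, Finset.mem_filter]
      exact ⟨k, hk, hi, hne⟩
    rw [this, smul_zero]
  rw [← Finset.sum_subset hsub hzero]
  calc _ ≤ ∑ _i ∈ S, A * min 1 (c * |t|) ^ l :=
        Finset.sum_le_sum fun i _ => abs_fwdDiff_arcBump_le hA h hc i t x
    _ = S.card * (A * min 1 (c * |t|) ^ l) := by rw [Finset.sum_const, nsmul_eq_mul]
    _ ≤ (l + 1) * (A * min 1 (c * |t|) ^ l) := by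
        gcongr
        exact_mod_cast hcard
    _ = _ := by ring

/-- The flat top of the bump occupies a quarter of its arc. -/
theorem le_integral_arcBump {c : ℕ} (hc : 1 ≤ c) {i : ℕ} :
    1 / (4 * c : ℝ) ≤ ∫ x, arcBump c i x ∂circMeasure := by
  have hc' : (1 : ℝ) ≤ c := by exact_mod_cast hc
  have hc0 : (0 : ℝ) < c := by linarith
  have hpi := Real.pi_pos
  set a : ℝ := 2 * π * (i / c) with ha
  have hcont : Continuous fun y : ℝ => arcBump c i (y : Circ) :=
    (continuous_arcBump hc i).comp (AddCircle.continuous_mk' _)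
  rw [AddCircle.integral_haarAddCircle, ← AddCircle.intervalIntegral_preimage (2 * π) a,
    smul_eq_mul, ← div_eq_inv_mul, le_div_iff₀ (by positivity)]
  set u : ℝ := a + 2 * π * (3 / (8 * c)) with hu
  set v : ℝ := a + 2 * π * (5 / (8 * c)) with hv
  have huv : u ≤ v := by
    rw [hu, hv]
    gcongr
    norm_num
  have hau : a ≤ u := by rw [hu]; linarith [show (0 : ℝ) ≤ 2 * π * (3 / (8 * c)) by positivity]
  have hva : v ≤ a + 2 * π := by
    rw [hv]
    have : (5 : ℝ) / (8 * c) ≤ 1 := by rw [div_le_one (by positivity)]; linarith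
    nlinarith
  calc 1 / (4 * c : ℝ) * (2 * π) = ∫ _ in u..v, (1 : ℝ) := by
        rw [intervalIntegral.integral_const, smul_eq_mul, hu, hv]
        field_simp
        ring
    _ = ∫ y in u..v, arcBump c i (y : Circ) := by
        refine intervalIntegral.integral_congr fun y hy => ?_
        rw [Set.uIcc_of_le huv, Set.mem_Icc] at hy
        have h1 : 3 / (8 * c) ≤ y / (2 * π) - i / c := by
          rw [le_sub_iff_add_le, le_div_iff₀ (by positivity)]
          linarith [hy.1]
        have h2 : y / (2 * π) - i / c ≤ 5 / (8 * c) := by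
          rw [sub_le_iff_le_add, div_le_iff₀ (by positivity)]
          linarith [hy.2]
        have h3 : Int.fract (y / (2 * π) - i / c) = y / (2 * π) - i / c := by
          rw [Int.fract_eq_self]
          refine ⟨le_trans (by positivity) h1, lt_of_le_of_lt h2 ?_⟩
          rw [div_lt_one (by positivity)]
          linarith
        have h4 : (c : ℝ) * (3 / (8 * c)) = 3 / 8 := by field_simp
        have h5 : (c : ℝ) * (5 / (8 * c)) = 5 / 8 := by field_simp
        rw [arcBump_coe, perBump, h3, unitBump_eq_one]
        · rw [← h4]; gcongr
        · rw [← h5]; gcongr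
    _ ≤ ∫ y in a..a + 2 * π, arcBump c i (y : Circ) := by
        refine intervalIntegral.integral_mono_interval hau huv hva
          (Filter.Eventually.of_forall fun y => arcBump_nonneg _ _ _) (hcont.intervalIntegrable _ _)

/-- The sum of the product bumps over a set of boxes of size `1/c₁ × 1/c₂`. -/
def boxBump (c₁ c₂ : ℕ) (U : Finset (ℕ × ℕ)) (x : Torus 2) : ℝ :=
  ∑ i ∈ U, arcBump c₁ i.1 (x 0) * arcBump c₂ i.2 (x 1)

theorem continuous_boxBump {c₁ c₂ : ℕ} (h₁ : 1 ≤ c₁) (h₂ : 1 ≤ c₂) (U : Finset (ℕ × ℕ)) :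
    Continuous (boxBump c₁ c₂ U) := by
  unfold boxBump
  refine continuous_finsetSum _ fun i _ => ?_
  exact ((continuous_arcBump h₁ _).comp (continuous_apply 0)).mul
    ((continuous_arcBump h₂ _).comp (continuous_apply 1))

theorem boxBump_nonneg (c₁ c₂ : ℕ) (U : Finset (ℕ × ℕ)) (x : Torus 2) : 0 ≤ boxBump c₁ c₂ U x :=
  Finset.sum_nonneg fun _ _ => mul_nonneg (arcBump_nonneg _ _ _) (arcBump_nonneg _ _ _)

theorem le_integral_boxBump {c₁ c₂ : ℕ} (h₁ : 1 ≤ c₁) (h₂ : 1 ≤ c₂) (U : Finset (ℕ × ℕ)) :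
    U.card / (16 * (c₁ * c₂) : ℝ) ≤ ∫ x, boxBump c₁ c₂ U x ∂torusMeasure 2 := by
  have hc₁ : (1 : ℝ) ≤ c₁ := by exact_mod_cast h₁
  have hc₂ : (1 : ℝ) ≤ c₂ := by exact_mod_cast h₂
  have hi : ∀ i ∈ U, Integrable (fun x : Torus 2 => arcBump c₁ i.1 (x 0) * arcBump c₂ i.2 (x 1))
      (torusMeasure 2) := fun i _ => integrable_torus_of_continuous
    (((continuous_arcBump h₁ _).comp (continuous_apply 0)).mul
    ((continuous_arcBump h₂ _).comp (continuous_apply 1)))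
  unfold boxBump
  rw [integral_finsetSum _ hi]
  calc _ = ∑ _i ∈ U, 1 / (4 * c₁ : ℝ) * (1 / (4 * c₂ : ℝ)) := by
        rw [Finset.sum_const, nsmul_eq_mul]
        field_simp
        norm_num
    _ ≤ _ := by
        refine Finset.sum_le_sum fun i _ => ?_
        rw [integral_tensor (arcBump c₁ i.1) (arcBump c₂ i.2)]
        exact mul_le_mul (le_integral_arcBump h₁) (le_integral_arcBump h₂) (by positivity)
          (le_trans (by positivity) (le_integral_arcBump h₁))

/-! ### Mixed differences of sums of box bumps -/

/-- The mixed difference in both variables, of separate orders. -/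
theorem mixedDiff_eq_coordDiff {𝕜 : Type*} [RCLike 𝕜] (l : ℕ) (t : Fin 2 → ℝ)
    (e : Finset (Fin 2)) (f : Torus 2 → 𝕜) :
    mixedDiff l t e f = coordDiff (if 1 ∈ e then l else 0) (t 1) 1
      (coordDiff (if 0 ∈ e then l else 0) (t 0) 0 f) := by
  simp only [mixedDiff, List.finRange_succ, List.finRange_zero, List.map_nil,
    List.map_cons, List.foldl_cons, List.foldl_nil, Fin.succ_zero_eq_one]
  split_ifs <;> rfl

theorem coordDiff_sum {ι : Type*} (I : Finset ι) (l : ℕ) (t : ℝ) (j : Fin 2)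
    (g : ι → Torus 2 → ℝ) :
    coordDiff l t j (fun x => ∑ i ∈ I, g i x) = fun x => ∑ i ∈ I, coordDiff l t j (g i) x := by
  unfold coordDiff
  funext x
  have e : (fun x => ∑ i ∈ I, g i x) = ∑ i ∈ I, g i := by
    funext x; rw [Finset.sum_apply]
  rw [e, fwdDiff_iter_finsetSum, Finset.sum_apply]

theorem coordDiff_const_add_mul (l : ℕ) (t : ℝ) (j : Fin 2) (k κ : ℝ) (g : Torus 2 → ℝ) :
    coordDiff l t j (fun x => k + κ * g x)
      = fun x => (if l = 0 then k else 0) + κ * coordDiff l t j g x := by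
  unfold coordDiff
  induction l with
  | zero => rfl
  | succ l ih =>
    rw [Function.iterate_succ_apply', Function.iterate_succ_apply', ih]
    funext x
    simp only [fwdDiff, Nat.succ_ne_zero, if_false]
    ring

theorem coordDiff_zero_tensor (l : ℕ) (t : ℝ) (a b : Circ → ℝ) :
    coordDiff l t 0 (fun x : Torus 2 => a (x 0) * b (x 1))
      = fun x => (fwdDiff (t : Circ))^[l] a (x 0) * b (x 1) := by
  unfold coordDiff
  induction l with
  | zero => rfl
  | succ l ih =>
    rw [Function.iterate_succ_apply', Function.iterate_succ_apply', ih]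
    funext x
    simp only [fwdDiff, Pi.add_apply, Pi.single_eq_same, Pi.single_eq_of_ne one_ne_zero, add_zero]
    ring

theorem coordDiff_one_tensor (l : ℕ) (t : ℝ) (a b : Circ → ℝ) :
    coordDiff l t 1 (fun x : Torus 2 => a (x 0) * b (x 1))
      = fun x => a (x 0) * (fwdDiff (t : Circ))^[l] b (x 1) := by
  unfold coordDiff
  induction l with
  | zero => rfl
  | succ l ih =>
    rw [Function.iterate_succ_apply', Function.iterate_succ_apply', ih]
    funext x
    simp only [fwdDiff, Pi.add_apply, Pi.single_eq_same, Pi.single_eq_of_ne zero_ne_one, add_zero]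
    ring

theorem mixedDiff_boxBump (l : ℕ) (t : Fin 2 → ℝ) (e : Finset (Fin 2)) (c₁ c₂ : ℕ)
    (U : Finset (ℕ × ℕ)) (x : Torus 2) :
    mixedDiff l t e (boxBump c₁ c₂ U) x
      = ∑ i ∈ U, (fwdDiff (t 0 : Circ))^[if 0 ∈ e then l else 0] (arcBump c₁ i.1) (x 0)
        * (fwdDiff (t 1 : Circ))^[if 1 ∈ e then l else 0] (arcBump c₂ i.2) (x 1) := by
  unfold boxBump
  rw [mixedDiff_eq_coordDiff, coordDiff_sum]
  simp_rw [coordDiff_zero_tensor]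
  rw [coordDiff_sum]
  simp_rw [coordDiff_one_tensor]

/-- Enlarging U to the full grid only increases the sum of absolute values, which then factors into
two one-dimensional sums. The bound is therefore independent of which boxes were kept. -/
theorem exists_mixedDiff_boxBump_le (l : ℕ) : ∃ B : ℝ, 0 < B ∧ ∀ (c₁ c₂ : ℕ), 1 ≤ c₁ → 1 ≤ c₂ →
    ∀ (U : Finset (ℕ × ℕ)), U ⊆ Finset.range c₁ ×ˢ Finset.range c₂ →
    ∀ (t : Fin 2 → ℝ) (e : Finset (Fin 2)) (x : Torus 2),
      |mixedDiff l t e (boxBump c₁ c₂ U) x|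
        ≤ B * (min 1 (c₁ * |t 0|) ^ (if 0 ∈ e then l else 0) *
          min 1 (c₂ * |t 1|) ^ (if 1 ∈ e then l else 0)) := by
  obtain ⟨A, hA, h⟩ := exists_fwdDiff_perBump_le l
  have hif : ∀ (P : Prop) [Decidable P] (c : ℕ), 1 ≤ c → ∀ (t : ℝ) (x : Circ),
      ∑ i ∈ Finset.range c, |(fwdDiff (t : Circ))^[if P then l else 0] (arcBump c i) x|
        ≤ (l + 1) * A * min 1 (c * |t|) ^ (if P then l else 0) := by
    intro P _ c hc t x
    split_ifs
    · exact sum_abs_fwdDiff_arcBump_le hA h hc t x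
    · refine (sum_abs_fwdDiff_arcBump_le (l := 0) hA (fun c hc t x => ?_) hc t x).trans ?_
      · rw [Function.iterate_zero, id, pow_zero, mul_one, abs_of_nonneg (perBump_nonneg c x)]
        exact (perBump_le_one c x).trans hA
      · gcongr
        simp
  refine ⟨((l + 1) * A) ^ 2, by positivity, fun c₁ c₂ h₁ h₂ U hU t e x => ?_⟩
  rw [mixedDiff_boxBump]
  calc _ ≤ ∑ i ∈ U, |(fwdDiff (t 0 : Circ))^[if 0 ∈ e then l else 0] (arcBump c₁ i.1) (x 0)|
        * |(fwdDiff (t 1 : Circ))^[if 1 ∈ e then l else 0] (arcBump c₂ i.2) (x 1)| := by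
        refine (Finset.abs_sum_le_sum_abs _ _).trans (le_of_eq ?_)
        simp only [abs_mul]
    _ ≤ ∑ i ∈ Finset.range c₁ ×ˢ Finset.range c₂,
        |(fwdDiff (t 0 : Circ))^[if 0 ∈ e then l else 0] (arcBump c₁ i.1) (x 0)|
        * |(fwdDiff (t 1 : Circ))^[if 1 ∈ e then l else 0] (arcBump c₂ i.2) (x 1)| :=
        Finset.sum_le_sum_of_subset_of_nonneg hU fun i _ _ => by positivity
    _ = (∑ i ∈ Finset.range c₁,
          |(fwdDiff (t 0 : Circ))^[if 0 ∈ e then l else 0] (arcBump c₁ i) (x 0)|) *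
        ∑ i ∈ Finset.range c₂,
          |(fwdDiff (t 1 : Circ))^[if 1 ∈ e then l else 0] (arcBump c₂ i) (x 1)| := by
        rw [Finset.sum_mul_sum, ← Finset.sum_product']
    _ ≤ ((l + 1) * A * min 1 (c₁ * |t 0|) ^ (if 0 ∈ e then l else 0)) *
        ((l + 1) * A * min 1 (c₂ * |t 1|) ^ (if 1 ∈ e then l else 0)) :=
        mul_le_mul (hif _ _ h₁ _ _) (hif _ _ h₂ _ _)
          (Finset.sum_nonneg fun i _ => abs_nonneg _) (by positivity)
    _ = _ := by ring

/-! ### Summation over the layers without a logarithmic loss -/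

theorem min_one_pow_le_rpow {u r : ℝ} {l : ℕ} (hu : 0 ≤ u) (hr : 0 < r) (hl : r ≤ l) :
    min 1 u ^ l ≤ u ^ r := by
  rcases le_total u 1 with h | h
  · rw [min_eq_right h, ← Real.rpow_natCast]
    exact Real.rpow_le_rpow_of_exponent_ge' hu h hr.le hl
  · rw [min_eq_left h, one_pow]
    exact Real.one_le_rpow h hr.le

/-- The extra factor decays like a power on both sides of u = 1; this is the gain that makes the sum
over dyadic u bounded. It uses the slack l - r for small u and r > 0 for large u. -/
theorem min_one_pow_le_rpow_mul {u r δ : ℝ} {l : ℕ} (hu : 0 ≤ u) (hδ : 0 < δ) (hδr : δ ≤ r)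
    (hl : r + δ ≤ l) : min 1 u ^ l ≤ u ^ r * (4 * (u ^ δ / (1 + u ^ δ) ^ 2)) := by
  have hr : 0 < r := hδ.trans_le hδr
  have hv : 0 ≤ u ^ δ := Real.rpow_nonneg hu _
  have e : u ^ r * (4 * (u ^ δ / (1 + u ^ δ) ^ 2)) = u ^ r * (4 * u ^ δ) / (1 + u ^ δ) ^ 2 := by
    ring
  rw [e, le_div_iff₀ (by positivity)]
  rcases le_total u 1 with h | h
  · rw [min_eq_right h, ← Real.rpow_natCast]
    have h1 : u ^ (l : ℝ) ≤ u ^ r * u ^ δ := by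
      rw [← Real.rpow_add_of_nonneg hu hr.le hδ.le]
      exact Real.rpow_le_rpow_of_exponent_ge' hu h (by positivity) hl
    have h2 : u ^ δ ≤ 1 := Real.rpow_le_one hu h hδ.le
    have h3 : (1 + u ^ δ) ^ 2 ≤ 4 := by nlinarith
    calc _ ≤ u ^ r * u ^ δ * 4 := mul_le_mul h1 h3 (by positivity) (by positivity)
      _ = _ := by ring
  · rw [min_eq_left h, one_pow, one_mul]
    have h1 : u ^ δ ≤ u ^ r := Real.rpow_le_rpow_of_exponent_le h hδr
    have h2 : 1 ≤ u ^ δ := Real.one_le_rpow h hδ.le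
    nlinarith

theorem sum_pow_le_mul_pow {q : ℝ} (hq : 1 < q) (N : ℕ) :
    ∑ a ∈ Finset.range (N + 1), q ^ a ≤ q / (q - 1) * q ^ N := by
  rw [geom_sum_eq hq.ne', div_mul_eq_mul_div]
  refine div_le_div_of_nonneg_right ?_ (by linarith)
  rw [pow_succ']
  linarith

/-- Each term is dominated by an increment of the bounded function w ↦ w/(1+w) between w and qw, so
the sum telescopes. -/
theorem sum_logistic_le {q v : ℝ} (hq : 1 < q) (hv : 0 ≤ v) (N : ℕ) :
    ∑ a ∈ Finset.range N, q ^ a * v / (1 + q ^ a * v) ^ 2 ≤ q / (q - 1) := by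
  have hstep : ∀ w : ℝ, 0 ≤ w → w / (1 + w) ^ 2
      ≤ q / (q - 1) * (q * w / (1 + q * w) - w / (1 + w)) := by
    intro w hw
    have hq1 : 0 < q - 1 := by linarith
    have hqw : 0 ≤ q * w := by positivity
    have e : q / (q - 1) * (q * w / (1 + q * w) - w / (1 + w))
        = q * w / ((1 + q * w) * (1 + w)) := by
      field_simp
      ring
    rw [e, div_le_div_iff₀ (by positivity) (by positivity)]
    have : 0 ≤ w * (1 + w) * (q - 1) := by positivity
    nlinarith
  have hq1 : 0 ≤ q / (q - 1) := div_nonneg (by linarith) (by linarith)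
  calc _ ≤ ∑ a ∈ Finset.range N, q / (q - 1) * (q ^ (a + 1) * v / (1 + q ^ (a + 1) * v)
        - q ^ a * v / (1 + q ^ a * v)) := by
        refine Finset.sum_le_sum fun a _ => (hstep (q ^ a * v) (by positivity)).trans_eq ?_
        rw [pow_succ', mul_assoc]
    _ = q / (q - 1) * (q ^ N * v / (1 + q ^ N * v) - v / (1 + v)) := by
        rw [← Finset.mul_sum, Finset.sum_range_sub (fun a => q ^ a * v / (1 + q ^ a * v)),
          pow_zero, one_mul]
    _ ≤ q / (q - 1) * 1 := by
        refine mul_le_mul_of_nonneg_left ?_ hq1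
        have h1 : q ^ N * v / (1 + q ^ N * v) ≤ 1 := by
          rw [div_le_one (by positivity)]; linarith
        have h2 : 0 ≤ v / (1 + v) := by positivity
        linarith
    _ = _ := mul_one _

theorem rpow_two_pow_mul {s r : ℝ} (hs : 0 ≤ s) (a : ℕ) :
    ((2 : ℝ) ^ a * s) ^ r = (2 ^ r) ^ a * s ^ r := by
  rw [Real.mul_rpow (by positivity) hs, ← Real.rpow_natCast 2 a, ← Real.rpow_mul (by norm_num),
    mul_comm (a : ℝ), Real.rpow_mul (by norm_num), Real.rpow_natCast]

/-- Using only min(1,u)^l ≤ u^r in both variables would give N + 1 equal terms. When both variables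
are differenced, the sharper bound is used in one of them and the logistic sum removes the factor N
+ 1; in the other cases a geometric series suffices. -/
theorem exists_sum_min_one_pow_le {r : ℝ} (hr : 0 < r) {l : ℕ} (hl : r < l) : ∃ C : ℝ, 0 < C ∧
    ∀ (N : ℕ) (t : Fin 2 → ℝ) (e : Finset (Fin 2)),
      ∑ a ∈ Finset.range (N + 1), min 1 ((2 : ℝ) ^ a * |t 0|) ^ (if 0 ∈ e then l else 0) *
        min 1 ((2 : ℝ) ^ (N - a) * |t 1|) ^ (if 1 ∈ e then l else 0)
      ≤ C * (2 ^ r) ^ N * ∏ j ∈ e, |t j| ^ r := by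
  set δ := min (l - r) r with hδ
  have hδ0 : 0 < δ := lt_min (by linarith) hr
  have hδr : δ ≤ r := min_le_right _ _
  have hδl : r + δ ≤ l := by linarith [min_le_left (l - r) r]
  set q := (2 : ℝ) ^ r
  set q' := (2 : ℝ) ^ δ
  have hq : 1 < q := Real.one_lt_rpow (by norm_num) hr
  have hq' : 1 < q' := Real.one_lt_rpow (by norm_num) hδ0
  have hK : 0 < q / (q - 1) := div_pos (by linarith) (by linarith)
  have hK' : 0 < q' / (q' - 1) := div_pos (by linarith) (by linarith)
  have hone : ∀ (N : ℕ) (s : ℝ), 0 ≤ s →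
      ∑ a ∈ Finset.range (N + 1), min 1 ((2 : ℝ) ^ a * s) ^ l ≤ q / (q - 1) * q ^ N * s ^ r := by
    intro N s hs
    calc _ ≤ ∑ a ∈ Finset.range (N + 1), q ^ a * s ^ r := by
          refine Finset.sum_le_sum fun a _ => ?_
          rw [← rpow_two_pow_mul hs]
          exact min_one_pow_le_rpow (by positivity) hr hl.le
      _ ≤ _ := by
          rw [← Finset.sum_mul]
          exact mul_le_mul_of_nonneg_right (sum_pow_le_mul_pow hq N) (Real.rpow_nonneg hs r)
  refine ⟨q / (q - 1) + 4 * (q' / (q' - 1)), by positivity, fun N t e => ?_⟩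
  have hprod : 0 ≤ ∏ j ∈ e, |t j| ^ r := by positivity
  have hweak : ∀ {S : ℝ}, S ≤ q / (q - 1) * q ^ N * ∏ j ∈ e, |t j| ^ r →
      S ≤ (q / (q - 1) + 4 * (q' / (q' - 1))) * q ^ N * ∏ j ∈ e, |t j| ^ r := by
    intro S hS
    have : 0 ≤ 4 * (q' / (q' - 1)) * q ^ N * ∏ j ∈ e, |t j| ^ r := by positivity
    linarith
  have hprod2 : ∏ j ∈ e, |t j| ^ r
      = (if 0 ∈ e then |t 0| ^ r else 1) * (if 1 ∈ e then |t 1| ^ r else 1) := by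
    rw [← Fin.prod_univ_two (fun j => if j ∈ e then |t j| ^ r else 1), Finset.prod_ite_mem,
      Finset.univ_inter]
  by_cases h0 : 0 ∈ e <;> by_cases h1 : 1 ∈ e <;>
    simp only [h0, h1, if_true, if_false, pow_zero, mul_one, one_mul] at hprod2 ⊢
  · rw [hprod2]
    set s := |t 0|
    set s' := |t 1|
    have hs : 0 ≤ s := abs_nonneg _
    have hs' : 0 ≤ s' := abs_nonneg _
    have hS : ∑ a ∈ Finset.range (N + 1), min 1 ((2 : ℝ) ^ a * s) ^ l *
        min 1 ((2 : ℝ) ^ (N - a) * s') ^ l ≤ 4 * (q' / (q' - 1)) * q ^ N * (s ^ r * s' ^ r) := by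
      calc _ ≤ ∑ a ∈ Finset.range (N + 1), 4 * q ^ N * (s ^ r * s' ^ r) *
            (q' ^ a * s ^ δ / (1 + q' ^ a * s ^ δ) ^ 2) := by
            refine Finset.sum_le_sum fun a ha => ?_
            have haN : a ≤ N := by rw [Finset.mem_range] at ha; omega
            have k1 := min_one_pow_le_rpow_mul (u := 2 ^ a * s) (by positivity) hδ0 hδr hδl
            have k2 := min_one_pow_le_rpow (u := 2 ^ (N - a) * s') (by positivity) hr hl.le
            rw [rpow_two_pow_mul hs, rpow_two_pow_mul hs] at k1
            rw [rpow_two_pow_mul hs'] at k2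
            refine (mul_le_mul k1 k2 (by positivity) (by positivity)).trans_eq ?_
            rw [← pow_mul_pow_sub q haN]
            ring
        _ ≤ _ := by
            rw [← Finset.mul_sum]
            refine (mul_le_mul_of_nonneg_left (sum_logistic_le hq' (by positivity) _)
              (by positivity)).trans_eq ?_
            ring
    have : 0 ≤ q / (q - 1) * q ^ N * (s ^ r * s' ^ r) := by positivity
    linarith
  · apply hweak
    rw [hprod2]
    exact hone N _ (abs_nonneg _)
  · apply hweak
    rw [hprod2, ← Finset.sum_range_reflect]
    refine (Finset.sum_le_sum fun a ha => ?_).trans (hone N |t 1| (abs_nonneg _))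
    rw [Finset.mem_range] at ha
    rw [show N - (N + 1 - 1 - a) = a by omega]
  · apply hweak
    rw [hprod2, mul_one]
    refine le_trans (Finset.sum_le_sum fun a _ => ?_) (sum_pow_le_mul_pow hq N)
    exact one_le_pow₀ hq.le

/-! ### The fooling function and the lower bound -/

/-- At each point at most one product bump is nonzero, so discarding at most m boxes is enough. -/
theorem exists_boxes_vanishing {m : ℕ} (ξ : Fin m → Torus 2) {c₁ c₂ : ℕ} (h₁ : 1 ≤ c₁)
    (h₂ : 1 ≤ c₂) : ∃ U ⊆ Finset.range c₁ ×ˢ Finset.range c₂, c₁ * c₂ ≤ m + U.card ∧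
      ∀ j, boxBump c₁ c₂ U (ξ j) = 0 := by
  classical
  set R := Finset.range c₁ ×ˢ Finset.range c₂
  let hit : Fin m → Finset (ℕ × ℕ) := fun j =>
    R.filter fun i => arcBump c₁ i.1 (ξ j 0) * arcBump c₂ i.2 (ξ j 1) ≠ 0
  have hhit : ∀ j ∈ (Finset.univ : Finset (Fin m)), (hit j).card ≤ 1 := by
    intro j _
    rw [Finset.card_le_one]
    intro i hi i' hi'
    simp only [hit, R, Finset.mem_filter, Finset.mem_product, Finset.mem_range] at hi hi'
    exact Prod.ext
      (arcBump_index_eq h₁ hi.1.1 hi'.1.1 (left_ne_zero_of_mul hi.2) (left_ne_zero_of_mul hi'.2))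
      (arcBump_index_eq h₂ hi.1.2 hi'.1.2 (right_ne_zero_of_mul hi.2) (right_ne_zero_of_mul hi'.2))
  have hcard := Finset.card_biUnion_le_card_mul Finset.univ hit 1 hhit
  rw [Finset.card_univ, Fintype.card_fin, mul_one] at hcard
  refine ⟨R \ Finset.univ.biUnion hit, Finset.sdiff_subset, ?_, fun j => ?_⟩
  · have h3 := Finset.le_card_sdiff (Finset.univ.biUnion hit) R
    have h4 : R.card = c₁ * c₂ := by
      rw [Finset.card_product, Finset.card_range, Finset.card_range]
    omega
  · refine Finset.sum_eq_zero fun i hi => ?_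
    rw [Finset.mem_sdiff, Finset.mem_biUnion] at hi
    by_contra hne
    exact hi.2 ⟨j, Finset.mem_univ j, Finset.mem_filter.2 ⟨hi.1, hne⟩⟩

/-- A sum of `N + 1` layers of bumps, vanishing at the given points, that belongs, after scaling
and adding a constant, to the class `H^r_p` for every `p`. -/
theorem exists_bump_mem_classH {𝕜 : Type*} [RCLike 𝕜] {r : ℝ} (hr : 0 < r) :
    ∃ κ : ℝ, 0 < κ ∧ ∀ (m N : ℕ) (ξ : Fin m → Torus 2), 2 * m ≤ 2 ^ N →
      ∃ G : Torus 2 → ℝ, Continuous G ∧ (∀ x, 0 ≤ G x) ∧ (∀ j, G (ξ j) = 0) ∧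
        ((N : ℝ) + 1) / 32 ≤ ∫ x, G x ∂torusMeasure 2 ∧
        ∃ f : C(Torus 2, 𝕜), (∀ x, f x = ((1 / 2 + κ / (2 ^ r) ^ N * G x : ℝ) : 𝕜)) ∧
          ∀ p : ℝ≥0∞, f ∈ classH 𝕜 2 r p := by
  set l := ⌊r⌋₊ + 1 with hl
  have hrl : r < l := by rw [hl]; push_cast; exact Nat.lt_floor_add_one r
  obtain ⟨B, hB, hBump⟩ := exists_mixedDiff_boxBump_le l
  obtain ⟨C, hC, hsum⟩ := exists_sum_min_one_pow_le hr hrl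
  refine ⟨1 / (2 * (B * C)), by positivity, fun m N ξ hm => ?_⟩
  have hpow : ∀ a : ℕ, 1 ≤ 2 ^ a := fun a => Nat.one_le_two_pow
  choose U hUs hUc hU0 using fun a : ℕ =>
    exists_boxes_vanishing ξ (hpow a) (hpow (N - a))
  set G : Torus 2 → ℝ := fun x => ∑ a ∈ Finset.range (N + 1),
    boxBump (2 ^ a) (2 ^ (N - a)) (U a) x with hG
  have hGc : Continuous G :=
    continuous_finsetSum _ fun a _ => continuous_boxBump (hpow a) (hpow (N - a)) (U a)
  have hQ : (0 : ℝ) < (2 ^ r) ^ N := by positivity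
  -- The scaling gives the bumps half of the allowed bound; the other half is for the constant 1/2,
  -- which is seen only by e = ∅.
  set κ' := 1 / (2 * (B * C)) / (2 ^ r) ^ N with hκ'
  have hκ0 : 0 < κ' := by positivity
  have hdiffG : ∀ (t : Fin 2 → ℝ) (e : Finset (Fin 2)) (x : Torus 2),
      κ' * |mixedDiff l t e G x| ≤ 1 / 2 * ∏ j ∈ e, |t j| ^ r := by
    intro t e x
    have e1 : mixedDiff l t e G x = ∑ a ∈ Finset.range (N + 1),
        mixedDiff l t e (boxBump (2 ^ a) (2 ^ (N - a)) (U a)) x := by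
      simp only [mixedDiff_eq_coordDiff]
      rw [hG, coordDiff_sum, coordDiff_sum]
    have e2 : |mixedDiff l t e G x| ≤ B * (C * (2 ^ r) ^ N * ∏ j ∈ e, |t j| ^ r) := by
      rw [e1]
      refine (Finset.abs_sum_le_sum_abs _ _).trans ?_
      refine le_trans ?_ (mul_le_mul_of_nonneg_left (hsum N t e) hB.le)
      rw [Finset.mul_sum]
      refine Finset.sum_le_sum fun a _ => ?_
      have := hBump _ _ (hpow a) (hpow (N - a)) (U a) (hUs a) t e x
      push_cast at this
      exact this
    refine (mul_le_mul_of_nonneg_left e2 hκ0.le).trans_eq ?_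
    rw [hκ']
    field_simp
  have hdiff : ∀ (t : Fin 2 → ℝ) (e : Finset (Fin 2)) (x : Torus 2),
      |mixedDiff l t e (fun x => 1 / 2 + κ' * G x) x| ≤ ∏ j ∈ e, |t j| ^ r := by
    intro t e x
    have hl0 : l ≠ 0 := by omega
    have e1 : mixedDiff l t e (fun x => 1 / 2 + κ' * G x) x
        = (if e = ∅ then 1 / 2 else 0) + κ' * mixedDiff l t e G x := by
      simp only [mixedDiff_eq_coordDiff, coordDiff_const_add_mul]
      congr 1
      have he : e = ∅ ↔ 0 ∉ e ∧ 1 ∉ e := by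
        rw [Finset.eq_empty_iff_forall_notMem, Fin.forall_fin_two]
      by_cases h0 : 0 ∈ e <;> by_cases h1 : 1 ∈ e <;> simp [he, h0, h1, hl0]
    have e2 : |if e = ∅ then (1 / 2 : ℝ) else 0| ≤ 1 / 2 * ∏ j ∈ e, |t j| ^ r := by
      split_ifs with he
      · rw [he, Finset.prod_empty]; norm_num
      · rw [abs_zero]; positivity
    rw [e1]
    refine (abs_add_le _ _).trans ?_
    rw [abs_mul, abs_of_pos hκ0]
    linarith [hdiffG t e x]
  refine ⟨G, hGc, fun x => Finset.sum_nonneg fun a _ => boxBump_nonneg _ _ _ _,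
    fun j => Finset.sum_eq_zero fun a _ => hU0 a j, ?_,
    ⟨fun x => ((1 / 2 + κ' * G x : ℝ) : 𝕜), RCLike.continuous_ofReal.comp (by fun_prop)⟩,
    fun x => rfl, fun p e t => ?_⟩
  · rw [hG, integral_finsetSum _ fun a _ => integrable_torus_of_continuous
      (continuous_boxBump (hpow a) (hpow (N - a)) (U a))]
    calc ((N : ℝ) + 1) / 32 = ∑ _a ∈ Finset.range (N + 1), (1 / 32 : ℝ) := by
          rw [Finset.sum_const, Finset.card_range, nsmul_eq_mul]
          push_cast
          ring
      _ ≤ _ := by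
          refine Finset.sum_le_sum fun a ha => ?_
          have haN : a ≤ N := by rw [Finset.mem_range] at ha; omega
          refine le_trans ?_ (le_integral_boxBump (hpow a) (hpow (N - a)) (U a))
          have h1 : 2 ^ a * 2 ^ (N - a) = 2 ^ N := pow_mul_pow_sub 2 haN
          have h2 : 2 ^ N ≤ 2 * (U a).card := by have := hUc a; omega
          have h3 : ((2 ^ a : ℕ) : ℝ) * ((2 ^ (N - a) : ℕ) : ℝ) = 2 ^ N := by exact_mod_cast h1
          have h4 : (2 : ℝ) ^ N ≤ 2 * (U a).card := by exact_mod_cast h2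
          rw [h3, div_le_div_iff₀ (by norm_num) (by positivity)]
          linarith
  · change eLpNorm (mixedDiff l t e fun x => ((1 / 2 + κ' * G x : ℝ) : 𝕜)) p (torusMeasure 2) ≤ _
    rw [← comp_mixedDiff (φ := (RCLike.ofReal : ℝ → 𝕜)) RCLike.ofReal_sub]
    refine (eLpNorm_le_of_ae_bound (C := ∏ j ∈ e, |t j| ^ r)
      (Filter.Eventually.of_forall fun x => ?_)).trans_eq ?_
    · rw [RCLike.norm_ofReal]
      exact hdiff t e x
    · rw [measure_univ, ENNReal.one_rpow, one_mul]

/-- Because of the constant term, (1/2 + κ'G)² = 1/4 + κ'G + (κ'G)², and at the points only 1/4 is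
seen. The cross term alone yields the rate m^{-r} log m. -/
theorem exists_le_er_classH {𝕜 : Type*} [RCLike 𝕜] {r : ℝ} (hr : 0 < r) :
    ∃ c : ℝ, 0 < c ∧ ∀ (p : ℝ≥0∞) (m : ℕ), 2 ≤ m →
      ENNReal.ofReal (c * ((m : ℝ) ^ (-r) * Real.log m))
        ≤ er (torusMeasure 2) 2 (classH 𝕜 2 r p) m := by
  obtain ⟨κ, hκ, h⟩ := exists_bump_mem_classH (𝕜 := 𝕜) hr
  refine ⟨κ * (4 : ℝ) ^ (-r) / 32, by positivity, fun p m hm => le_iInf fun ξ => ?_⟩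
  have hm0 : (0 : ℝ) < m := by exact_mod_cast (by omega : 0 < m)
  set k := Nat.log 2 m with hk
  have hkle : 2 ^ k ≤ m := Nat.pow_log_le_self 2 (by omega)
  have hklt : m < 2 ^ (k + 1) := Nat.lt_pow_succ_log_self (by norm_num) m
  -- With 2^k ≤ m < 2^{k+1}, the choice N = k + 2 gives 2m ≤ 2^N ≤ 4m; the upper bound is the source
  -- of 4^{-r} in the constant.
  obtain ⟨G, hGc, hG0, hGξ, hGint, f, hf, hmem⟩ := h m (k + 2) ξ (by rw [pow_succ]; omega)
  set κ' := κ / (2 ^ r) ^ (k + 2) with hκ'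
  have hκ0 : 0 < κ' := by positivity
  have hnorm : ∀ x, ‖f x‖ ^ (2 : ℝ) = (1 / 2 + κ' * G x) ^ 2 := by
    intro x
    rw [hf, RCLike.norm_ofReal, Real.rpow_two, sq_abs]
  have hint : ∀ {g : Torus 2 → ℝ}, Continuous g → Integrable g (torusMeasure 2) :=
    fun hg => integrable_torus_of_continuous hg
  have hlow : κ' * ((((k + 2 : ℕ) : ℝ) + 1) / 32) ≤ (∫ x, ‖f x‖ ^ (2 : ℝ) ∂torusMeasure 2)
      - (1 / (m : ℝ)) * ∑ j, ‖f (ξ j)‖ ^ (2 : ℝ) := by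
    have e1 : (1 / (m : ℝ)) * ∑ j, ‖f (ξ j)‖ ^ (2 : ℝ) = 1 / 4 := by
      simp only [hnorm, hGξ, mul_zero, add_zero, Finset.sum_const, Finset.card_univ,
        Fintype.card_fin, nsmul_eq_mul]
      field_simp
      norm_num
    have e2 : 1 / 4 + κ' * ∫ x, G x ∂torusMeasure 2 ≤ ∫ x, ‖f x‖ ^ (2 : ℝ) ∂torusMeasure 2 := by
      calc _ = ∫ x, (1 / 4 + κ' * G x) ∂torusMeasure 2 := by
            rw [integral_add (integrable_const _) (hint (by fun_prop)), integral_const_mul]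
            simp
        _ ≤ _ := by
            simp only [hnorm]
            refine integral_mono (hint (by fun_prop)) (hint (by fun_prop)) fun x => ?_
            have := sq_nonneg (κ' * G x)
            simp only
            linarith
    rw [e1]
    have := mul_le_mul_of_nonneg_left hGint hκ0.le
    linarith
  have hmain : κ * (4 : ℝ) ^ (-r) / 32 * ((m : ℝ) ^ (-r) * Real.log m)
      ≤ κ' * ((((k + 2 : ℕ) : ℝ) + 1) / 32) := by
    have e1 : (4 : ℝ) ^ (-r) * (m : ℝ) ^ (-r) ≤ 1 / (2 ^ r) ^ (k + 2) := by
      rw [← Real.mul_rpow (by norm_num) hm0.le, Real.rpow_neg (by positivity), ← one_div]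
      refine one_div_le_one_div_of_le (by positivity) ?_
      rw [← Real.rpow_natCast, ← Real.rpow_mul (by norm_num), mul_comm,
        Real.rpow_mul (by norm_num), Real.rpow_natCast]
      refine Real.rpow_le_rpow (by positivity) ?_ hr.le
      rw [pow_add]
      have : (2 : ℝ) ^ k ≤ m := by exact_mod_cast hkle
      linarith
    have e2 : Real.log m ≤ ((k + 2 : ℕ) : ℝ) + 1 := by
      have h1 : Real.log m ≤ Real.log (2 ^ (k + 1)) :=
        Real.log_le_log hm0 (by exact_mod_cast hklt.le)
      rw [Real.log_pow] at h1
      have h2 : Real.log 2 ≤ 1 := by linarith [Real.log_two_lt_d9]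
      have h3 : ((k + 1 : ℕ) : ℝ) * Real.log 2 ≤ ((k + 1 : ℕ) : ℝ) * 1 :=
        mul_le_mul_of_nonneg_left h2 (by positivity)
      push_cast at h1 h3 ⊢
      linarith
    have e3 : 0 ≤ Real.log m := Real.log_nonneg (by exact_mod_cast (by omega : 1 ≤ m))
    have e4 := mul_le_mul e1 e2 e3 (by positivity)
    have e5 := mul_le_mul_of_nonneg_left e4 (by positivity : 0 ≤ κ / 32)
    rw [hκ']
    calc _ = κ / 32 * ((4 : ℝ) ^ (-r) * (m : ℝ) ^ (-r) * Real.log m) := by ring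
      _ ≤ _ := e5
      _ = _ := by ring
  refine le_trans (ENNReal.ofReal_le_ofReal ?_)
    (le_iSup₂ (f := fun (f : C(Torus 2, 𝕜)) (_ : f ∈ classH 𝕜 2 r p) => ENNReal.ofReal
      |(∫ x, ‖f x‖ ^ (2 : ℝ) ∂torusMeasure 2) - (1 / (m : ℝ)) * ∑ j, ‖f (ξ j)‖ ^ (2 : ℝ)|)
      f (hmem p))
  exact (hmain.trans hlow).trans (le_abs_self _)

end

theorem theorem5p3 {𝕜 : Type*} [RCLike 𝕜] (p : ℝ≥0∞) (hp : 1 ≤ p)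
    (r : ℝ) (hr : 1 / p < ENNReal.ofReal r) :
    ∃ c C : ℝ, 0 < c ∧ 0 < C ∧ ∀ n : ℕ, 2 ≤ n →
      ENNReal.ofReal (c * ((fibB n : ℝ) ^ (-r) * Real.log (fibB n)))
          ≤ er (torusMeasure 2) 2 (classH 𝕜 2 r p) (fibB n) ∧
      er (torusMeasure 2) 2 (classH 𝕜 2 r p) (fibB n)
          ≤ ENNReal.ofReal (C * ((fibB n : ℝ) ^ (-r) * Real.log (fibB n))) ∧
      samplingError (torusMeasure 2) 2 (classH 𝕜 2 r p) (fibPoint n)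
          ≤ ENNReal.ofReal (C * ((fibB n : ℝ) ^ (-r) * Real.log (fibB n))) := by
  have hr0 : 0 < r := by
    by_contra hcon
    rw [ENNReal.ofReal_of_nonpos (not_lt.1 hcon)] at hr
    exact not_lt_bot hr
  obtain ⟨c, hc, hlow⟩ := exists_le_er_classH (𝕜 := 𝕜) hr0
  obtain ⟨C, hC, hup⟩ := samplingError_fibPoint_le (𝕜 := 𝕜) hp hr
  exact ⟨c, C, hc, hC, fun n hn =>
    ⟨hlow p _ (two_le_fibB hn), (iInf_le _ (fibPoint n)).trans (hup n hn), hup n hn⟩⟩
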